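/- Let $0<T<\infty$ and let $u=(u_1,u_2,u_3)$ be a Leray–Hopf weak solution on $[0,T]$ of the Navier–Stokes equations $$u_t-\Delta u+u\cdot\nabla u+\nabla \Pi=0,\qquad \operatorname{div}u=0,\qquad u|_{t=0}=u_0\qquad\text{in }\mathbb{R}^3,$$ with $u_0\in L^2(\mathbb{R}^3)$, $\operatorname{div}u_0=0$. That is, $u\in L^\infty(0,T;L^2(\mathbb{R}^3))$, $\nabla u\in L^2(0,T;L^2(\mathbb{R}^3))$, $u$ is weakly continuous from $[0,T]$ to $L^2(\mathbb{R}^3)$ with $u(0)=u_0$, $u$ is divergence-free and satisfies the equations in the sense of distributions (tested with smooth divergence-free fields compactly supported in $[0,T)\times\mathbb{R}^3$), and for all $t\in[0,T]$ $$\tfrac12\|u(t)\|_{L^2}^2+\int_0^t\|\nabla u\|_{L^2}^2\,ds\le\tfrac12\|u_0\|_{L^2}^2 .$$ Write $u_h=(u_1,u_2)$ for the horizontal velocity, $\nabla u_h$ for its full spatial gradient, and $L^p(0,T;X)$ for the measurable functions $f$ on $(0,T)$ with values in $X$ such that $\|f\|_X\in L^p(0,T)$. Let $B^s_{3,\infty}(\mathbb{R}^3)$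 be the inhomogeneous Besov space with norm $\sup_{j\ge-1}2^{js}\|\Delta_jf\|_{L^3}$, where $\Delta_j$ are the inhomogeneous Littlewood–Paley blocks. Suppose that one of the following four conditions holds: 1. $u_h\in L^{p_1}(0,T;L^{q_1}(\mathbb{R}^3))\cap L^4(0,T;L^4(\mathbb{R}^3))$ and $u_3\in L^{p_2}(0,T;L^{q_2}(\mathbb{R}^3))$ for some $p_1,p_2,q_1,q_2\in[1,\infty]$ with $\frac1{p_1}+\frac1{p_2}=\frac12$ and $\frac1{q_1}+\frac1{q_2}=\frac12$; 2. $u_h\in L^p(0,T;L^q(\mathbb{R}^3))$ for some $p\in[1,\infty]$ and $3\le q<\infty$ with $\frac2p+\frac3q=1$; 3. $\nabla u_h\in L^p(0,T;L^q(\mathbb{R}^3))$ for some $p\in[1,\infty]$ and $\frac32\le q<\infty$ with $\frac2p+\frac3q=2$; 4. $u_h\in L^3(0,T;B^\alpha_{3,\infty}(\mathbb{R}^3))$ and $u_3\in L^3(0,T;B^\beta_{3,\infty}(\mathbb{R}^3))$ for some $\frac13\le\alpha\le\frac12$ and $\beta\ge\frac{1-\alpha}2$. Then the energy equality holds: for every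 $t\in[0,T]$, in particular for $t=T$, $$\tfrac12\|u(t)\|_{L^2(\mathbb{R}^3)}^2+\int_0^t\|\nabla u\|_{L^2(\mathbb{R}^3)}^2\,ds=\tfrac12\|u_0\|_{L^2(\mathbb{R}^3)}^2 .$$ -/

import Mathlib

open MeasureTheory Set
open scoped ENNReal ContDiff FourierTransform

noncomputable section

namespace AnisoNS

/-- Euclidean three-space. -/
abbrev E3 : Type := EuclideanSpace ℝ (Fin 3)

/-! ### Calculus on three-space -/

/-- The partial derivative `∂ⱼ f (x)`. -/
def pd (j : Fin 3) (f : E3 → ℝ) (x : E3) : ℝ :=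
  fderiv ℝ f x (EuclideanSpace.single j 1)

/-- The (classical) divergence of a smooth vector field. -/
def divergence (v : E3 → E3) (x : E3) : ℝ :=
  ∑ i, pd i (fun y => v y i) x

/-- `div v = 0` in the sense of distributions. -/
def IsWeaklyDivFree (v : E3 → E3) : Prop :=
  ∀ φ : E3 → ℝ, ContDiff ℝ ∞ φ → HasCompactSupport φ →
    ∫ x, ∑ i, v x i * pd i φ x = 0

/-- `G` is the weak gradient of the vector field `v`: the entry `G x (i, j)` is the weak partial
derivative `∂ⱼ vᵢ`. The norm of `G x` as an element of `EuclideanSpace ℝ (Fin 3 × Fin 3)` is the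
Frobenius norm of the gradient matrix. -/
def IsWeakGradient (v : E3 → E3) (G : E3 → EuclideanSpace ℝ (Fin 3 × Fin 3)) : Prop :=
  ∀ φ : E3 → ℝ, ContDiff ℝ ∞ φ → HasCompactSupport φ → ∀ i j : Fin 3,
    ∫ x, v x i * pd j φ x = - ∫ x, G x (i, j) * φ x

/-! ### Function spaces on space-time -/

section Spaces

variable {F : Type*} [NormedAddCommGroup F] [NormedSpace ℝ F]

/-- Membership in `L^p(0, T; X)`, where `X` is a space of functions on three-space with (extended)
norm `N`: the function is measurable on `(0, T) × ℝ³` and `t ↦ N (f t)` lies in `L^p(0, T)`. -/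
def MemBochner (N : (E3 → F) → ℝ≥0∞) (p : ℝ≥0∞) (T : ℝ) (f : ℝ → E3 → F) : Prop :=
  AEStronglyMeasurable (fun z : ℝ × E3 => f z.1 z.2)
      ((volume.restrict (Ioo 0 T)).prod volume) ∧
    eLpNorm (fun t => N (f t)) p (volume.restrict (Ioo 0 T)) < ⊤

/-- Membership in `L^p(0, T; L^q(ℝ³))`, for `p, q ∈ [1, ∞]`. -/
def MemLpLq (p q : ℝ≥0∞) (T : ℝ) (f : ℝ → E3 → F) : Prop :=
  MemBochner (fun g => eLpNorm g q volume) p T f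

end Spaces

/-! ### Littlewood–Paley blocks and Besov spaces -/

/-- A dyadic partition of unity `(ϱ, φ)` as used in Littlewood–Paley theory. -/
structure DyadicPartition where
  /-- the low-frequency cut-off -/
  rho : E3 → ℝ
  /-- the profile of the dyadic shells -/
  phi : E3 → ℝ
  rho_smooth : ContDiff ℝ ∞ rho
  phi_smooth : ContDiff ℝ ∞ phi
  rho_nonneg : ∀ ξ, 0 ≤ rho ξ
  phi_nonneg : ∀ ξ, 0 ≤ phi ξ
  rho_radial : ∀ ξ η, ‖ξ‖ = ‖η‖ → rho ξ = rho η
  phi_radial : ∀ ξ η, ‖ξ‖ = ‖η‖ → phi ξ = phi η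
  rho_support : ∀ ξ, rho ξ ≠ 0 → ‖ξ‖ ≤ 4 / 3
  phi_support : ∀ ξ, phi ξ ≠ 0 → 3 / 4 ≤ ‖ξ‖ ∧ ‖ξ‖ ≤ 8 / 3
  inhom_sum : ∀ ξ, HasSum (fun j : ℕ => phi ((2 : ℝ) ^ (-(j : ℤ)) • ξ)) (1 - rho ξ)
  hom_sum : ∀ ξ, ξ ≠ 0 → HasSum (fun j : ℤ => phi ((2 : ℝ) ^ (-j) • ξ)) 1

/-- The inverse Fourier transform of a real radial function; it is real-valued, and we record it
as a real function by taking the real part. -/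
def invFourierReal (m : E3 → ℝ) (x : E3) : ℝ :=
  (𝓕⁻ (fun ξ : E3 => (m ξ : ℂ)) x).re

section Besov

variable {F : Type*} [NormedAddCommGroup F] [NormedSpace ℝ F]

/-- The inhomogeneous dyadic blocks: `Δⱼ f = 0` for `j ≤ -2`, `Δ₋₁ f = h̃ * f` with
`h̃ = 𝓕⁻¹ ϱ`, and `Δⱼ f = 2^{3j} h(2^j ·) * f` with `h = 𝓕⁻¹ φ` for `j ≥ 0`. -/
def lpBlock (P : DyadicPartition) (j : ℤ) (f : E3 → F) (x : E3) : F :=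
  if j ≤ -2 then 0
  else if j = -1 then ∫ y, invFourierReal P.rho y • f (x - y)
  else (2 : ℝ) ^ (3 * j) • ∫ y, invFourierReal P.phi ((2 : ℝ) ^ j • y) • f (x - y)

/-- The inhomogeneous Besov norm `‖f‖_{B^s_{p,∞}} = sup_j 2^{js} ‖Δⱼ f‖_{L^p}`. -/
def besovNorm (P : DyadicPartition) (s : ℝ) (p : ℝ≥0∞) (f : E3 → F) : ℝ≥0∞ :=
  ⨆ j : ℤ, ENNReal.ofReal ((2 : ℝ) ^ ((j : ℝ) * s)) * eLpNorm (lpBlock P j f) p volume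

/-- Membership in `L^r(0, T; B^s_{p,∞}(ℝ³))`. -/
def MemLpBesov (P : DyadicPartition) (r : ℝ≥0∞) (s : ℝ) (p : ℝ≥0∞) (T : ℝ)
    (f : ℝ → E3 → F) : Prop :=
  MemBochner (besovNorm P s p) r T f

end Besov

/-! ### Leray–Hopf weak solutions -/

/-- Admissible test fields on `[0, T) × ℝ³`: smooth, compactly supported (the support may meet
`t = 0`, but not `t = T`) and divergence-free in space. -/
structure IsTestField (T : ℝ) (φ : ℝ → E3 → E3) : Prop where
  smooth : ContDiff ℝ ∞ (fun z : ℝ × E3 => φ z.1 z.2)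
  compact_support : HasCompactSupport (fun z : ℝ × E3 => φ z.1 z.2)
  support_lt : tsupport (fun z : ℝ × E3 => φ z.1 z.2) ⊆ Iio T ×ˢ univ
  div_free : ∀ t x, divergence (φ t) x = 0

/-- The integrand `u · ∂ₜφ + ∑ᵢⱼ uᵢ uⱼ ∂ⱼφᵢ - ∑ᵢⱼ ∂ⱼuᵢ ∂ⱼφᵢ` of the weak formulation. -/
def weakIntegrand (u : ℝ → E3 → E3) (Du : ℝ → E3 → EuclideanSpace ℝ (Fin 3 × Fin 3))
    (φ : ℝ → E3 → E3) (t : ℝ) (x : E3) : ℝ :=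
  (∑ i, u t x i * deriv (fun s => φ s x i) t)
    + (∑ i, ∑ j, u t x i * u t x j * pd j (fun y => φ t y i) x)
    - ∑ i, ∑ j, Du t x (i, j) * pd j (fun y => φ t y i) x

/-- `u` is a Leray–Hopf weak solution on `[0, T]` of the Navier–Stokes equations
`∂ₜu - Δu + u·∇u + ∇Π = 0`, `div u = 0` in three-space with initial velocity `u₀`, and `Du` is
its spatial weak gradient. -/
structure IsLerayHopf (T : ℝ) (u₀ : E3 → E3) (u : ℝ → E3 → E3)
    (Du : ℝ → E3 → EuclideanSpace ℝ (Fin 3 × Fin 3)) : Prop where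
  init_memLp : MemLp u₀ 2 volume
  init_divFree : IsWeaklyDivFree u₀
  /-- `u(t) ∈ L²` for every `t ∈ [0, T]` -/
  memLp : ∀ t ∈ Icc 0 T, MemLp (u t) 2 volume
  /-- `u ∈ L^∞(0, T; L²)` -/
  energy_class : MemLpLq ⊤ 2 T u
  /-- `∇u ∈ L²(0, T; L²)` -/
  grad_class : MemLpLq 2 2 T Du
  weak_gradient : ∀ᵐ t ∂(volume.restrict (Ioo 0 T)), IsWeakGradient (u t) (Du t)
  div_free : ∀ᵐ t ∂(volume.restrict (Ioo 0 T)), IsWeaklyDivFree (u t)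
  /-- `u` is weakly continuous from `[0, T]` to `L²` -/
  weak_continuous : ∀ w : E3 → E3, MemLp w 2 volume →
    ContinuousOn (fun t => ∫ x, inner ℝ (u t x) (w x)) (Icc 0 T)
  initial_value : u 0 =ᵐ[volume] u₀
  /-- the momentum equation in the sense of distributions, tested with divergence-free fields -/
  momentum : ∀ φ : ℝ → E3 → E3, IsTestField T φ →
    ∫ t in Ioo 0 T, ∫ x, weakIntegrand u Du φ t x = - ∫ x, inner ℝ (u₀ x) (φ 0 x)
  /-- the energy inequality -/
  energy_inequality : ∀ t ∈ Icc 0 T,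
    1 / 2 * (∫ x, ‖u t x‖ ^ 2) + ∫ s in Ioo 0 t, ∫ x, ‖Du s x‖ ^ 2
      ≤ 1 / 2 * ∫ x, ‖u₀ x‖ ^ 2

/-- The horizontal velocity `u_h = (u₁, u₂)`. -/
def horizontal (u : ℝ → E3 → E3) (t : ℝ) (x : E3) : EuclideanSpace ℝ (Fin 2) :=
  WithLp.toLp 2 fun i => u t x i.castSucc

/-- The vertical velocity `u₃`. -/
def vertical (u : ℝ → E3 → E3) (t : ℝ) (x : E3) : ℝ :=
  u t x 2

/-- The gradient `∇u_h` of the horizontal velocity: the first two rows of `∇u`. -/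
def horizontalGrad (Du : ℝ → E3 → EuclideanSpace ℝ (Fin 3 × Fin 3)) (t : ℝ) (x : E3) :
    EuclideanSpace ℝ (Fin 2 × Fin 3) :=
  WithLp.toLp 2 fun k => Du t x (k.1.castSucc, k.2)

end AnisoNS

end

noncomputable section

namespace AnisoNS

open Filter Topology

/-! ### Convolution of real functions on three-space -/

/-! Let `S l` be mollification at scale `1/l`. Testing the momentum equation with the twice
mollified solution gives a balance for the resolved energy: `‖S u(t)‖² - ‖S u(0)‖² = 2 ∫₀ᵗ (flux -
dissipation)`, where the flux is `∑ᵢⱼ ∫ S(uᵢ uⱼ) ∂ⱼ S uᵢ` (`IsLerayHopf.resolved_energy_balance`).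
As `l → ∞` the resolved energies and the dissipation converge to the terms of the energy equality.
At almost every time `u(s)` is in `H¹ ⊆ L⁴`, so `u ⊗ u` is in `L²` and the flux tends to `∑ᵢⱼ ∫ uᵢ
uⱼ ∂ⱼuᵢ = 0` (`IsSolenoidalH1.tendsto_flux`). What remains is to exchange this limit with the time
integral, and for that a time-integrable majorant of the flux, uniform in `l`, suffices
(`HasFluxBound`, `IsLerayHopf.energy_equality_of_flux_bound`). The four conditions serve only to
produce such a majorant.

The anisotropy enters through incompressibility. The only term of the flux without a horizontal
component is `u₃ u₃ ∂₃u₃`, and `∂₃u₃ = -(∂₁u₁ + ∂₂u₂)` supplies one. Three estimates follow.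
`IsSolenoidalH1.enorm_flux_le` uses Hölder's inequality, after moving the derivative from `u_h` onto
`u₃²` in the vertical term; it serves conditions 1 and 2. `IsSolenoidalH1.enorm_flux_le_grad` puts
the derivative on `u_h` in every term, including `u₃ uⱼ ∂ⱼu₃`, where a commutator argument replaces
the integration by parts that mollification obstructs; it serves condition 3.
`IsSolenoidalH1.enorm_flux_le_increments` is the Constantin–E–Titi estimate, which bounds the flux
by `l` times three `L³` increments over distance `1/l`; it serves condition 4 once Besov regularity
has been turned into increments (`exists_increment_le_besovNorm`). In conditions 2 and 3 the
remaining velocity factors are interpolated between the energy bound and the Sobolev bound in `L⁶`,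
and Hölder's inequality in time closes at exactly the stated scaling.

The balance itself needs care, since `u(t')` is not an admissible test field and `u` is not
differentiable in time. Smooth compactly supported solenoidal fields are dense in the solenoidal
part of `L²` (`exists_smoothSolenoidal_approx`), so the time-integrated momentum equation can be
tested with the twice mollified slice `u(t')` for each fixed `t'`. The resolved inner product of
`u(t)` and `u(t')` is symmetric, and a telescoping argument along the diagonal
(`sub_eq_two_mul_integral_diag`) sets `t' = t`. -/

/-- The convolution of two real functions on three-space. -/
def conv (K f : E3 → ℝ) (x : E3) : ℝ := ∫ y, K y * f (x - y)

/-- The `L¹`-normalised dilation `λ³ K(λ ·)`. -/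
def dil (l : ℝ) (K : E3 → ℝ) (x : E3) : ℝ := l ^ 3 * K (l • x)

lemma conv_eq_convolution (K f : E3 → ℝ) :
    conv K f = convolution K f (ContinuousLinearMap.mul ℝ ℝ) volume := by
  ext x; simp [conv, convolution_def]

lemma conv_comm (K f : E3 → ℝ) : conv K f = conv f K := by
  ext x
  unfold conv
  rw [← integral_sub_left_eq_self (fun y => f y * K (x - y)) volume x]
  simp [mul_comm]

lemma aestronglyMeasurable_comp_sub {f : E3 → ℝ} (hf : AEStronglyMeasurable f volume) :
    AEStronglyMeasurable (fun z : E3 × E3 => f (z.1 - z.2)) (volume.prod volume) :=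
  hf.comp_quasiMeasurePreserving (quasiMeasurePreserving_sub volume volume)

lemma eLpNorm_comp_sub {f : E3 → ℝ} (p : ℝ≥0∞) (hf : AEStronglyMeasurable f volume) (y : E3) :
    eLpNorm (fun x => f (x - y)) p volume = eLpNorm f p volume :=
  eLpNorm_comp_measurePreserving (g := f) hf (measurePreserving_sub_right volume y)

/-! ### Weighted Jensen and Minkowski inequalities for kernel averages. -/

section Minkowski

variable {X Y : Type*} [MeasurableSpace X] [MeasurableSpace Y] {μ : Measure X} {ν : Measure Y}

/-- Hölder applied to the splitting `k g = k^(1 - 1/p) · (k^(1/p) g)`: Jensen's inequality for a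
weight that is not normalised. -/
lemma lintegral_mul_rpow_le (p : ℝ) (hp : 1 ≤ p) {k g : Y → ℝ≥0∞} (hk : AEMeasurable k ν)
    (hg : AEMeasurable g ν) :
    (∫⁻ y, k y * g y ∂ν) ^ p ≤ (∫⁻ y, k y ∂ν) ^ (p - 1) * ∫⁻ y, k y * g y ^ p ∂ν := by
  rcases hp.eq_or_lt with rfl | hp1
  · simp
  have hpq : (p / (p - 1)).HolderConjugate p := (Real.HolderConjugate.conjExponent hp1).symm
  have hp0 : 0 < p := by linarith
  have h1 : ∀ y, k y * g y = k y ^ (1 - 1 / p) * (k y ^ (1 / p) * g y) := fun y => by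
    rw [← mul_assoc, ← ENNReal.rpow_add_of_nonneg _ _ (by
      rw [sub_nonneg, div_le_one hp0]; exact hp) (by positivity)]
    simp
  have h2 := ENNReal.lintegral_mul_le_Lp_mul_Lq ν hpq (f := fun y => k y ^ (1 - 1 / p))
    (g := fun y => k y ^ (1 / p) * g y) (hk.pow_const _) ((hk.pow_const _).mul hg)
  simp only [Pi.mul_apply, ← h1] at h2
  have e1 : ∀ y, (k y ^ (1 - 1 / p)) ^ (p / (p - 1)) = k y := fun y => by
    rw [← ENNReal.rpow_mul]
    have : (1 - 1 / p) * (p / (p - 1)) = 1 := by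
      have : p - 1 ≠ 0 := by linarith
      field_simp
    rw [this, ENNReal.rpow_one]
  have e2 : ∀ y, (k y ^ (1 / p) * g y) ^ p = k y * g y ^ p := fun y => by
    rw [ENNReal.mul_rpow_of_nonneg _ _ hp0.le, ← ENNReal.rpow_mul]
    simp [hp0.ne']
  simp only [e1, e2] at h2
  calc (∫⁻ y, k y * g y ∂ν) ^ p ≤ _ := ENNReal.rpow_le_rpow h2 hp0.le
    _ = _ := by
      rw [ENNReal.mul_rpow_of_nonneg _ _ hp0.le, ← ENNReal.rpow_mul, ← ENNReal.rpow_mul]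
      congr 2
      · have : p - 1 ≠ 0 := by linarith
        field_simp
      · rw [one_div, inv_mul_cancel₀ hp0.ne', ENNReal.rpow_one]

variable [SFinite ν]

/-- Fubini read backwards: null-measurability lets the exceptional set be enclosed in a measurable
set almost equal to it, whose slices are then null. It allows slice bounds to change the order of
the variables when `p = ⊤`. -/
lemma ae_prod_of_ae_ae {p : X × Y → Prop} (hp : NullMeasurableSet {z | p z} (μ.prod ν))
    (h : ∀ᵐ x ∂μ, ∀ᵐ y ∂ν, p (x, y)) : ∀ᵐ z ∂(μ.prod ν), p z := by
  obtain ⟨t, hst, ht, hts⟩ := hp.compl.exists_measurable_superset_ae_eq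
  refine measure_mono_null hst ((Measure.measure_prod_null ht).2 ?_)
  have h2 := Measure.ae_ae_of_ae_prod hts.mem_iff
  filter_upwards [h, h2] with x hx hx2
  have h3 : ∀ᵐ y ∂ν, (x, y) ∉ t := by
    filter_upwards [hx, hx2] with y hy hy2 hyt
    exact hy2.1 hyt hy
  rw [ae_iff] at h3
  simp only [not_not] at h3
  exact h3

variable [SFinite μ]

/-- Weighted Jensen for each `x`, then Tonelli. The slice norms stay under the integral so that
dominated convergence can be applied to them in `tendsto_eLpNorm_conv_dil`. -/
lemma eLpNorm_integral_mul_rpow_le {p : ℝ≥0∞} (hp : 1 ≤ p) (hp' : p ≠ ⊤) {K : Y → ℝ}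
    {F : X → Y → ℝ} (hK : AEStronglyMeasurable K ν)
    (hF : AEStronglyMeasurable (fun z : X × Y => F z.1 z.2) (μ.prod ν)) :
    eLpNorm (fun x => ∫ y, K y * F x y ∂ν) p μ ^ p.toReal
      ≤ (∫⁻ y, ‖K y‖ₑ ∂ν) ^ (p.toReal - 1) *
        ∫⁻ y, ‖K y‖ₑ * eLpNorm (fun x => F x y) p μ ^ p.toReal ∂ν := by
  have hp0 : p ≠ 0 := (zero_lt_one.trans_le hp).ne'
  have hpr : 1 ≤ p.toReal := by
    rw [← ENNReal.toReal_one]; exact (ENNReal.toReal_le_toReal (by simp) hp').2 hp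
  have hpr0 : 0 < p.toReal := by linarith
  have key : ∀ g : X → ℝ, eLpNorm g p μ ^ p.toReal = ∫⁻ x, ‖g x‖ₑ ^ p.toReal ∂μ := fun g => by
    rw [eLpNorm_eq_lintegral_rpow_enorm_toReal hp0 hp', ← ENNReal.rpow_mul, one_div,
      inv_mul_cancel₀ hpr0.ne', ENNReal.rpow_one]
  simp only [key]
  have hKF : AEMeasurable (fun z : X × Y => ‖K z.2‖ₑ * ‖F z.1 z.2‖ₑ ^ p.toReal) (μ.prod ν) :=
    (hK.comp_snd.enorm).mul (hF.enorm.pow_const _)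
  calc ∫⁻ x, ‖∫ y, K y * F x y ∂ν‖ₑ ^ p.toReal ∂μ
      ≤ ∫⁻ x, (∫⁻ y, ‖K y‖ₑ ∂ν) ^ (p.toReal - 1) *
          ∫⁻ y, ‖K y‖ₑ * ‖F x y‖ₑ ^ p.toReal ∂ν ∂μ := by
        apply lintegral_mono_ae
        filter_upwards [hF.prodMk_left] with x hx
        refine le_trans (ENNReal.rpow_le_rpow (enorm_integral_le_lintegral_enorm _) hpr0.le) ?_
        simp only [enorm_mul]
        exact lintegral_mul_rpow_le _ hpr hK.enorm hx.enorm
    _ = (∫⁻ y, ‖K y‖ₑ ∂ν) ^ (p.toReal - 1) *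
          ∫⁻ x, ∫⁻ y, ‖K y‖ₑ * ‖F x y‖ₑ ^ p.toReal ∂ν ∂μ :=
        lintegral_const_mul'' _ hKF.lintegral_prod_right'
    _ = _ := by
        rw [lintegral_lintegral_swap hKF]
        congr 1
        apply lintegral_congr_ae
        have : AEStronglyMeasurable (fun z : Y × X => F z.2 z.1) (ν.prod μ) := hF.prod_swap
        filter_upwards [this.prodMk_left] with y hy
        rw [lintegral_const_mul'' _ (hy.enorm.pow_const _)]

/-- Minkowski's integral inequality, with a uniform bound on the slices. -/
lemma eLpNorm_integral_mul_le {p : ℝ≥0∞} (hp : 1 ≤ p) {K : Y → ℝ}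
    {F : X → Y → ℝ} (hK : AEStronglyMeasurable K ν)
    (hF : AEStronglyMeasurable (fun z : X × Y => F z.1 z.2) (μ.prod ν)) {A : ℝ≥0∞}
    (hA : ∀ᵐ y ∂ν, K y ≠ 0 → eLpNorm (fun x => F x y) p μ ≤ A) :
    eLpNorm (fun x => ∫ y, K y * F x y ∂ν) p μ ≤ (∫⁻ y, ‖K y‖ₑ ∂ν) * A := by
  have hp0 : p ≠ 0 := (zero_lt_one.trans_le hp).ne'
  by_cases hp' : p = ⊤
  · subst hp'
    simp only [eLpNorm_exponent_top] at hA ⊢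
    apply eLpNormEssSup_le_of_ae_enorm_bound
    -- The hypothesis holds for a.e. `y` and then a.e. `x`, while the conclusion needs the opposite
    -- order, so it is first made a statement on the product. The factor `K` makes the bound trivial
    -- where the kernel vanishes.
    have hmeas : NullMeasurableSet {z : Y × X | ‖K z.1‖ₑ * ‖F z.2 z.1‖ₑ ≤ ‖K z.1‖ₑ * A}
        (ν.prod μ) := by
      have h1 : AEMeasurable (fun z : Y × X => ‖K z.1‖ₑ) (ν.prod μ) := hK.comp_fst.enorm
      have h2 : AEMeasurable (fun z : Y × X => ‖F z.2 z.1‖ₑ) (ν.prod μ) := hF.prod_swap.enorm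
      exact nullMeasurableSet_le (h1.mul h2) (h1.mul_const _)
    have h1 : ∀ᵐ z ∂(ν.prod μ), ‖K z.1‖ₑ * ‖F z.2 z.1‖ₑ ≤ ‖K z.1‖ₑ * A := by
      refine ae_prod_of_ae_ae hmeas ?_
      filter_upwards [hA] with y hy
      by_cases h : K y = 0
      · simp [h]
      · filter_upwards [ae_le_eLpNormEssSup (f := fun x => F x y) (μ := μ)] with x hx
        gcongr
        exact hx.trans (hy h)
    have h2 : ∀ᵐ z ∂(μ.prod ν), ‖K z.2‖ₑ * ‖F z.1 z.2‖ₑ ≤ ‖K z.2‖ₑ * A :=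
      (Measure.measurePreserving_swap (μ := μ) (ν := ν)).quasiMeasurePreserving.ae h1
    filter_upwards [Measure.ae_ae_of_ae_prod h2] with x hx
    calc ‖∫ y, K y * F x y ∂ν‖ₑ ≤ ∫⁻ y, ‖K y * F x y‖ₑ ∂ν := enorm_integral_le_lintegral_enorm _
      _ ≤ ∫⁻ y, ‖K y‖ₑ * A ∂ν := by
          apply lintegral_mono_ae
          filter_upwards [hx] with y hy
          rwa [enorm_mul]
      _ = _ := lintegral_mul_const'' _ hK.enorm
  have hpr : 1 ≤ p.toReal := by
    rw [← ENNReal.toReal_one]; exact (ENNReal.toReal_le_toReal (by simp) hp').2 hp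
  have hpr0 : 0 < p.toReal := by linarith
  rw [← ENNReal.rpow_le_rpow_iff hpr0]
  refine (eLpNorm_integral_mul_rpow_le hp hp' hK hF).trans ?_
  calc _ ≤ (∫⁻ y, ‖K y‖ₑ ∂ν) ^ (p.toReal - 1) * ∫⁻ y, ‖K y‖ₑ * A ^ p.toReal ∂ν := by
        gcongr 1
        apply lintegral_mono_ae
        filter_upwards [hA] with y hy
        by_cases h : K y = 0
        · simp [h]
        · gcongr
          exact hy h
    _ = _ := by
        rw [lintegral_mul_const'' _ hK.enorm, ← mul_assoc, ENNReal.mul_rpow_of_nonneg _ _ hpr0.le]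
        congr 1
        nth_rewrite 2 [← ENNReal.rpow_one (∫⁻ y, ‖K y‖ₑ ∂ν)]
        rw [← ENNReal.rpow_add_of_nonneg _ _ (by linarith) zero_le_one]
        simp

end Minkowski

/-- Young's inequality `L¹ * Lᵖ ⊆ Lᵖ`. -/
lemma eLpNorm_conv_le {p : ℝ≥0∞} (hp : 1 ≤ p) {K f : E3 → ℝ} (hK : AEStronglyMeasurable K volume)
    (hf : AEStronglyMeasurable f volume) :
    eLpNorm (conv K f) p volume ≤ eLpNorm K 1 volume * eLpNorm f p volume := by
  rw [eLpNorm_one_eq_lintegral_enorm]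
  exact eLpNorm_integral_mul_le hp hK (F := fun x y => f (x - y))
    (aestronglyMeasurable_comp_sub hf) (ae_of_all _ fun y _ => (eLpNorm_comp_sub p hf y).le)

lemma aestronglyMeasurable_conv {K f : E3 → ℝ} (hK : AEStronglyMeasurable K volume)
    (hf : AEStronglyMeasurable f volume) : AEStronglyMeasurable (conv K f) volume :=
  (hK.comp_snd.mul (aestronglyMeasurable_comp_sub hf)).integral_prod_right'

lemma memLp_conv {p : ℝ≥0∞} (hp : 1 ≤ p) {K f : E3 → ℝ} (hK : Integrable K)
    (hf : MemLp f p volume) : MemLp (conv K f) p volume :=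
  ⟨aestronglyMeasurable_conv hK.1 hf.1, (eLpNorm_conv_le hp hK.1 hf.1).trans_lt
    (ENNReal.mul_lt_top (memLp_one_iff_integrable.2 hK).2 hf.2)⟩

lemma eLpNorm_comp_sub_left {f : E3 → ℝ} (p : ℝ≥0∞) (hf : AEStronglyMeasurable f volume) (x : E3) :
    eLpNorm (fun y => f (x - y)) p volume = eLpNorm f p volume :=
  eLpNorm_comp_measurePreserving (g := f) hf (Measure.measurePreserving_sub_left volume x)

lemma aestronglyMeasurable_comp_sub_left {f : E3 → ℝ} (hf : AEStronglyMeasurable f volume) (x : E3) :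
    AEStronglyMeasurable (fun y => f (x - y)) volume :=
  hf.comp_measurePreserving (Measure.measurePreserving_sub_left volume x)

lemma lintegral_enorm_mul_le {X : Type*} [MeasurableSpace X] {μ : Measure X} (p q : ℝ≥0∞)
    [p.HolderTriple q 1] {f g : X → ℝ} (hf : AEStronglyMeasurable f μ)
    (hg : AEStronglyMeasurable g μ) :
    ∫⁻ x, ‖f x * g x‖ₑ ∂μ ≤ eLpNorm f p μ * eLpNorm g q μ := by
  have h := eLpNorm_smul_le_mul_eLpNorm (p := p) (q := q) (r := 1) hg hf
  rw [eLpNorm_one_eq_lintegral_enorm] at h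
  simpa only [Pi.smul_apply', smul_eq_mul] using h

lemma enorm_integral_mul_le {X : Type*} [MeasurableSpace X] {μ : Measure X} (p q : ℝ≥0∞)
    [p.HolderTriple q 1] {f g : X → ℝ} (hf : AEStronglyMeasurable f μ)
    (hg : AEStronglyMeasurable g μ) :
    ‖∫ x, f x * g x ∂μ‖ₑ ≤ eLpNorm f p μ * eLpNorm g q μ :=
  (enorm_integral_le_lintegral_enorm _).trans (lintegral_enorm_mul_le p q hf hg)

lemma enorm_conv_le (p q : ℝ≥0∞) [p.HolderTriple q 1] {K f : E3 → ℝ}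
    (hK : AEStronglyMeasurable K volume) (hf : AEStronglyMeasurable f volume) (x : E3) :
    ‖conv K f x‖ₑ ≤ eLpNorm K p volume * eLpNorm f q volume := by
  rw [← eLpNorm_comp_sub_left q hf x]
  exact enorm_integral_mul_le p q hK (aestronglyMeasurable_comp_sub_left hf x)

lemma integrable_conv_integrand (p q : ℝ≥0∞) [p.HolderTriple q 1] {K f : E3 → ℝ}
    (hK : MemLp K p volume) (hf : MemLp f q volume) (x : E3) :
    Integrable (fun y => K y * f (x - y)) := by
  refine MemLp.integrable_mul (p := p) (q := q) hK ⟨aestronglyMeasurable_comp_sub_left hf.1 x, ?_⟩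
  rw [eLpNorm_comp_sub_left q hf.1 x]
  exact hf.2

/-- Convolution with `K` is adjoint to convolution with `K(-·)`. -/
lemma integral_conv_mul (p q : ℝ≥0∞) [p.HolderTriple q 1] {K f g : E3 → ℝ}
    (hK : Integrable K) (hf : MemLp f p volume) (hg : MemLp g q volume) :
    ∫ x, conv K f x * g x = ∫ x, f x * conv (fun y => K (-y)) g x := by
  have hint : Integrable (fun z : E3 × E3 => K z.2 * f (z.1 - z.2) * g z.1)
      (volume.prod volume) := by
    refine ⟨(hK.1.comp_snd.mul (aestronglyMeasurable_comp_sub hf.1)).mul hg.1.comp_fst, ?_⟩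
    have h := lintegral_prod_symm _
      ((hK.1.comp_snd.mul (aestronglyMeasurable_comp_sub hf.1)).mul hg.1.comp_fst).enorm
    simp only [Pi.mul_apply] at h
    rw [HasFiniteIntegral, h]
    calc ∫⁻ y, ∫⁻ x, ‖K y * f (x - y) * g x‖ₑ
        ≤ ∫⁻ y, ‖K y‖ₑ * (eLpNorm f p volume * eLpNorm g q volume) := by
          apply lintegral_mono
          intro y
          simp only [mul_assoc, enorm_mul (K y)]
          rw [lintegral_const_mul' _ _ (by simp)]
          gcongr
          rw [← eLpNorm_comp_sub p hf.1 y]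
          exact lintegral_enorm_mul_le p q
            (hf.1.comp_measurePreserving (measurePreserving_sub_right volume y)) hg.1
      _ = eLpNorm K 1 volume * (eLpNorm f p volume * eLpNorm g q volume) := by
          rw [lintegral_mul_const'' _ hK.1.enorm, eLpNorm_one_eq_lintegral_enorm]
      _ < ⊤ := ENNReal.mul_lt_top (memLp_one_iff_integrable.2 hK).2 (ENNReal.mul_lt_top hf.2 hg.2)
  -- The shear `(x, y) ↦ (x + y, y)` preserves the measure and carries the first integrand to the
  -- second.
  have hint2 : Integrable (fun z : E3 × E3 => K z.2 * f z.1 * g (z.1 + z.2))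
      (volume.prod volume) := by
    have := ((measurePreserving_add_prod (G := E3) volume volume).integrable_comp hint.1).2 hint
    refine this.congr (ae_of_all _ fun z => ?_)
    simp
  calc ∫ x, conv K f x * g x = ∫ x, ∫ y, K y * f (x - y) * g x := by
        simp only [conv, integral_mul_const]
    _ = ∫ y, ∫ x, K y * f (x - y) * g x := integral_integral_swap hint
    _ = ∫ y, ∫ x, K y * f x * g (x + y) := by
        congr 1; ext y
        rw [← integral_add_right_eq_self _ y]
        simp
    _ = ∫ x, ∫ y, K y * f x * g (x + y) := (integral_integral_swap hint2).symm
    _ = _ := by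
        congr 1; ext x
        rw [conv, ← integral_const_mul, ← integral_neg_eq_self (fun y => K y * f x * g (x + y))]
        congr 1; ext y; rw [← sub_eq_add_neg]
        ring

/-! ### Approximate identities -/

/-- Translations form a continuous family of measure-preserving maps, and such a family acts
continuously on `Lᵖ` when `p` is finite. -/
lemma tendsto_eLpNorm_translation {p : ℝ≥0∞} (hp : 1 ≤ p) (hp' : p ≠ ⊤) {f : E3 → ℝ}
    (hf : MemLp f p volume) :
    Tendsto (fun y : E3 => eLpNorm (fun x => f (x - y) - f x) p volume) (𝓝 0) (𝓝 0) := by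
  have : Fact (1 ≤ p) := ⟨hp⟩
  let g : E3 → C(E3, E3) := fun y => ⟨fun x => x - y, by fun_prop⟩
  have hg : Continuous g := by
    refine ContinuousMap.continuous_of_continuous_uncurry _ ?_
    change Continuous fun z : E3 × E3 => z.2 - z.1
    fun_prop
  have hgm : ∀ y, MeasurePreserving (g y) volume volume := fun y =>
    measurePreserving_sub_right volume y
  have hc : Continuous (fun y => Lp.compMeasurePreserving (g y) (hgm y) (hf.toLp f)) :=
    continuous_const.compMeasurePreservingLp hg hgm hp'
  have h0 := (Lp.tendsto_Lp_iff_tendsto_eLpNorm' _ _).1 (hc.tendsto 0)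
  refine h0.congr fun y => eLpNorm_congr_ae ?_
  have a1 := Lp.coeFn_compMeasurePreserving (hf.toLp f) (hgm y)
  have a2 := Lp.coeFn_compMeasurePreserving (hf.toLp f) (hgm 0)
  have a3 := (hgm y).quasiMeasurePreserving.ae hf.coeFn_toLp
  have a4 := (hgm 0).quasiMeasurePreserving.ae hf.coeFn_toLp
  filter_upwards [a1, a2, a3, a4] with x h1 h2 h3 h4
  simp only [Pi.sub_apply, h1, h2, Function.comp_apply, h3, h4]
  simp [g]

lemma integral_dil_mul {l : ℝ} (hl : 0 < l) (K : E3 → ℝ) (F : E3 → ℝ) :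
    ∫ y, dil l K y * F y = ∫ y, K y * F (l⁻¹ • y) := by
  have h := Measure.integral_comp_smul_of_nonneg (volume : Measure E3)
    (fun y => l ^ 3 * K y * F (l⁻¹ • y)) l (hR := hl.le)
  simp only [smul_smul, inv_mul_cancel₀ hl.ne', one_smul] at h
  unfold dil
  rw [h]
  simp only [finrank_euclideanSpace, Fintype.card_fin, smul_eq_mul, mul_assoc]
  rw [integral_const_mul, ← mul_assoc, inv_mul_cancel₀ (by positivity), one_mul]

lemma conv_dil {l : ℝ} (hl : 0 < l) (K f : E3 → ℝ) (x : E3) :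
    conv (dil l K) f x = ∫ y, K y * f (x - l⁻¹ • y) :=
  integral_dil_mul hl K fun y => f (x - y)

lemma integral_dil {l : ℝ} (hl : 0 < l) (K : E3 → ℝ) : ∫ y, dil l K y = ∫ y, K y := by
  simpa using integral_dil_mul hl K fun _ => 1

lemma integrable_dil {l : ℝ} (hl : 0 < l) {K : E3 → ℝ} (hK : Integrable K) :
    Integrable (dil l K) :=
  (hK.comp_smul hl.ne').const_mul _

lemma eLpNorm_one_eq_ofReal {K : E3 → ℝ} (hK : Integrable K) :
    eLpNorm K 1 volume = ENNReal.ofReal (∫ x, |K x|) := by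
  rw [eLpNorm_one_eq_lintegral_enorm, ofReal_integral_eq_lintegral_ofReal hK.abs
    (ae_of_all _ fun _ => abs_nonneg _)]
  simp [Real.enorm_eq_ofReal_abs]

lemma eLpNorm_one_dil {l : ℝ} (hl : 0 < l) {K : E3 → ℝ} (hK : Integrable K) :
    eLpNorm (dil l K) 1 volume = eLpNorm K 1 volume := by
  rw [eLpNorm_one_eq_ofReal hK, eLpNorm_one_eq_ofReal (integrable_dil hl hK),
    ← integral_dil hl fun x => |K x|]
  simp only [dil, abs_mul, abs_of_pos (pow_pos hl 3)]

lemma memLp_comp_smul {l : ℝ} (hl : l ≠ 0) {p : ℝ≥0∞} {K : E3 → ℝ} (hK : MemLp K p volume) :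
    MemLp (fun x => K (l • x)) p volume := by
  have h := Measure.map_addHaar_smul (volume : Measure E3) hl
  have hK2 : MemLp K p (Measure.map (l • ·) (volume : Measure E3)) := by
    rw [h]
    exact hK.smul_measure ENNReal.ofReal_ne_top
  exact (memLp_map_measure_iff hK2.1 (measurable_const_smul l).aemeasurable).1 hK2

lemma memLp_dil {l : ℝ} (hl : 0 < l) {p : ℝ≥0∞} {K : E3 → ℝ} (hK : MemLp K p volume) :
    MemLp (dil l K) p volume :=
  (memLp_comp_smul hl.ne' hK).const_mul _

lemma integrable_mul_comp_smul {l : ℝ} (hl : 0 < l) (q p : ℝ≥0∞) [q.HolderTriple p 1]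
    {K f : E3 → ℝ} (hK : MemLp K q volume) (hf : MemLp f p volume) (x : E3) :
    Integrable (fun y => K y * f (x - l⁻¹ • y)) := by
  refine MemLp.integrable_mul (p := q) (q := p) hK ?_
  refine memLp_comp_smul (K := fun y => f (x - y)) (inv_ne_zero hl.ne') ⟨?_, ?_⟩
  · exact aestronglyMeasurable_comp_sub_left hf.1 x
  · rw [eLpNorm_comp_sub_left p hf.1 x]
    exact hf.2

/-- Since `∫ K = 1`, the value `f x` can be put under the integral. Membership of `K` in the
conjugate space makes the identity valid at every `x`, not only almost everywhere. -/
lemma conv_dil_sub {l : ℝ} (hl : 0 < l) (q p : ℝ≥0∞) [q.HolderTriple p 1] {K f : E3 → ℝ}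
    (hK : Integrable K) (hKq : MemLp K q volume) (hK1 : ∫ x, K x = 1) (hf : MemLp f p volume)
    (x : E3) : conv (dil l K) f x - f x = ∫ y, K y * (f (x - l⁻¹ • y) - f x) := by
  simp only [mul_sub]
  rw [integral_sub (integrable_mul_comp_smul hl q p hKq hf x) (hK.mul_const _), conv_dil hl,
    integral_mul_const, hK1, one_mul]

lemma aestronglyMeasurable_translation (l : ℝ) {f : E3 → ℝ} (hf : AEStronglyMeasurable f volume) :
    AEStronglyMeasurable (fun z : E3 × E3 => f (z.1 - l • z.2)) (volume.prod volume) := by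
  rcases eq_or_ne l 0 with rfl | hl
  · simpa using hf.comp_fst
  have h : Measure.QuasiMeasurePreserving (fun z : E3 × E3 => (z.1, l • z.2))
      (volume.prod volume) (volume.prod volume) := by
    have h2 : MeasurePreserving (fun z : E3 => l • z) volume _ :=
      ⟨measurable_const_smul l, Measure.map_addHaar_smul _ hl⟩
    exact ((MeasurePreserving.id volume).prod h2).quasiMeasurePreserving.mono_right
      (Measure.AbsolutelyContinuous.rfl.prod Measure.smul_absolutelyContinuous)
  exact (aestronglyMeasurable_comp_sub hf).comp_quasiMeasurePreserving h

lemma eLpNorm_sub_translation_le {p : ℝ≥0∞} (hp : 1 ≤ p) {f : E3 → ℝ}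
    (hf : AEStronglyMeasurable f volume) (y : E3) :
    eLpNorm (fun x => f (x - y) - f x) p volume ≤ 2 * eLpNorm f p volume := by
  refine (eLpNorm_sub_le (f := fun x => f (x - y)) ?_ hf hp).trans ?_
  · exact hf.comp_measurePreserving (measurePreserving_sub_right volume y)
  · rw [eLpNorm_comp_sub p hf, two_mul]

/-- Convolution with dilations of a kernel of integral one is an approximate identity in `Lᵖ`. -/
lemma tendsto_eLpNorm_conv_dil (q : ℝ≥0∞) {p : ℝ≥0∞} [q.HolderTriple p 1] (hp : 1 ≤ p)
    (hp' : p ≠ ⊤) {K f : E3 → ℝ} (hK : Integrable K) (hKq : MemLp K q volume)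
    (hK1 : ∫ x, K x = 1) (hf : MemLp f p volume) :
    Tendsto (fun l : ℝ => eLpNorm (fun x => conv (dil l K) f x - f x) p volume) atTop (𝓝 0) := by
  have hp0 : p ≠ 0 := (zero_lt_one.trans_le hp).ne'
  have hpr : 1 ≤ p.toReal := by
    rw [← ENNReal.toReal_one]; exact (ENNReal.toReal_le_toReal (by simp) hp').2 hp
  have hpr0 : 0 < p.toReal := by linarith
  have hKfin : ∫⁻ y, ‖K y‖ₑ ≠ ⊤ := hK.2.ne
  have hfp : eLpNorm f p volume ^ p.toReal ≠ ⊤ := ENNReal.rpow_ne_top_of_nonneg hpr0.le hf.2.ne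
  have hmeas : ∀ l : ℝ, AEStronglyMeasurable (fun z : E3 × E3 => f (z.1 - l⁻¹ • z.2) - f z.1)
      (volume.prod volume) := fun l =>
    (aestronglyMeasurable_translation _ hf.1).sub hf.1.comp_fst
  have hI : Tendsto (fun l : ℝ => ∫⁻ y, ‖K y‖ₑ *
      eLpNorm (fun x => f (x - l⁻¹ • y) - f x) p volume ^ p.toReal) atTop (𝓝 0) := by
    have hlim : Tendsto (fun l : ℝ => ∫⁻ y, ‖K y‖ₑ *
        eLpNorm (fun x => f (x - l⁻¹ • y) - f x) p volume ^ p.toReal) atTop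
        (𝓝 (∫⁻ _ : E3, 0)) := by
      -- Each translation norm tends to zero and never exceeds `2‖f‖ₚ`, which the integrable kernel
      -- turns into a majorant in `y`.
      refine tendsto_lintegral_filter_of_dominated_convergence'
        (fun y => ‖K y‖ₑ * (2 * eLpNorm f p volume) ^ p.toReal) ?_ ?_ ?_ ?_
      · refine Eventually.of_forall fun l => hK.1.enorm.mul ?_
        have key : ∀ y, eLpNorm (fun x => f (x - l⁻¹ • y) - f x) p volume ^ p.toReal
            = ∫⁻ x, ‖f (x - l⁻¹ • y) - f x‖ₑ ^ p.toReal := fun y => by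
          rw [eLpNorm_eq_lintegral_rpow_enorm_toReal hp0 hp', ← ENNReal.rpow_mul, one_div,
            inv_mul_cancel₀ hpr0.ne', ENNReal.rpow_one]
        simp only [key]
        exact ((hmeas l).prod_swap.enorm.pow_const _).lintegral_prod_right'
      · refine Eventually.of_forall fun l => ae_of_all _ fun y => ?_
        gcongr
        exact eLpNorm_sub_translation_le hp hf.1 _
      · rw [lintegral_mul_const'' _ hK.1.enorm]
        refine ENNReal.mul_ne_top hKfin (ENNReal.rpow_ne_top_of_nonneg hpr0.le ?_)
        exact ENNReal.mul_ne_top (by simp) hf.2.ne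
      · refine ae_of_all _ fun y => ?_
        have h1 : Tendsto (fun l : ℝ => l⁻¹ • y) atTop (𝓝 0) := by
          simpa using (tendsto_inv_atTop_zero (𝕜 := ℝ)).smul_const y
        have h2 := (tendsto_eLpNorm_translation hp hp' hf).comp h1
        have h3 := (ENNReal.continuous_rpow_const (y := p.toReal)).tendsto 0 |>.comp h2
        rw [ENNReal.zero_rpow_of_pos hpr0] at h3
        have h4 := ENNReal.Tendsto.const_mul (a := ‖K y‖ₑ) h3 (Or.inr enorm_ne_top)
        simpa using h4
    simpa using hlim
  have hbound : ∀ l : ℝ, 0 < l → eLpNorm (fun x => conv (dil l K) f x - f x) p volume ≤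
      ((∫⁻ y, ‖K y‖ₑ) ^ (p.toReal - 1) * ∫⁻ y, ‖K y‖ₑ *
      eLpNorm (fun x => f (x - l⁻¹ • y) - f x) p volume ^ p.toReal) ^ (p.toReal⁻¹) := by
    intro l hl
    rw [ENNReal.le_rpow_inv_iff hpr0]
    simp only [conv_dil_sub hl q p hK hKq hK1 hf]
    exact eLpNorm_integral_mul_rpow_le hp hp' hK.1 (hmeas l)
  have hz : Tendsto (fun l : ℝ => ((∫⁻ y, ‖K y‖ₑ) ^ (p.toReal - 1) * ∫⁻ y, ‖K y‖ₑ *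
      eLpNorm (fun x => f (x - l⁻¹ • y) - f x) p volume ^ p.toReal) ^ (p.toReal⁻¹)) atTop
      (𝓝 0) := by
    have h1 := ENNReal.Tendsto.const_mul (a := (∫⁻ y, ‖K y‖ₑ) ^ (p.toReal - 1)) hI
      (Or.inr (ENNReal.rpow_ne_top_of_nonneg (by linarith) hKfin))
    have h3 := (ENNReal.continuous_rpow_const (y := p.toReal⁻¹)).tendsto _ |>.comp h1
    rw [mul_zero, ENNReal.zero_rpow_of_pos (inv_pos.2 hpr0)] at h3
    exact h3
  refine tendsto_of_tendsto_of_tendsto_of_le_of_le' tendsto_const_nhds hz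
    (Eventually.of_forall fun _ => zero_le) ?_
  filter_upwards [eventually_gt_atTop 0] with l hl using hbound l hl

/-! ### The mollifier -/

/-- The standard bump on three-space with radii one and two. -/
def bump : ContDiffBump (0 : E3) := ⟨1, 2, one_pos, one_lt_two⟩

/-- A smooth even nonnegative kernel of integral one, supported in the ball of radius two. -/
def eta : E3 → ℝ := bump.normed volume

lemma eta_nonneg (x : E3) : 0 ≤ eta x := bump.nonneg_normed x

lemma eta_neg (x : E3) : eta (-x) = eta x := bump.normed_neg x

lemma contDiff_eta : ContDiff ℝ ∞ eta := bump.contDiff_normed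

lemma hasCompactSupport_eta : HasCompactSupport eta := bump.hasCompactSupport_normed

lemma integral_eta : ∫ x, eta x = 1 := bump.integral_normed

lemma norm_lt_of_eta_ne_zero {x : E3} (h : eta x ≠ 0) : ‖x‖ < 2 := by
  have : x ∈ Function.support (bump.normed volume) := h
  rw [bump.support_normed_eq] at this
  simpa [bump] using this

/-- The mollifier at scale `1 / l`. -/
def mol (l : ℝ) : E3 → ℝ := dil l eta

lemma mol_neg (l : ℝ) (x : E3) : mol l (-x) = mol l x := by
  simp [mol, dil, eta_neg]

lemma mol_nonneg {l : ℝ} (hl : 0 < l) (x : E3) : 0 ≤ mol l x :=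
  mul_nonneg (by positivity) (eta_nonneg _)

lemma contDiff_dil (l : ℝ) {n : WithTop ℕ∞} {K : E3 → ℝ} (hK : ContDiff ℝ n K) :
    ContDiff ℝ n (dil l K) :=
  contDiff_const.mul (hK.comp (contDiff_const_smul l))

lemma contDiff_mol (l : ℝ) : ContDiff ℝ ∞ (mol l) := contDiff_dil l contDiff_eta

lemma hasCompactSupport_dil {l : ℝ} (hl : l ≠ 0) {K : E3 → ℝ} (hK : HasCompactSupport K) :
    HasCompactSupport (dil l K) :=
  (hK.comp_smul hl).mul_left

lemma hasCompactSupport_mol {l : ℝ} (hl : 0 < l) : HasCompactSupport (mol l) :=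
  hasCompactSupport_dil hl.ne' hasCompactSupport_eta

lemma integral_mol {l : ℝ} (hl : 0 < l) : ∫ x, mol l x = 1 := by
  rw [mol, integral_dil hl, integral_eta]

lemma memLp_of_hasCompactSupport {p : ℝ≥0∞} {f : E3 → ℝ} (hf : Continuous f)
    (hfc : HasCompactSupport f) : MemLp f p volume :=
  hf.memLp_of_hasCompactSupport hfc

lemma memLp_mol {l : ℝ} (hl : 0 < l) (p : ℝ≥0∞) : MemLp (mol l) p volume :=
  memLp_of_hasCompactSupport (contDiff_mol l).continuous (hasCompactSupport_mol hl)

lemma integrable_mol {l : ℝ} (hl : 0 < l) : Integrable (mol l) :=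
  memLp_one_iff_integrable.1 (memLp_mol hl 1)

lemma integrable_eta : Integrable eta := bump.integrable_normed

lemma eLpNorm_one_mol {l : ℝ} (hl : 0 < l) : eLpNorm (mol l) 1 volume = 1 := by
  rw [eLpNorm_one_eq_ofReal (integrable_mol hl)]
  simp only [abs_of_nonneg (mol_nonneg hl _), integral_mol hl, ENNReal.ofReal_one]

lemma norm_lt_of_mol_ne_zero {l : ℝ} (hl : 0 < l) {x : E3} (h : mol l x ≠ 0) : ‖x‖ < 2 / l := by
  have := norm_lt_of_eta_ne_zero (right_ne_zero_of_mul h)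
  rw [norm_smul, Real.norm_of_nonneg hl.le] at this
  rwa [lt_div_iff₀' hl]

/-- Mollification at scale `1 / l`. -/
def S (l : ℝ) (f : E3 → ℝ) : E3 → ℝ := conv (mol l) f

lemma eLpNorm_S_le {l : ℝ} (hl : 0 < l) {p : ℝ≥0∞} (hp : 1 ≤ p) {f : E3 → ℝ}
    (hf : AEStronglyMeasurable f volume) : eLpNorm (S l f) p volume ≤ eLpNorm f p volume := by
  simpa [S, eLpNorm_one_mol hl] using eLpNorm_conv_le hp (integrable_mol hl).1 hf

lemma memLp_S {l : ℝ} (hl : 0 < l) {p : ℝ≥0∞} (hp : 1 ≤ p) {f : E3 → ℝ}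
    (hf : MemLp f p volume) : MemLp (S l f) p volume := memLp_conv hp (integrable_mol hl) hf

lemma integral_S_mul {l : ℝ} (hl : 0 < l) (p q : ℝ≥0∞) [p.HolderTriple q 1] {f g : E3 → ℝ}
    (hf : MemLp f p volume) (hg : MemLp g q volume) :
    ∫ x, S l f x * g x = ∫ x, f x * S l g x := by
  rw [S, integral_conv_mul p q (integrable_mol hl) hf hg]
  simp only [mol_neg, S]

lemma tendsto_eLpNorm_S {p : ℝ≥0∞} (hp : 1 ≤ p) (hp' : p ≠ ⊤) {f : E3 → ℝ}
    (hf : MemLp f p volume) :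
    Tendsto (fun l : ℝ => eLpNorm (fun x => S l f x - f x) p volume) atTop (𝓝 0) := by
  have : (ENNReal.conjExponent p).HolderTriple p 1 :=
    (ENNReal.HolderConjugate.conjExponent hp).symm
  exact tendsto_eLpNorm_conv_dil (ENNReal.conjExponent p) hp hp' integrable_eta
    (memLp_of_hasCompactSupport contDiff_eta.continuous hasCompactSupport_eta) integral_eta hf

/-! ### Derivatives of convolutions -/

/-- `g` is the weak partial derivative `∂ⱼ f`. -/
def HasWeakDeriv (j : Fin 3) (f g : E3 → ℝ) : Prop :=
  ∀ φ : E3 → ℝ, ContDiff ℝ ∞ φ → HasCompactSupport φ → ∫ x, f x * pd j φ x = - ∫ x, g x * φ x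

lemma contDiff_pd (j : Fin 3) {f : E3 → ℝ} (hf : ContDiff ℝ ∞ f) : ContDiff ℝ ∞ (pd j f) :=
  (hf.fderiv_right (m := ∞) (by simp)).clm_apply contDiff_const

lemma hasCompactSupport_pd (j : Fin 3) {f : E3 → ℝ} (hf : HasCompactSupport f) :
    HasCompactSupport (pd j f) :=
  hf.fderiv_apply (𝕜 := ℝ) _

lemma contDiff_conv {K f : E3 → ℝ} (hK : ContDiff ℝ ∞ K) (hKc : HasCompactSupport K)
    (hf : LocallyIntegrable f) : ContDiff ℝ ∞ (conv K f) := by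
  rw [conv_eq_convolution]
  exact hKc.contDiff_convolution_left _ hK hf

lemma pd_conv (j : Fin 3) {K f : E3 → ℝ} (hK : ContDiff ℝ ∞ K) (hKc : HasCompactSupport K)
    (hf : LocallyIntegrable f) : pd j (conv K f) = conv (pd j K) f := by
  ext x
  rw [conv_comm, conv_comm (pd j K), conv_eq_convolution, conv_eq_convolution]
  have h := hKc.hasFDerivAt_convolution_right (ContinuousLinearMap.mul ℝ ℝ) hf
    (hK.of_le (by simp)) x
  unfold pd
  rw [h.fderiv]
  exact convolution_precompR_apply _ hf (hKc.fderiv ℝ) (hK.continuous_fderiv (by simp)) x _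

/-- The weak derivative is tested with `y ↦ K (x - y)`; the sign from the reflection cancels the one
from the definition. -/
lemma conv_pd_eq (j : Fin 3) {K f g : E3 → ℝ} (hK : ContDiff ℝ ∞ K) (hKc : HasCompactSupport K)
    (hfg : HasWeakDeriv j f g) : conv (pd j K) f = conv K g := by
  ext x
  have h := hfg (fun y => K (x - y)) (hK.comp (contDiff_const.sub contDiff_id))
    (hKc.comp_homeomorph (Homeomorph.subLeft x))
  have hd : ∀ y, pd j (fun y => K (x - y)) y = - pd j K (x - y) := fun y => by
    have h1 : HasFDerivAt (fun y => x - y) (-(ContinuousLinearMap.id ℝ E3)) y := by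
      simpa using (hasFDerivAt_id y).const_sub x
    have h2 := ((hK.differentiable (by simp)) (x - y)).hasFDerivAt.comp y h1
    have h3 : HasFDerivAt (fun y => K (x - y)) _ y := h2
    simp [pd, h3.fderiv]
  simp only [hd, mul_neg, integral_neg, neg_inj] at h
  rw [conv_comm, conv_comm K]
  exact h

lemma pd_S {j : Fin 3} {l : ℝ} (hl : 0 < l) {f g : E3 → ℝ} (hf : LocallyIntegrable f)
    (hfg : HasWeakDeriv j f g) : pd j (S l f) = S l g := by
  rw [S, pd_conv j (contDiff_mol l) (hasCompactSupport_mol hl) hf,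
    conv_pd_eq j (contDiff_mol l) (hasCompactSupport_mol hl) hfg, S]

lemma contDiff_S {l : ℝ} (hl : 0 < l) {f : E3 → ℝ} (hf : LocallyIntegrable f) :
    ContDiff ℝ ∞ (S l f) := contDiff_conv (contDiff_mol l) (hasCompactSupport_mol hl) hf

lemma integral_mul_pd (j : Fin 3) {f g : E3 → ℝ} (hf : Differentiable ℝ f)
    (hg : Differentiable ℝ g) (h1 : Integrable (fun x => pd j f x * g x))
    (h2 : Integrable (fun x => f x * pd j g x)) (h3 : Integrable (fun x => f x * g x)) :
    ∫ x, f x * pd j g x = - ∫ x, pd j f x * g x :=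
  integral_mul_fderiv_eq_neg_fderiv_mul_of_integrable h1 h2 h3 (fun x _ => hf x) (fun x _ => hg x)

lemma pd_mul (j : Fin 3) {f g : E3 → ℝ} (hf : Differentiable ℝ f) (hg : Differentiable ℝ g) :
    pd j (fun x => f x * g x) = fun x => f x * pd j g x + pd j f x * g x := by
  ext x
  have h := ((hf x).hasFDerivAt.mul (hg x).hasFDerivAt)
  have h3 : HasFDerivAt (fun x => f x * g x) _ x := h
  simp [pd, h3.fderiv, mul_comm]

lemma pd_dil (j : Fin 3) (l : ℝ) {K : E3 → ℝ} (hK : Differentiable ℝ K) :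
    pd j (dil l K) = fun x => l * dil l (pd j K) x := by
  ext x
  have h1 : HasFDerivAt (fun y : E3 => l • y) (l • ContinuousLinearMap.id ℝ E3) x :=
    (hasFDerivAt_id x).const_smul l
  have h2 : HasFDerivAt (dil l K) _ x := ((hK (l • x)).hasFDerivAt.comp x h1).const_mul (l ^ 3)
  simp only [pd, h2.fderiv, dil]
  simp
  ring

lemma hasWeakDeriv_of_contDiff (j : Fin 3) {f : E3 → ℝ} (hf : ContDiff ℝ ∞ f) :
    HasWeakDeriv j f (pd j f) := by
  intro φ hφ hφc
  have hc := hf.continuous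
  have hc' := (contDiff_pd j hf).continuous
  refine integral_mul_pd j (hf.differentiable (by simp)) (hφ.differentiable (by simp)) ?_ ?_ ?_
  · exact (hc'.mul hφ.continuous).integrable_of_hasCompactSupport hφc.mul_left
  · exact (hc.mul (contDiff_pd j hφ).continuous).integrable_of_hasCompactSupport
      (hasCompactSupport_pd j hφc).mul_left
  · exact (hc.mul hφ.continuous).integrable_of_hasCompactSupport hφc.mul_left

/-! ### Limits of integrals of products -/

lemma tendsto_eLpNorm_mul_bounded {ι : Type*} {F : Filter ι} {p : ℝ≥0∞} {b : ι → E3 → ℝ}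
    {b' ψ : E3 → ℝ} {C : ℝ} (hψ : ∀ x, |ψ x| ≤ C)
    (hb : Tendsto (fun i => eLpNorm (fun x => b i x - b' x) p volume) F (𝓝 0)) :
    Tendsto (fun i => eLpNorm (fun x => b i x * ψ x - b' x * ψ x) p volume) F (𝓝 0) := by
  have h := ENNReal.Tendsto.const_mul (a := ENNReal.ofReal C) hb (Or.inr ENNReal.ofReal_ne_top)
  rw [mul_zero] at h
  refine tendsto_of_tendsto_of_tendsto_of_le_of_le tendsto_const_nhds h (fun _ => zero_le)
    fun i => eLpNorm_le_mul_eLpNorm_of_ae_le_mul (ae_of_all _ fun x => ?_) p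
  rw [← sub_mul, Real.norm_eq_abs, Real.norm_eq_abs, abs_mul, mul_comm]
  gcongr
  exact hψ x

/-- Hölder on `ab - a'b' = (a - a')b + a'(b - b')`. The norm of `b` is at most `‖b - b'‖ + ‖b'‖`, so
no uniform bound has to be assumed. -/
lemma tendsto_integral_mul {ι : Type*} {F : Filter ι} (p q : ℝ≥0∞) [hpq : p.HolderTriple q 1]
    (hq : 1 ≤ q) {a b : ι → E3 → ℝ} {a' b' : E3 → ℝ}
    (ha : ∀ᶠ i in F, MemLp (a i) p volume) (hb : ∀ᶠ i in F, MemLp (b i) q volume)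
    (ha' : MemLp a' p volume) (hb' : MemLp b' q volume)
    (hal : Tendsto (fun i => eLpNorm (fun x => a i x - a' x) p volume) F (𝓝 0))
    (hbl : Tendsto (fun i => eLpNorm (fun x => b i x - b' x) q volume) F (𝓝 0)) :
    Tendsto (fun i => ∫ x, a i x * b i x) F (𝓝 (∫ x, a' x * b' x)) := by
  rw [tendsto_iff_edist_tendsto_0]
  have hlim : Tendsto (fun i => eLpNorm (fun x => a i x - a' x) p volume *
      (eLpNorm (fun x => b i x - b' x) q volume + eLpNorm b' q volume) +
      eLpNorm a' p volume * eLpNorm (fun x => b i x - b' x) q volume) F (𝓝 0) := by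
    have h1 := ENNReal.Tendsto.mul hal (Or.inr (by simpa using hb'.2.ne))
      (hbl.add_const (eLpNorm b' q volume)) (Or.inr (by simp))
    have h2 := ENNReal.Tendsto.const_mul (a := eLpNorm a' p volume) hbl (Or.inr ha'.2.ne)
    simpa using h1.add h2
  refine tendsto_of_tendsto_of_tendsto_of_le_of_le' tendsto_const_nhds hlim
    (Eventually.of_forall fun _ => zero_le) ?_
  filter_upwards [ha, hb] with i hai hbi
  have e : ∫ x, a i x * b i x = (∫ x, a' x * b' x) +
      ((∫ x, (a i x - a' x) * b i x) + ∫ x, a' x * (b i x - b' x)) := by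
    have i1 : Integrable (fun x => a' x * b' x) := ha'.integrable_mul hb'
    have i2 : Integrable (fun x => (a i x - a' x) * b i x) := (hai.sub ha').integrable_mul hbi
    have i3 : Integrable (fun x => a' x * (b i x - b' x)) := ha'.integrable_mul (hbi.sub hb')
    rw [← integral_add i2 i3]
    have i4 : Integrable (fun x => (a i x - a' x) * b i x + a' x * (b i x - b' x)) := i2.add i3
    rw [← integral_add i1 i4]
    congr 1; ext x; ring
  rw [e, edist_eq_enorm_sub, add_sub_cancel_left]
  refine (enorm_add_le _ _).trans (add_le_add ?_ ?_)
  · refine (enorm_integral_mul_le p q (hai.sub ha').1 hbi.1).trans ?_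
    gcongr
    · exact le_rfl
    · have := eLpNorm_add_le (hbi.sub hb').1 hb'.1 hq
      rw [sub_add_cancel] at this
      exact this
  · exact enorm_integral_mul_le p q ha'.1 (hbi.sub hb').1

/-! ### Sobolev functions -/

/-- `f` is square integrable with weak partial derivatives `G j` in `L²`. -/
structure IsH1 (f : E3 → ℝ) (G : Fin 3 → E3 → ℝ) : Prop where
  memLp : MemLp f 2 volume
  grad_memLp : ∀ j, MemLp (G j) 2 volume
  weakDeriv : ∀ j, HasWeakDeriv j f (G j)

lemma IsH1.locallyIntegrable {f : E3 → ℝ} {G : Fin 3 → E3 → ℝ} (h : IsH1 f G) :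
    LocallyIntegrable f := h.memLp.locallyIntegrable (by norm_num)

lemma IsH1.pd_S {f : E3 → ℝ} {G : Fin 3 → E3 → ℝ} (h : IsH1 f G) (j : Fin 3) {l : ℝ}
    (hl : 0 < l) : pd j (S l f) = S l (G j) :=
  AnisoNS.pd_S hl h.locallyIntegrable (h.weakDeriv j)

lemma exists_bound_of_hasCompactSupport {φ : E3 → ℝ} (hφ : Continuous φ)
    (hφc : HasCompactSupport φ) : ∃ C, ∀ x, |φ x| ≤ C :=
  hφc.exists_bound_of_continuous hφ

/-- The product rule for weak derivatives of Sobolev functions. -/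
lemma HasWeakDeriv.mul {j : Fin 3} {f g F G : E3 → ℝ} (hf : MemLp f 2 volume)
    (hg : MemLp g 2 volume) (hF : MemLp F 2 volume) (hG : MemLp G 2 volume)
    (hfF : HasWeakDeriv j f F) (hgG : HasWeakDeriv j g G) :
    HasWeakDeriv j (fun x => f x * g x) (fun x => f x * G x + F x * g x) := by
  intro φ hφ hφc
  obtain ⟨C, hC⟩ := exists_bound_of_hasCompactSupport hφ.continuous hφc
  obtain ⟨C', hC'⟩ := exists_bound_of_hasCompactSupport (contDiff_pd j hφ).continuous
    (hasCompactSupport_pd j hφc)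
  have hlim : ∀ {a b ψ : E3 → ℝ} {c : ℝ}, MemLp a 2 volume → MemLp b 2 volume →
      Continuous ψ → (∀ x, |ψ x| ≤ c) →
      Tendsto (fun l => ∫ x, S l a x * (S l b x * ψ x)) atTop (𝓝 (∫ x, a x * (b x * ψ x))) := by
    intro a b ψ c ha hb hψ hc
    have hm : ∀ {b' : E3 → ℝ}, MemLp b' 2 volume → MemLp (fun x => b' x * ψ x) 2 volume :=
      fun {b'} hb' => by
        refine hb'.of_le_mul (c := c) (hb'.1.mul hψ.aestronglyMeasurable) (ae_of_all _ fun x => ?_)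
        rw [norm_mul, mul_comm]
        gcongr
        exact hc x
    refine tendsto_integral_mul 2 2 (by norm_num) ?_ ?_ ha (hm hb)
      (tendsto_eLpNorm_S (by norm_num) (by norm_num) ha)
      (tendsto_eLpNorm_mul_bounded hc (tendsto_eLpNorm_S (by norm_num) (by norm_num) hb))
    · filter_upwards [eventually_gt_atTop 0] with l hl using memLp_S hl (by norm_num) ha
    · filter_upwards [eventually_gt_atTop 0] with l hl using hm (memLp_S hl (by norm_num) hb)
  have h1 := hlim hf hg (contDiff_pd j hφ).continuous hC'
  have h2 := hlim hf hG hφ.continuous hC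
  have h3 := hlim hF hg hφ.continuous hC
  have hli : ∀ {a : E3 → ℝ}, MemLp a 2 volume → LocallyIntegrable a := fun ha =>
    ha.locallyIntegrable (by norm_num)
  have hI : ∀ {a b ψ : E3 → ℝ}, MemLp a 2 volume → MemLp b 2 volume → Continuous ψ →
      HasCompactSupport ψ → Integrable (fun x => a x * (b x * ψ x)) :=
    fun {a b ψ} ha hb hψ hψc => by
      have : Integrable (fun x => a x * b x) := ha.integrable_mul hb
      obtain ⟨c, hc⟩ := exists_bound_of_hasCompactSupport hψ hψc
      simpa [mul_assoc] using this.mul_bdd (c := c) hψ.aestronglyMeasurable (ae_of_all _ hc)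
  -- For the mollified functions this is the classical product rule. Each of the three integrals
  -- pairs two strongly convergent `L²` families with a bounded function, so the identity survives
  -- the limit.
  have heq : ∀ᶠ l : ℝ in atTop, ∫ x, S l f x * (S l g x * pd j φ x) =
      -((∫ x, S l f x * (S l G x * φ x)) + ∫ x, S l F x * (S l g x * φ x)) := by
    filter_upwards [eventually_gt_atTop 0] with l hl
    have sf := contDiff_S hl (hli hf)
    have sg := contDiff_S hl (hli hg)
    have := hasWeakDeriv_of_contDiff j (sf.mul sg) φ hφ hφc
    rw [pd_mul j (sf.differentiable (by simp)) (sg.differentiable (by simp)),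
      pd_S hl (hli hf) hfF, pd_S hl (hli hg) hgG] at this
    rw [← integral_add, ← integral_neg]
    · simp only [← mul_assoc, this, ← integral_neg]
      congr 1; ext x; ring
    · exact hI (memLp_S hl (by norm_num) hf) (memLp_S hl (by norm_num) hG) hφ.continuous hφc
    · exact hI (memLp_S hl (by norm_num) hF) (memLp_S hl (by norm_num) hg) hφ.continuous hφc
  have h4 := tendsto_nhds_unique (h1.congr' heq) (h2.add h3).neg
  simp only [← mul_assoc] at h4
  rw [h4, neg_inj, ← integral_add]
  · congr 1; ext x; ring
  · simpa [mul_assoc] using hI hf hG hφ.continuous hφc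
  · simpa [mul_assoc] using hI hF hg hφ.continuous hφc

/-- Fatou along an almost everywhere convergent subsequence. The exponents `p` and `q` are
unrelated: convergence in `L²` is enough to transfer `L³` or `L⁶` bounds from the approximations. -/
lemma eLpNorm_le_of_tendsto {T : ℕ → E3 → ℝ} {f : E3 → ℝ} {p : ℝ≥0∞} (hp : p ≠ 0)
    (hT : ∀ n, AEStronglyMeasurable (T n) volume) (hf : AEStronglyMeasurable f volume)
    (h : Tendsto (fun n => eLpNorm (fun x => T n x - f x) p volume) atTop (𝓝 0))
    (q : ℝ≥0∞) {A : ℝ≥0∞} (hA : ∀ n, eLpNorm (T n) q volume ≤ A) : eLpNorm f q volume ≤ A := by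
  obtain ⟨ns, -, hns⟩ := (tendstoInMeasure_of_tendsto_eLpNorm hp hT hf h).exists_seq_tendsto_ae
  refine (Lp.eLpNorm_lim_le_liminf_eLpNorm (fun n => hT (ns n)) f hns).trans ?_
  exact liminf_le_of_frequently_le' (Frequently.of_forall fun n => hA (ns n))

lemma eLpNorm_translation_le_of_tendsto {T : ℕ → E3 → ℝ} {f : E3 → ℝ} {p : ℝ≥0∞} (hp : 1 ≤ p)
    (hT : ∀ n, AEStronglyMeasurable (T n) volume) (hf : AEStronglyMeasurable f volume)
    (h : Tendsto (fun n => eLpNorm (fun x => T n x - f x) p volume) atTop (𝓝 0))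
    (q : ℝ≥0∞) {A : ℝ≥0∞} (y : E3) (hA : ∀ n, eLpNorm (fun x => T n (x - y) - T n x) q volume ≤ A) :
    eLpNorm (fun x => f (x - y) - f x) q volume ≤ A := by
  have hm : ∀ {g : E3 → ℝ}, AEStronglyMeasurable g volume →
      AEStronglyMeasurable (fun x => g (x - y) - g x) volume := fun hg =>
    (hg.comp_measurePreserving (measurePreserving_sub_right volume y)).sub hg
  refine eLpNorm_le_of_tendsto (zero_lt_one.trans_le hp).ne' (fun n => hm (hT n)) (hm hf) ?_ q hA
  have h2 := ENNReal.Tendsto.const_mul (a := 2) h (Or.inr (by simp))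
  rw [mul_zero] at h2
  refine tendsto_of_tendsto_of_tendsto_of_le_of_le tendsto_const_nhds h2 (fun _ => zero_le)
    fun n => ?_
  refine le_trans (le_of_eq ?_) (eLpNorm_sub_translation_le hp ((hT n).sub hf) y)
  congr 1; ext x; simp only [Pi.sub_apply]; ring

lemma tendsto_eLpNorm_S_nat {p : ℝ≥0∞} (hp : 1 ≤ p) (hp' : p ≠ ⊤) {f : E3 → ℝ}
    (hf : MemLp f p volume) :
    Tendsto (fun n : ℕ => eLpNorm (fun x => S (n + 1) f x - f x) p volume) atTop (𝓝 0) :=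
  (tendsto_eLpNorm_S hp hp' hf).comp
    (tendsto_atTop_add_const_right _ _ tendsto_natCast_atTop_atTop)

lemma norm_le_sum_abs (L : E3 →L[ℝ] ℝ) :
    ‖L‖ ≤ ∑ j, |L (EuclideanSpace.single j 1)| := by
  refine L.opNorm_le_bound (Finset.sum_nonneg fun _ _ => abs_nonneg _) fun x => ?_
  have hx : x = ∑ j, x j • EuclideanSpace.single j (1 : ℝ) := by
    ext i
    simp [Finset.sum_apply, Pi.single_apply]
  conv_lhs => rw [hx]
  rw [map_sum, Finset.sum_mul]
  refine (norm_sum_le _ _).trans (Finset.sum_le_sum fun j _ => ?_)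
  rw [map_smul, norm_smul, mul_comm, Real.norm_eq_abs (L _)]
  gcongr
  exact PiLp.norm_apply_le x j

lemma norm_fderiv_le (f : E3 → ℝ) (x : E3) : ‖fderiv ℝ f x‖ ≤ ∑ j, |pd j f x| :=
  norm_le_sum_abs _

lemma continuous_pd (j : Fin 3) {f : E3 → ℝ} (hf : ContDiff ℝ 1 f) : Continuous (pd j f) :=
  (hf.continuous_fderiv (by simp)).clm_apply continuous_const

lemma eLpNorm_sum_abs_le {p : ℝ≥0∞} (hp : 1 ≤ p) {G : Fin 3 → E3 → ℝ}
    (hG : ∀ j, AEStronglyMeasurable (G j) volume) :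
    eLpNorm (fun x => ∑ j, |G j x|) p volume ≤ ∑ j, eLpNorm (G j) p volume := by
  have h := eLpNorm_sum_le (μ := volume) (s := Finset.univ) (f := fun j x => |G j x|)
    (fun j _ => (hG j).norm) hp
  have e : (∑ j, fun x => |G j x|) = fun x => ∑ j, |G j x| := by ext x; simp
  rw [e] at h
  refine h.trans (Finset.sum_le_sum fun j _ => le_of_eq ?_)
  exact eLpNorm_norm (G j)

/-- Increments of continuously differentiable functions. -/
lemma eLpNorm_translation_le_of_contDiff {q : ℝ≥0∞} (hq : 1 ≤ q) {f : E3 → ℝ}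
    (hf : ContDiff ℝ 1 f) (y : E3) :
    eLpNorm (fun x => f (x - y) - f x) q volume ≤ ‖y‖ₑ * ∑ j, eLpNorm (pd j f) q volume := by
  have hd : ∀ x (t : ℝ), HasDerivAt (fun t : ℝ => f (x - t • y)) (-(fderiv ℝ f (x - t • y) y)) t :=
    fun x t => by
      have h1 : HasDerivAt (fun t : ℝ => x - t • y) (-y) t := by
        simpa using ((hasDerivAt_id t).smul_const y).const_sub x
      have h2 := ((hf.differentiable one_ne_zero) (x - t • y)).hasFDerivAt.comp_hasDerivAt t h1
      rw [map_neg] at h2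
      exact h2
  have hcont : Continuous fun z : E3 × ℝ => fderiv ℝ f (z.1 - z.2 • y) y :=
    ((hf.continuous_fderiv one_ne_zero).comp (by fun_prop)).clm_apply continuous_const
  have hint : ∀ x, f (x - y) - f x =
      ∫ t, (1 : ℝ) * (-(fderiv ℝ f (x - t • y) y)) ∂(volume.restrict (Ioc (0 : ℝ) 1)) := fun x => by
    simp only [one_mul]
    rw [← intervalIntegral.integral_of_le zero_le_one,
      intervalIntegral.integral_eq_sub_of_hasDerivAt (fun t _ => hd x t)]
    · simp
    · apply Continuous.intervalIntegrable
      exact (hcont.comp (by fun_prop : Continuous fun t : ℝ => (x, t))).neg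
  simp only [hint]
  -- The increment is an integral of directional derivatives along the segment, and translation
  -- invariance makes each slice norm independent of `t`.
  refine (eLpNorm_integral_mul_le hq (K := fun _ : ℝ => (1 : ℝ))
    (F := fun x t => -(fderiv ℝ f (x - t • y) y))
    (A := ‖y‖ₑ * ∑ j, eLpNorm (pd j f) q volume) aestronglyMeasurable_const
    hcont.neg.aestronglyMeasurable (ae_of_all _ fun t _ => ?_)).trans ?_
  · rw [← eLpNorm_comp_sub (f := fun x => -(fderiv ℝ f (x - t • y) y)) q
      (by
        have : Continuous fun x => fderiv ℝ f (x - t • y) y :=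
          hcont.comp (by fun_prop : Continuous fun x : E3 => (x, t))
        exact this.neg.aestronglyMeasurable) (-(t • y))]
    simp only [sub_neg_eq_add, add_sub_cancel_right]
    have h1 : eLpNorm (fun x => -(fderiv ℝ f x) y) q volume ≤
        ENNReal.ofReal ‖y‖ * eLpNorm (fun x => ∑ j, |pd j f x|) q volume := by
      refine eLpNorm_le_mul_eLpNorm_of_ae_le_mul (ae_of_all _ fun x => ?_) q
      rw [norm_neg, mul_comm, Real.norm_of_nonneg (Finset.sum_nonneg fun _ _ => abs_nonneg _)]
      refine (ContinuousLinearMap.le_opNorm _ _).trans ?_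
      gcongr
      exact norm_fderiv_le f x
    refine h1.trans ?_
    rw [ofReal_norm]
    gcongr
    exact eLpNorm_sum_abs_le hq fun j => (continuous_pd j hf).aestronglyMeasurable
  · simp

/-- Increments of Sobolev functions. -/
lemma IsH1.eLpNorm_translation_le {f : E3 → ℝ} {G : Fin 3 → E3 → ℝ} (h : IsH1 f G) {q : ℝ≥0∞}
    (hq : 1 ≤ q) (y : E3) :
    eLpNorm (fun x => f (x - y) - f x) q volume ≤ ‖y‖ₑ * ∑ j, eLpNorm (G j) q volume := by
  have hpos : ∀ n : ℕ, (0 : ℝ) < n + 1 := fun n => by positivity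
  refine eLpNorm_translation_le_of_tendsto (p := 2) (by norm_num)
    (fun n => (memLp_S (hpos n) (by norm_num) h.memLp).1) h.memLp.1
    (tendsto_eLpNorm_S_nat (by norm_num) (by norm_num) h.memLp) q y fun n => ?_
  refine (eLpNorm_translation_le_of_contDiff hq
    ((contDiff_S (hpos n) h.locallyIntegrable).of_le (by simp)) y).trans ?_
  gcongr with j
  rw [h.pd_S j (hpos n)]
  exact eLpNorm_S_le (hpos n) hq (h.grad_memLp j).1

/-! ### The Sobolev inequality -/

lemma exists_sobolev_const : ∃ C : ℝ≥0∞, C ≠ ⊤ ∧ ∀ f : E3 → ℝ, ContDiff ℝ 1 f →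
    HasCompactSupport f → eLpNorm f 6 volume ≤ C * ∑ j, eLpNorm (pd j f) 2 volume := by
  refine ⟨SNormLESNormFDerivOfEqConst ℝ (volume : Measure E3) 2, by simp, fun f hf hfc => ?_⟩
  have h := eLpNorm_le_eLpNorm_fderiv_of_eq (volume : Measure E3) hf hfc (p := 2) (p' := 6)
    one_le_two (by simp) (by simp; norm_num)
  rw [show (((6 : NNReal) : ℝ≥0∞)) = 6 from rfl, show (((2 : NNReal) : ℝ≥0∞)) = 2 from rfl] at h
  refine h.trans (mul_le_mul' le_rfl ?_)
  refine le_trans ?_ (eLpNorm_sum_abs_le one_le_two fun j =>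
    (continuous_pd j hf).aestronglyMeasurable)
  refine eLpNorm_mono fun x => ?_
  rw [Real.norm_of_nonneg (Finset.sum_nonneg fun _ _ => abs_nonneg _)]
  exact norm_fderiv_le f x

/-- The Sobolev inequality for smooth functions of `H¹`. -/
lemma exists_sobolev_const_smooth : ∃ C : ℝ≥0∞, C ≠ ⊤ ∧ ∀ f : E3 → ℝ, ContDiff ℝ ∞ f →
    MemLp f 2 volume → eLpNorm f 6 volume ≤ C * ∑ j, eLpNorm (pd j f) 2 volume := by
  obtain ⟨C, hC, hS⟩ := exists_sobolev_const
  refine ⟨C, hC, fun f hf hf2 => ?_⟩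
  have hb : ContDiff ℝ ∞ (bump : E3 → ℝ) := bump.contDiff
  choose M hM using fun j : Fin 3 => exists_bound_of_hasCompactSupport
    (contDiff_pd j hb).continuous (hasCompactSupport_pd j bump.hasCompactSupport)
  -- Cut-offs at radius of order `n + 1`. The term `f ∂χ` costs `‖f‖₂ / (n + 1)` and disappears in
  -- the limit, so only the gradient norm remains; Fatou removes the cut-off on the left.
  let χ : ℕ → E3 → ℝ := fun n x => bump (((n : ℝ) + 1)⁻¹ • x)
  have hχ : ∀ n, ContDiff ℝ ∞ (χ n) := fun n => hb.comp (contDiff_const_smul _)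
  have hχd : ∀ n j x, pd j (χ n) x = ((n : ℝ) + 1)⁻¹ * pd j bump (((n : ℝ) + 1)⁻¹ • x) := by
    intro n j x
    have h1 : HasFDerivAt (fun y : E3 => ((n : ℝ) + 1)⁻¹ • y)
      (((n : ℝ) + 1)⁻¹ • ContinuousLinearMap.id ℝ E3) x :=
        (hasFDerivAt_id x).const_smul ((n : ℝ) + 1)⁻¹
    have h2 : HasFDerivAt (χ n) _ x :=
      ((hb.differentiable (by simp)) (((n : ℝ) + 1)⁻¹ • x)).hasFDerivAt.comp x h1
    simp [pd, h2.fderiv]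
  have hχc : ∀ n, HasCompactSupport (χ n) := fun n =>
    bump.hasCompactSupport.comp_smul (by positivity)
  have hbound : ∀ n : ℕ, eLpNorm (fun x => χ n x * f x) 6 volume ≤
      C * ∑ j, (eLpNorm (pd j f) 2 volume +
        ENNReal.ofReal (((n : ℝ) + 1)⁻¹ * M j) * eLpNorm f 2 volume) := by
    intro n
    refine (hS _ (((hχ n).mul hf).of_le (by simp)) (hχc n).mul_right).trans ?_
    gcongr with j
    rw [pd_mul j ((hχ n).differentiable (by simp)) (hf.differentiable (by simp))]
    refine (eLpNorm_add_le ?_ ?_ (by norm_num)).trans (add_le_add ?_ ?_)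
    · exact ((hχ n).continuous.mul (contDiff_pd j hf).continuous).aestronglyMeasurable
    · exact ((contDiff_pd j (hχ n)).continuous.mul hf.continuous).aestronglyMeasurable
    · refine eLpNorm_mono fun x => ?_
      rw [norm_mul, Real.norm_of_nonneg bump.nonneg]
      exact mul_le_of_le_one_left (norm_nonneg _) bump.le_one
    · refine eLpNorm_le_mul_eLpNorm_of_ae_le_mul (ae_of_all _ fun x => ?_) 2
      rw [norm_mul, hχd, norm_mul, Real.norm_of_nonneg (by positivity)]
      gcongr
      exact hM j _
  have hlim : ∀ x, Tendsto (fun n => χ n x * f x) atTop (𝓝 (f x)) := fun x => by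
    have h0 : Tendsto (fun n : ℕ => ((n : ℝ) + 1)⁻¹) atTop (𝓝 0) :=
      tendsto_inv_atTop_zero.comp
        (tendsto_atTop_add_const_right _ _ tendsto_natCast_atTop_atTop)
    have h1 : Tendsto (fun n : ℕ => ((n : ℝ) + 1)⁻¹ • x) atTop (𝓝 0) := by
      simpa using h0.smul_const x
    have h2 := (hb.continuous.tendsto 0).comp h1
    have h3 : (bump : E3 → ℝ) 0 = 1 := bump.one_of_mem_closedBall (by simp [bump])
    rw [h3] at h2
    simpa using h2.mul_const (f x)
  have hrhs : Tendsto (fun n : ℕ => C * ∑ j, (eLpNorm (pd j f) 2 volume +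
        ENNReal.ofReal (((n : ℝ) + 1)⁻¹ * M j) * eLpNorm f 2 volume)) atTop
        (𝓝 (C * ∑ j, eLpNorm (pd j f) 2 volume)) := by
    refine ENNReal.Tendsto.const_mul (tendsto_finsetSum _ fun j _ => ?_) (Or.inr hC)
    have h0 : Tendsto (fun n : ℕ => ((n : ℝ) + 1)⁻¹ * M j) atTop (𝓝 (0 * M j)) :=
      (tendsto_inv_atTop_zero.comp
        (tendsto_atTop_add_const_right _ _ tendsto_natCast_atTop_atTop)).mul_const _
    have h1 := (ENNReal.continuous_ofReal.tendsto _).comp h0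
    have h2 := (ENNReal.Tendsto.mul_const (b := eLpNorm f 2 volume) h1
      (Or.inr hf2.2.ne)).const_add (eLpNorm (pd j f) 2 volume)
    simpa using h2
  refine (Lp.eLpNorm_lim_le_liminf_eLpNorm (fun n => ((hχ n).mul hf).continuous.aestronglyMeasurable)
    f (ae_of_all _ hlim)).trans ?_
  rw [← hrhs.liminf_eq]
  exact liminf_le_liminf (Eventually.of_forall hbound)

/-- The Sobolev inequality `H¹ ⊆ L⁶`. -/
lemma exists_sobolev_const_H1 : ∃ C : ℝ≥0∞, C ≠ ⊤ ∧ ∀ (f : E3 → ℝ) (G : Fin 3 → E3 → ℝ),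
    IsH1 f G → eLpNorm f 6 volume ≤ C * ∑ j, eLpNorm (G j) 2 volume := by
  obtain ⟨C, hC, hS⟩ := exists_sobolev_const_smooth
  refine ⟨C, hC, fun f G h => ?_⟩
  have hpos : ∀ n : ℕ, (0 : ℝ) < n + 1 := fun n => by positivity
  refine eLpNorm_le_of_tendsto (p := 2) (by norm_num)
    (fun n => (memLp_S (hpos n) (by norm_num) h.memLp).1) h.memLp.1
    (tendsto_eLpNorm_S_nat (by norm_num) (by norm_num) h.memLp) 6 fun n => ?_
  refine (hS _ (contDiff_S (hpos n) h.locallyIntegrable)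
    (memLp_S (hpos n) (by norm_num) h.memLp)).trans ?_
  gcongr with j
  rw [h.pd_S j (hpos n)]
  exact eLpNorm_S_le (hpos n) (by norm_num) (h.grad_memLp j).1

/-- Interpolation of `Lˢ` between `L²` and `L⁶`. -/
lemma eLpNorm_le_interpolation {f : E3 → ℝ} (hf : AEStronglyMeasurable f volume) {s : ℝ}
    (hs2 : 2 ≤ s) (hs6 : s ≤ 6) :
    eLpNorm f (ENNReal.ofReal s) volume ≤
      eLpNorm f 2 volume ^ (1 - 3 * (1 / 2 - 1 / s)) *
        eLpNorm f 6 volume ^ (3 * (1 / 2 - 1 / s)) := by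
  have hs : 0 < s := by linarith
  -- The weights come from `s = 2 · (6 - s)/4 + 6 · (s - 2)/4`.
  have h := ENNReal.lintegral_mul_norm_pow_le (μ := volume) (f := fun x => ‖f x‖ₑ ^ (2 : ℝ))
    (g := fun x => ‖f x‖ₑ ^ (6 : ℝ)) (hf.enorm.pow_const _) (hf.enorm.pow_const _)
    (p := (6 - s) / 4) (q := (s - 2) / 4) (by linarith) (by linarith) (by ring)
  have e : ∀ x, (‖f x‖ₑ ^ (2 : ℝ)) ^ ((6 - s) / 4) * (‖f x‖ₑ ^ (6 : ℝ)) ^ ((s - 2) / 4)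
      = ‖f x‖ₑ ^ s := fun x => by
    rw [← ENNReal.rpow_mul, ← ENNReal.rpow_mul, ← ENNReal.rpow_add_of_nonneg _ _ (by linarith)
      (by linarith)]
    congr 1; ring
  simp only [e] at h
  rw [eLpNorm_eq_lintegral_rpow_enorm_toReal (by simpa using hs) (by simp),
    eLpNorm_eq_lintegral_rpow_enorm_toReal (p := 2) (by simp) (by simp),
    eLpNorm_eq_lintegral_rpow_enorm_toReal (p := 6) (by simp) (by simp),
    ENNReal.toReal_ofReal hs.le]
  simp only [ENNReal.toReal_ofNat]
  refine (ENNReal.rpow_le_rpow h (by positivity)).trans (le_of_eq ?_)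
  rw [ENNReal.mul_rpow_of_nonneg _ _ (by positivity), ← ENNReal.rpow_mul, ← ENNReal.rpow_mul,
    ← ENNReal.rpow_mul, ← ENNReal.rpow_mul]
  congr 2 <;> field_simp <;> ring

/-! ### The energy flux through scale `1 / l` -/

lemma holderTriple_four_four_two : ENNReal.HolderTriple 4 4 2 := by
  refine ⟨?_⟩
  rw [← ENNReal.toReal_eq_toReal_iff' (by simp) (by simp), ENNReal.toReal_add (by simp) (by simp)]
  norm_num

lemma eLpNorm_mul_le (p q r : ℝ≥0∞) [p.HolderTriple q r] {f g : E3 → ℝ}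
    (hf : AEStronglyMeasurable f volume) (hg : AEStronglyMeasurable g volume) :
    eLpNorm (fun x => f x * g x) r volume ≤ eLpNorm f p volume * eLpNorm g q volume := by
  have h := eLpNorm_smul_le_mul_eLpNorm (p := p) (q := q) (r := r) hg hf
  have e : (f • g) = fun x => f x * g x := rfl
  rwa [e] at h

/-- The same telescoping as in `tendsto_integral_mul`, at exponents for which the product lands in
`L²` and can be paired with a gradient. Because `H¹ ⊆ L⁴`, it applies to products of mollified
velocities. -/
lemma tendsto_eLpNorm_mul_sub {ι : Type*} {F : Filter ι} {a b : ι → E3 → ℝ} {a' b' : E3 → ℝ}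
    (ha : ∀ᶠ i in F, MemLp (a i) 4 volume) (hb : ∀ᶠ i in F, MemLp (b i) 4 volume)
    (ha' : MemLp a' 4 volume) (hb' : MemLp b' 4 volume)
    (hal : Tendsto (fun i => eLpNorm (fun x => a i x - a' x) 4 volume) F (𝓝 0))
    (hbl : Tendsto (fun i => eLpNorm (fun x => b i x - b' x) 4 volume) F (𝓝 0)) :
    Tendsto (fun i => eLpNorm (fun x => a i x * b i x - a' x * b' x) 2 volume) F (𝓝 0) := by
  have := holderTriple_four_four_two
  have hlim : Tendsto (fun i => eLpNorm (fun x => a i x - a' x) 4 volume *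
      (eLpNorm (fun x => b i x - b' x) 4 volume + eLpNorm b' 4 volume) +
      eLpNorm a' 4 volume * eLpNorm (fun x => b i x - b' x) 4 volume) F (𝓝 0) := by
    have h1 := ENNReal.Tendsto.mul hal (Or.inr (by simpa using hb'.2.ne))
      (hbl.add_const (eLpNorm b' 4 volume)) (Or.inr (by simp))
    have h2 := ENNReal.Tendsto.const_mul (a := eLpNorm a' 4 volume) hbl (Or.inr ha'.2.ne)
    simpa using h1.add h2
  refine tendsto_of_tendsto_of_tendsto_of_le_of_le' tendsto_const_nhds hlim
    (Eventually.of_forall fun _ => zero_le) ?_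
  filter_upwards [ha, hb] with i hai hbi
  have e : (fun x => a i x * b i x - a' x * b' x) =
      (fun x => (a i x - a' x) * b i x) + fun x => a' x * (b i x - b' x) := by
    ext x; simp only [Pi.add_apply]; ring
  rw [e]
  refine (eLpNorm_add_le ((hai.1.sub ha'.1).mul hbi.1) (ha'.1.mul (hbi.1.sub hb'.1))
    (by norm_num)).trans (add_le_add ?_ ?_)
  · refine (eLpNorm_mul_le 4 4 2 (hai.1.sub ha'.1) hbi.1).trans ?_
    gcongr
    · exact le_rfl
    · have := eLpNorm_add_le (hbi.sub hb').1 hb'.1 (p := 4) (by norm_num)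
      rw [sub_add_cancel] at this
      exact this
  · exact eLpNorm_mul_le 4 4 2 ha'.1 (hbi.1.sub hb'.1)

lemma IsH1.memLp_six {f : E3 → ℝ} {G : Fin 3 → E3 → ℝ} (h : IsH1 f G) : MemLp f 6 volume := by
  obtain ⟨C, hC, hS⟩ := exists_sobolev_const_H1
  refine ⟨h.memLp.1, (hS f G h).trans_lt ?_⟩
  exact ENNReal.mul_lt_top hC.lt_top (ENNReal.sum_lt_top.2 fun j _ => (h.grad_memLp j).2)

lemma IsH1.memLp_four {f : E3 → ℝ} {G : Fin 3 → E3 → ℝ} (h : IsH1 f G) : MemLp f 4 volume := by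
  refine ⟨h.memLp.1, ?_⟩
  have := eLpNorm_le_interpolation h.memLp.1 (s := 4) (by norm_num) (by norm_num)
  rw [show ENNReal.ofReal 4 = 4 by simp] at this
  refine this.trans_lt (ENNReal.mul_lt_top ?_ ?_)
  · exact ENNReal.rpow_lt_top_of_nonneg (by norm_num) h.memLp.2.ne
  · exact ENNReal.rpow_lt_top_of_nonneg (by norm_num) h.memLp_six.2.ne

lemma IsH1.mul_memLp_two {f g : E3 → ℝ} {F G : Fin 3 → E3 → ℝ} (hf : IsH1 f F) (hg : IsH1 g G) :
    MemLp (fun x => f x * g x) 2 volume :=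
  have := holderTriple_four_four_two
  hg.memLp_four.mul' hf.memLp_four

/-- A divergence-free vector field of class `H¹`, with `G i j` the weak derivative `∂ⱼ vᵢ`. -/
structure IsSolenoidalH1 (v : Fin 3 → E3 → ℝ) (G : Fin 3 → Fin 3 → E3 → ℝ) : Prop where
  isH1 : ∀ i, IsH1 (v i) (G i)
  div_free : ∀ φ : E3 → ℝ, ContDiff ℝ ∞ φ → HasCompactSupport φ →
    ∑ i, ∫ x, v i x * pd i φ x = 0

/-- The energy flux `∑ᵢⱼ ∫ S(vᵢ vⱼ) ∂ⱼ S vᵢ`. -/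
def flux (l : ℝ) (v : Fin 3 → E3 → ℝ) : ℝ :=
  ∑ i, ∑ j, ∫ x, S l (fun y => v i y * v j y) x * pd j (S l (v i)) x

variable {v : Fin 3 → E3 → ℝ} {G : Fin 3 → Fin 3 → E3 → ℝ}

/-- Incompressibility tested with `y ↦ mol l (x - y)`, which yields the identity at every point. -/
lemma IsSolenoidalH1.sum_S_eq_zero (h : IsSolenoidalH1 v G) (l : ℝ) (hl : 0 < l) (x : E3) :
    ∑ i, S l (G i i) x = 0 := by
  have hφ : ContDiff ℝ ∞ (fun y => mol l (x - y)) :=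
    (contDiff_mol l).comp (contDiff_const.sub contDiff_id)
  have hφc : HasCompactSupport (fun y => mol l (x - y)) :=
    (hasCompactSupport_mol hl).comp_homeomorph (Homeomorph.subLeft x)
  have h0 := h.div_free _ hφ hφc
  simp only [fun i => (h.isH1 i).weakDeriv i _ hφ hφc, Finset.sum_neg_distrib, neg_eq_zero] at h0
  rw [← h0]
  refine Finset.sum_congr rfl fun i _ => ?_
  rw [S, conv_comm, conv]

/-- This exchange gives the purely vertical part of the flux its horizontal factor. -/
lemma IsSolenoidalH1.S_two_two (h : IsSolenoidalH1 v G) (l : ℝ) (hl : 0 < l) (x : E3) :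
    S l (G 2 2) x = -(S l (G 0 0) x + S l (G 1 1) x) := by
  have := h.sum_S_eq_zero l hl x
  rw [Fin.sum_univ_three] at this
  linarith

lemma exists_bound_S {l : ℝ} (hl : 0 < l) {f : E3 → ℝ} (hf : MemLp f 2 volume) :
    ∃ C, ∀ x, |S l f x| ≤ C := by
  have hfin : eLpNorm (mol l) 2 volume * eLpNorm f 2 volume ≠ ⊤ :=
    ENNReal.mul_ne_top (memLp_mol hl 2).2.ne hf.2.ne
  refine ⟨(eLpNorm (mol l) 2 volume * eLpNorm f 2 volume).toReal, fun x => ?_⟩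
  have := enorm_conv_le 2 2 (memLp_mol hl 2).1 hf.1 x
  have h2 := ENNReal.toReal_mono hfin this
  simpa [S] using h2

lemma IsH1.contDiff_S {f : E3 → ℝ} {F : Fin 3 → E3 → ℝ} (h : IsH1 f F) {l : ℝ} (hl : 0 < l) :
    ContDiff ℝ ∞ (S l f) := AnisoNS.contDiff_S hl h.locallyIntegrable

lemma IsH1.differentiable_S {f : E3 → ℝ} {F : Fin 3 → E3 → ℝ} (h : IsH1 f F) {l : ℝ} (hl : 0 < l) :
    Differentiable ℝ (S l f) := (h.contDiff_S hl).differentiable (by simp)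

/-- The mollified field does no work on itself. -/
lemma IsSolenoidalH1.sum_integral_S_eq_zero (h : IsSolenoidalH1 v G) {l : ℝ} (hl : 0 < l) :
    ∑ i, ∑ j, ∫ x, (S l (v i) x * S l (v j) x) * S l (G i j) x = 0 := by
  refine Finset.sum_eq_zero fun i _ => ?_
  -- Since `Svᵢ ∂ⱼSvᵢ` is half of `∂ⱼ(Svᵢ)²`, integration by parts moves the derivative onto `Svⱼ`;
  -- the sum over `j` then contains the divergence.
  have key : ∀ j, 2 * ∫ x, (S l (v i) x * S l (v j) x) * S l (G i j) x =
      - ∫ x, S l (G j j) x * (S l (v i) x * S l (v i) x) := by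
    intro j
    have a2 := memLp_S hl one_le_two (h.isH1 i).memLp
    have b2 := memLp_S hl one_le_two (h.isH1 j).memLp
    have da2 := memLp_S hl one_le_two ((h.isH1 i).grad_memLp j)
    have db2 := memLp_S hl one_le_two ((h.isH1 j).grad_memLp j)
    obtain ⟨C, hC⟩ := exists_bound_S hl (h.isH1 j).memLp
    obtain ⟨C', hC'⟩ := exists_bound_S hl ((h.isH1 j).grad_memLp j)
    have i0 : Integrable (fun x => S l (v i) x * S l (v i) x) := a2.integrable_mul a2
    have i1 : Integrable (fun x => S l (v i) x * S l (G i j) x + S l (G i j) x * S l (v i) x) :=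
      (a2.integrable_mul da2).add (da2.integrable_mul a2)
    have hibp := integral_mul_pd j (f := S l (v j)) (g := fun x => S l (v i) x * S l (v i) x)
      ((h.isH1 j).differentiable_S hl)
      (((h.isH1 i).differentiable_S hl).mul ((h.isH1 i).differentiable_S hl)) ?_ ?_ ?_
    · rw [pd_mul j ((h.isH1 i).differentiable_S hl) ((h.isH1 i).differentiable_S hl),
        (h.isH1 i).pd_S j hl, (h.isH1 j).pd_S j hl] at hibp
      rw [← hibp, ← integral_const_mul]
      congr 1; ext x; ring
    · rw [(h.isH1 j).pd_S j hl]
      exact i0.bdd_mul (c := C') db2.1 (ae_of_all _ hC')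
    · rw [pd_mul j ((h.isH1 i).differentiable_S hl) ((h.isH1 i).differentiable_S hl),
        (h.isH1 i).pd_S j hl]
      exact i1.bdd_mul (c := C) b2.1 (ae_of_all _ hC)
    · exact i0.bdd_mul (c := C) b2.1 (ae_of_all _ hC)
  have hsum : 2 * ∑ j, ∫ x, (S l (v i) x * S l (v j) x) * S l (G i j) x = 0 := by
    rw [Finset.mul_sum, Finset.sum_congr rfl fun j _ => key j, Finset.sum_neg_distrib,
      ← integral_finsetSum]
    · simp [← Finset.sum_mul, h.sum_S_eq_zero l hl]
    · intro j _
      obtain ⟨C', hC'⟩ := exists_bound_S hl ((h.isH1 j).grad_memLp j)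
      have a2 := memLp_S hl one_le_two (h.isH1 i).memLp
      exact (a2.integrable_mul a2).bdd_mul (c := C')
        (memLp_S hl one_le_two ((h.isH1 j).grad_memLp j)).1 (ae_of_all _ hC')
  linarith

lemma IsSolenoidalH1.flux_eq (h : IsSolenoidalH1 v G) {l : ℝ} (hl : 0 < l) :
    flux l v = ∑ i, ∑ j, ∫ x, S l (fun y => v i y * v j y) x * S l (G i j) x := by
  simp only [flux, fun i j => (h.isH1 i).pd_S j hl]

lemma memLp_S_mul_S {l : ℝ} (hl : 0 < l) {f g : E3 → ℝ} (hf : MemLp f 2 volume)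
    (hg : MemLp g 2 volume) : MemLp (fun x => S l f x * S l g x) 2 volume := by
  obtain ⟨C, hC⟩ := exists_bound_S hl hf
  have hf2 := memLp_S hl one_le_two hf
  have hg2 := memLp_S hl one_le_two hg
  refine hg2.of_le_mul (c := C) (hf2.1.mul hg2.1) (ae_of_all _ fun x => ?_)
  rw [norm_mul]
  gcongr
  exact hC x

/-- The Constantin–E–Titi form of the flux. -/
lemma IsSolenoidalH1.flux_eq_commutator (h : IsSolenoidalH1 v G) {l : ℝ} (hl : 0 < l) :
    flux l v = ∑ i, ∑ j, ∫ x, (S l (fun y => v i y * v j y) x - S l (v i) x * S l (v j) x) *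
      S l (G i j) x := by
  rw [h.flux_eq hl, ← sub_zero (∑ i, ∑ j, _), ← h.sum_integral_S_eq_zero hl,
    ← Finset.sum_sub_distrib]
  refine Finset.sum_congr rfl fun i _ => ?_
  rw [← Finset.sum_sub_distrib]
  refine Finset.sum_congr rfl fun j _ => ?_
  have g2 := memLp_S hl one_le_two ((h.isH1 i).grad_memLp j)
  rw [← integral_sub]
  · simp only [sub_mul]
  · exact (memLp_S hl one_le_two ((h.isH1 i).mul_memLp_two (h.isH1 j))).integrable_mul g2
  · exact (memLp_S_mul_S hl (h.isH1 i).memLp (h.isH1 j).memLp).integrable_mul g2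

/-- The flux of a divergence-free `H¹` field vanishes at small scales. -/
lemma IsSolenoidalH1.tendsto_flux (h : IsSolenoidalH1 v G) :
    Tendsto (fun l => flux l v) atTop (𝓝 0) := by
  have h1 : Tendsto (fun l => ∑ i, ∑ j, ∫ x, S l (fun y => v i y * v j y) x * S l (G i j) x) atTop
      (𝓝 (∑ i, ∑ j, ∫ x, (v i x * v j x) * G i j x)) := by
    refine tendsto_finsetSum _ fun i _ => tendsto_finsetSum _ fun j _ => ?_
    have m := (h.isH1 i).mul_memLp_two (h.isH1 j)
    have g := (h.isH1 i).grad_memLp j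
    refine tendsto_integral_mul 2 2 one_le_two ?_ ?_ m g (tendsto_eLpNorm_S one_le_two (by simp) m)
      (tendsto_eLpNorm_S one_le_two (by simp) g)
    · filter_upwards [eventually_gt_atTop 0] with l hl using memLp_S hl one_le_two m
    · filter_upwards [eventually_gt_atTop 0] with l hl using memLp_S hl one_le_two g
  -- Mollifying before or after taking the product leads to the same limit `∑ ∫ vᵢ vⱼ ∂ⱼvᵢ`. This
  -- second family is identically zero for `l > 0`, so the common limit is zero.
  have h2 : Tendsto (fun l => ∑ i, ∑ j, ∫ x, (S l (v i) x * S l (v j) x) * S l (G i j) x) atTop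
      (𝓝 (∑ i, ∑ j, ∫ x, (v i x * v j x) * G i j x)) := by
    refine tendsto_finsetSum _ fun i _ => tendsto_finsetSum _ fun j _ => ?_
    have m := (h.isH1 i).mul_memLp_two (h.isH1 j)
    have g := (h.isH1 i).grad_memLp j
    have f4 : ∀ i, ∀ᶠ l in atTop, MemLp (S l (v i)) 4 volume := fun i => by
      filter_upwards [eventually_gt_atTop 0] with l hl using
        memLp_S hl (by norm_num) (h.isH1 i).memLp_four
    refine tendsto_integral_mul 2 2 one_le_two ?_ ?_ m g (tendsto_eLpNorm_mul_sub (f4 i) (f4 j)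
      (h.isH1 i).memLp_four (h.isH1 j).memLp_four
      (tendsto_eLpNorm_S (by norm_num) (by simp) (h.isH1 i).memLp_four)
      (tendsto_eLpNorm_S (by norm_num) (by simp) (h.isH1 j).memLp_four))
      (tendsto_eLpNorm_S one_le_two (by simp) g)
    · filter_upwards [eventually_gt_atTop 0] with l hl using
        memLp_S_mul_S hl (h.isH1 i).memLp (h.isH1 j).memLp
    · filter_upwards [eventually_gt_atTop 0] with l hl using memLp_S hl one_le_two g
  have h3 : Tendsto (fun l => ∑ i, ∑ j, ∫ x, (S l (v i) x * S l (v j) x) * S l (G i j) x) atTop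
      (𝓝 0) := by
    refine tendsto_const_nhds.congr' ?_
    filter_upwards [eventually_gt_atTop 0] with l hl using (h.sum_integral_S_eq_zero hl).symm
  rw [tendsto_nhds_unique h2 h3] at h1
  refine h1.congr' ?_
  filter_upwards [eventually_gt_atTop 0] with l hl using (h.flux_eq hl).symm

/-! ### Bounds for the flux: integrability conditions -/

lemma one_le_of_holderTriple_one (p q : ℝ≥0∞) [h : p.HolderTriple q 1] : 1 ≤ p := by
  have h1 := h.inv_add_inv_eq_inv
  rw [← ENNReal.inv_le_inv, ← h1]
  exact le_self_add

/-- Mollification is a contraction on every `Lᵖ` with `p ≥ 1`, so Hölder's inequality costs nothing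
in `l`. -/
lemma enorm_integral_S_mul_S_le (a b m c : ℝ≥0∞) [a.HolderTriple b m] [m.HolderTriple c 1]
    {l : ℝ} (hl : 0 < l) {f g w : E3 → ℝ} (hf : AEStronglyMeasurable f volume)
    (hg : AEStronglyMeasurable g volume) (hw : AEStronglyMeasurable w volume) :
    ‖∫ x, S l (fun y => f y * g y) x * S l w x‖ₑ ≤
      eLpNorm f a volume * eLpNorm g b volume * eLpNorm w c volume := by
  have : c.HolderTriple m 1 := ENNReal.HolderTriple.symm
  have hm := (integrable_mol hl).1
  refine (enorm_integral_mul_le m c (aestronglyMeasurable_conv hm (hf.mul hg))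
    (aestronglyMeasurable_conv hm hw)).trans ?_
  gcongr
  · exact (eLpNorm_S_le hl (one_le_of_holderTriple_one m c) (hf.mul hg)).trans
      (eLpNorm_mul_le a b m hf hg)
  · exact eLpNorm_S_le hl (one_le_of_holderTriple_one c m) hw

/-- Integration by parts in the vertical flux. -/
lemma integral_S_sq_mul_S_deriv {l : ℝ} (hl : 0 < l) {f g : E3 → ℝ} {F K : Fin 3 → E3 → ℝ}
    (hf : IsH1 f F) (hg : IsH1 g K) (j : Fin 3) :
    ∫ x, S l (fun y => f y * f y) x * S l (K j) x =
      - ∫ x, S l (fun y => f y * F j y + F j y * f y) x * S l g x := by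
  have hff := hf.mul_memLp_two hf
  have hli : LocallyIntegrable (fun y => f y * f y) := hff.locallyIntegrable one_le_two
  have hwd := HasWeakDeriv.mul hf.memLp hf.memLp (hf.grad_memLp j) (hf.grad_memLp j)
    (hf.weakDeriv j) (hf.weakDeriv j)
  have hd1 : Integrable (fun y => f y * F j y + F j y * f y) :=
    (hf.memLp.integrable_mul (hf.grad_memLp j)).add ((hf.grad_memLp j).integrable_mul hf.memLp)
  have hS1 : Integrable (S l (fun y => f y * F j y + F j y * f y)) :=
    memLp_one_iff_integrable.1 (memLp_S hl le_rfl (memLp_one_iff_integrable.2 hd1))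
  obtain ⟨C, hC⟩ := exists_bound_S hl hg.memLp
  have s2 := memLp_S hl one_le_two hff
  have g2 := memLp_S hl one_le_two hg.memLp
  have hibp := integral_mul_pd j (f := S l (fun y => f y * f y)) (g := S l g)
      ((contDiff_S hl hli).differentiable (by simp)) (hg.differentiable_S hl) ?_ ?_ ?_
  · rwa [hg.pd_S j hl, pd_S hl hli hwd] at hibp
  · rw [pd_S hl hli hwd]
    exact hS1.mul_bdd (c := C) g2.1 (ae_of_all _ hC)
  · rw [hg.pd_S j hl]
    exact s2.integrable_mul (memLp_S hl one_le_two (hg.grad_memLp j))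
  · exact s2.integrable_mul g2

/-- The flux is controlled by `‖u_h‖ ‖u‖ ‖∇u‖`. -/
lemma IsSolenoidalH1.enorm_flux_le (h : IsSolenoidalH1 v G) (a b q₁ q₂ : ℝ≥0∞)
    [a.HolderTriple b 2] [q₁.HolderTriple q₂ 2] {l : ℝ} (hl : 0 < l) :
    ‖flux l v‖ₑ ≤ 12 * (((eLpNorm (v 0) a volume + eLpNorm (v 1) a volume) *
        (eLpNorm (v 0) b volume + eLpNorm (v 1) b volume) +
      (eLpNorm (v 0) q₁ volume + eLpNorm (v 1) q₁ volume) * eLpNorm (v 2) q₂ volume) *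
        ∑ i, ∑ j, eLpNorm (G i j) 2 volume) := by
  set M := (eLpNorm (v 0) a volume + eLpNorm (v 1) a volume) *
        (eLpNorm (v 0) b volume + eLpNorm (v 1) b volume) +
      (eLpNorm (v 0) q₁ volume + eLpNorm (v 1) q₁ volume) * eLpNorm (v 2) q₂ volume with hM
  set D := ∑ i, ∑ j, eLpNorm (G i j) 2 volume with hD
  have hD' : ∀ i j, eLpNorm (G i j) 2 volume ≤ D := fun i j =>
    (Finset.single_le_sum (f := fun j => eLpNorm (G i j) 2 volume) (fun _ _ => zero_le)
      (Finset.mem_univ j)).trans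
    (Finset.single_le_sum (f := fun i => ∑ j, eLpNorm (G i j) 2 volume) (fun _ _ => zero_le)
      (Finset.mem_univ i))
  have hm := fun i => (h.isH1 i).memLp.1
  have hgm := fun i j => ((h.isH1 i).grad_memLp j).1
  have hh : ∀ i j k : Fin 3, (i = 0 ∨ i = 1) → (j = 0 ∨ j = 1) →
      ‖∫ x, S l (fun y => v i y * v j y) x * S l (G i k) x‖ₑ ≤ M * D := by
    intro i j k hi hj
    refine (enorm_integral_S_mul_S_le a b 2 2 hl (hm i) (hm j) (hgm i k)).trans ?_
    refine mul_le_mul' (le_trans (mul_le_mul' ?_ ?_) (le_self_add)) (hD' i k)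
    · rcases hi with rfl | rfl
      exacts [le_self_add, le_add_self]
    · rcases hj with rfl | rfl
      exacts [le_self_add, le_add_self]
  have hq : ∀ i, (i = 0 ∨ i = 1) → eLpNorm (v i) q₁ volume * eLpNorm (v 2) q₂ volume ≤ M := by
    intro i hi
    refine le_trans (mul_le_mul' ?_ le_rfl) le_add_self
    rcases hi with rfl | rfl
    exacts [le_self_add, le_add_self]
  have hv : ∀ i k j : Fin 3, (i = 0 ∨ i = 1) →
      ‖∫ x, S l (fun y => v i y * v 2 y) x * S l (G k j) x‖ₑ ≤ M * D := by
    intro i k j hi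
    refine (enorm_integral_S_mul_S_le q₁ q₂ 2 2 hl (hm i) (hm 2) (hgm k j)).trans ?_
    exact mul_le_mul' (hq i hi) (hD' k j)
  have hv' : ∀ i k j : Fin 3, (i = 0 ∨ i = 1) →
      ‖∫ x, S l (fun y => v 2 y * v i y) x * S l (G k j) x‖ₑ ≤ M * D := by
    intro i k j hi
    simp only [mul_comm (v 2 _)]
    exact hv i k j hi
  -- Only `vᵢ`, not its derivative, is controlled in `L^{q₁}`. Integration by parts moves the
  -- derivative onto `v₃²`, leaving `v₃ ∂ᵢv₃ vᵢ` with exponents `q₂`, `2`, `q₁`.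
  have hz : ∀ i : Fin 3, (i = 0 ∨ i = 1) →
      ‖∫ x, S l (fun y => v 2 y * v 2 y) x * S l (G i i) x‖ₑ ≤ 2 * (M * D) := by
    intro i hi
    rw [integral_S_sq_mul_S_deriv hl (h.isH1 2) (h.isH1 i) i, enorm_neg]
    set m := (q₂⁻¹ + 2⁻¹)⁻¹ with hmdef
    have hqq : q₁⁻¹ + q₂⁻¹ = 2⁻¹ := ENNReal.HolderTriple.inv_add_inv_eq_inv q₁ q₂ 2
    have t1 : q₂.HolderTriple 2 m := ⟨by rw [hmdef, inv_inv]⟩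
    have t2 : m.HolderTriple q₁ 1 := ⟨by
      rw [hmdef, inv_inv, inv_one, add_right_comm, add_comm q₂⁻¹, hqq, ENNReal.inv_two_add_inv_two]⟩
    have t3 : q₁.HolderTriple m 1 := ENNReal.HolderTriple.symm
    have hmm := (integrable_mol hl).1
    have hs : AEStronglyMeasurable (fun y => v 2 y * G 2 i y + G 2 i y * v 2 y) volume :=
      ((hm 2).mul (hgm 2 i)).add ((hgm 2 i).mul (hm 2))
    have hone := one_le_of_holderTriple_one m q₁
    refine (enorm_integral_mul_le m q₁ (aestronglyMeasurable_conv hmm hs)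
      (aestronglyMeasurable_conv hmm (hm i))).trans ?_
    have b1 : eLpNorm (S l fun y => v 2 y * G 2 i y + G 2 i y * v 2 y) m volume ≤
        2 * (eLpNorm (v 2) q₂ volume * eLpNorm (G 2 i) 2 volume) := by
      refine (eLpNorm_S_le hl hone hs).trans ?_
      refine (eLpNorm_add_le ((hm 2).mul (hgm 2 i)) ((hgm 2 i).mul (hm 2)) hone).trans ?_
      rw [two_mul]
      refine add_le_add (eLpNorm_mul_le q₂ 2 m (hm 2) (hgm 2 i)) ?_
      rw [mul_comm (G 2 i)]
      exact eLpNorm_mul_le q₂ 2 m (hm 2) (hgm 2 i)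
    have b2 : eLpNorm (S l (v i)) q₁ volume ≤ eLpNorm (v i) q₁ volume :=
      eLpNorm_S_le hl (one_le_of_holderTriple_one q₁ m) (hm i)
    calc _ ≤ 2 * (eLpNorm (v 2) q₂ volume * eLpNorm (G 2 i) 2 volume) *
          eLpNorm (v i) q₁ volume := mul_le_mul' b1 b2
      _ = 2 * ((eLpNorm (v i) q₁ volume * eLpNorm (v 2) q₂ volume) *
          eLpNorm (G 2 i) 2 volume) := by ring
      _ ≤ _ := by
        gcongr
        · exact hq i hi
        · exact hD' 2 i
  have h22 : ‖∫ x, S l (fun y => v 2 y * v 2 y) x * S l (G 2 2) x‖ₑ ≤ 4 * (M * D) := by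
    have s2 := memLp_S hl one_le_two ((h.isH1 2).mul_memLp_two (h.isH1 2))
    have e : ∫ x, S l (fun y => v 2 y * v 2 y) x * S l (G 2 2) x =
        -((∫ x, S l (fun y => v 2 y * v 2 y) x * S l (G 0 0) x) +
          ∫ x, S l (fun y => v 2 y * v 2 y) x * S l (G 1 1) x) := by
      rw [← integral_add, ← integral_neg]
      · simp only [h.S_two_two l hl]
        congr 1; ext x; ring
      · exact s2.integrable_mul (memLp_S hl one_le_two ((h.isH1 0).grad_memLp 0))
      · exact s2.integrable_mul (memLp_S hl one_le_two ((h.isH1 1).grad_memLp 1))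
    rw [e, enorm_neg]
    refine (enorm_add_le _ _).trans ((add_le_add (hz 0 (by simp)) (hz 1 (by simp))).trans
      (le_of_eq ?_))
    ring
  -- Eight of the nine terms have a horizontal factor in the product and cost `M * D` each; the
  -- vertical one splits by incompressibility into two terms of cost `2 * (M * D)`. Hence the
  -- constant twelve.
  rw [h.flux_eq hl]
  simp only [Fin.sum_univ_three]
  refine (enorm_add_le _ _).trans ((add_le_add ((enorm_add_le _ _).trans (add_le_add
    ((enorm_add_le _ _).trans (add_le_add ((enorm_add_le _ _).trans (add_le_add
      (hh 0 0 0 (by simp) (by simp)) (hh 0 1 1 (by simp) (by simp)))) (hv 0 0 2 (by simp))))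
    ((enorm_add_le _ _).trans (add_le_add ((enorm_add_le _ _).trans (add_le_add
      (hh 1 0 0 (by simp) (by simp)) (hh 1 1 1 (by simp) (by simp)))) (hv 1 1 2 (by simp))))))
    ((enorm_add_le _ _).trans (add_le_add ((enorm_add_le _ _).trans (add_le_add
      (hv' 0 2 0 (by simp)) (hv' 1 2 1 (by simp)))) h22))).trans (le_of_eq ?_))
  ring

/-! ### Bounds for the flux: conditions on derivatives and increments -/

variable {v : Fin 3 → E3 → ℝ} {G : Fin 3 → Fin 3 → E3 → ℝ}

lemma norm_le_of_pd_mol_ne_zero {l : ℝ} (hl : 0 < l) {j : Fin 3} {x : E3}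
    (h : pd j (mol l) x ≠ 0) : ‖x‖ ≤ 2 / l := by
  have h1 : x ∈ tsupport (mol l) := by
    refine support_fderiv_subset ℝ (f := mol l) (fun h0 => h ?_)
    simp [pd, h0]
  have h2 : tsupport (mol l) ⊆ Metric.closedBall 0 (2 / l) := by
    refine closure_minimal (fun y hy => ?_) Metric.isClosed_closedBall
    simpa using (norm_lt_of_mol_ne_zero hl hy).le
  simpa using h2 h1

/-- The sum of the `L¹` norms of the derivatives of the mollifier at scale one. -/
def etaConst : ℝ≥0∞ := ∑ j, eLpNorm (pd j eta) 1 volume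

lemma memLp_pd_eta (j : Fin 3) (p : ℝ≥0∞) : MemLp (pd j eta) p volume :=
  memLp_of_hasCompactSupport (contDiff_pd j contDiff_eta).continuous
    (hasCompactSupport_pd j hasCompactSupport_eta)

lemma memLp_pd_mol {l : ℝ} (hl : 0 < l) (j : Fin 3) (p : ℝ≥0∞) : MemLp (pd j (mol l)) p volume :=
  memLp_of_hasCompactSupport (contDiff_pd j (contDiff_mol l)).continuous
    (hasCompactSupport_pd j (hasCompactSupport_mol hl))

lemma etaConst_ne_top : etaConst ≠ ⊤ :=
  (ENNReal.sum_lt_top.2 fun j _ => (memLp_pd_eta j 1).2).ne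

lemma eLpNorm_pd_mol_le {l : ℝ} (hl : 0 < l) (j : Fin 3) :
    eLpNorm (pd j (mol l)) 1 volume ≤ ENNReal.ofReal l * etaConst := by
  have h1 : Integrable (pd j eta) := memLp_one_iff_integrable.1 (memLp_pd_eta j 1)
  rw [mol, pd_dil j l (contDiff_eta.differentiable (by simp))]
  have h2 := eLpNorm_const_smul l (dil l (pd j eta)) 1 (volume : Measure E3)
  have e : (l • dil l (pd j eta)) = fun x => l * dil l (pd j eta) x := rfl
  rw [e, eLpNorm_one_dil hl h1, Real.enorm_of_nonneg hl.le] at h2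
  rw [h2]
  gcongr
  exact Finset.single_le_sum (f := fun j => eLpNorm (pd j eta) 1 volume) (fun _ _ => zero_le)
    (Finset.mem_univ j)

lemma integral_pd_mol {l : ℝ} (hl : 0 < l) (j : Fin 3) : ∫ x, pd j (mol l) x = 0 := by
  have h := hasWeakDeriv_of_contDiff j (f := fun _ => (1 : ℝ)) contDiff_const (mol l)
    (contDiff_mol l) (hasCompactSupport_mol hl)
  simpa [pd] using h

lemma conv_mul_sub {K f g : E3 → ℝ} (hK : MemLp K ⊤ volume) (hK2 : MemLp K 2 volume)
    (hf : MemLp f 2 volume) (hg : MemLp g 2 volume) (x : E3) :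
    conv K (fun y => f y * g y) x - g x * conv K f x =
      ∫ y, K y * (f (x - y) * (g (x - y) - g x)) := by
  have hfg : MemLp (fun y => f y * g y) 1 volume :=
    memLp_one_iff_integrable.2 (hf.integrable_mul hg)
  have i1 := integrable_conv_integrand ⊤ 1 hK hfg x
  have i2 := (integrable_conv_integrand 2 2 hK2 hf x).const_mul (g x)
  rw [conv, conv, ← integral_const_mul, ← integral_sub i1 i2]
  congr 1; ext y; ring

/-- The commutator is the average of `f(x - y)(g(x - y) - g(x))` against `k`, so only increments of
`g` over the support of the kernel occur. The gained factor `R` is what pays for a derivative of the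
mollifier. -/
lemma IsH1.eLpNorm_commutator_le {f g : E3 → ℝ} {K : Fin 3 → E3 → ℝ} (s q n : ℝ≥0∞)
    [s.HolderTriple q n] (hn : 1 ≤ n) (hq : 1 ≤ q) (hf : MemLp f 2 volume) (hg : IsH1 g K)
    {k : E3 → ℝ} (hk : ∀ p, MemLp k p volume) {R : ℝ} (hR : ∀ y, k y ≠ 0 → ‖y‖ ≤ R) :
    eLpNorm (fun x => conv k (fun y => f y * g y) x - g x * conv k f x) n volume ≤
      eLpNorm k 1 volume * (eLpNorm f s volume *
        (ENNReal.ofReal R * ∑ j, eLpNorm (K j) q volume)) := by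
  simp only [conv_mul_sub (hk ⊤) (hk 2) hf hg.memLp]
  rw [eLpNorm_one_eq_lintegral_enorm]
  refine eLpNorm_integral_mul_le hn (hk 1).1 (F := fun x y => f (x - y) * (g (x - y) - g x)) ?_
    (ae_of_all _ fun y hy => ?_)
  · exact (aestronglyMeasurable_comp_sub hf.1).mul
      ((aestronglyMeasurable_comp_sub hg.memLp.1).sub hg.memLp.1.comp_fst)
  · have mf : AEStronglyMeasurable (fun x => f (x - y)) volume :=
      hf.1.comp_measurePreserving (measurePreserving_sub_right volume y)
    have mg : AEStronglyMeasurable (fun x => g (x - y)) volume :=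
      hg.memLp.1.comp_measurePreserving (measurePreserving_sub_right volume y)
    refine (eLpNorm_mul_le s q n mf (mg.sub hg.memLp.1)).trans ?_
    rw [eLpNorm_comp_sub s hf.1]
    gcongr
    refine (hg.eLpNorm_translation_le hq y).trans ?_
    gcongr
    rw [← ofReal_norm]
    exact ENNReal.ofReal_le_ofReal (hR y hy)

/-- The mixed flux `∫ S(f g) ∂ⱼ S f` only needs the gradient of `g`. -/
lemma enorm_integral_S_mul_S_deriv_le {f g : E3 → ℝ} {F K : Fin 3 → E3 → ℝ} (s q n : ℝ≥0∞)
    [s.HolderTriple q n] [n.HolderTriple s 1] (hq : 1 ≤ q) (hf : IsH1 f F) (hg : IsH1 g K)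
    {l : ℝ} (hl : 0 < l) (j : Fin 3) :
    ‖∫ x, S l (fun y => f y * g y) x * S l (F j) x‖ₑ ≤
      4 * etaConst * (eLpNorm f s volume * eLpNorm f s volume * ∑ j, eLpNorm (K j) q volume) := by
  have hsn : s.HolderTriple n 1 := ENNReal.HolderTriple.symm
  have hn := one_le_of_holderTriple_one n s
  have hs := one_le_of_holderTriple_one s n
  have hfg := hf.mul_memLp_two hg
  have hfgl : LocallyIntegrable (fun y => f y * g y) := hfg.locallyIntegrable one_le_two
  have hpd : conv (pd j (mol l)) f = S l (F j) := by
    rw [← hf.pd_S j hl, S, pd_conv j (contDiff_mol l) (hasCompactSupport_mol hl)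
      hf.locallyIntegrable]
  have hpm : Integrable (pd j (mol l)) := memLp_one_iff_integrable.1 (memLp_pd_mol hl j 1)
  have hpdfg : pd j (S l (fun y => f y * g y)) = conv (pd j (mol l)) (fun y => f y * g y) := by
    rw [S, pd_conv j (contDiff_mol l) (hasCompactSupport_mol hl) hfgl]
  have s1 := memLp_S hl one_le_two hfg
  have s2 := memLp_S hl one_le_two (hf.grad_memLp j)
  have s3 := memLp_S hl one_le_two hf.memLp
  have s4 := memLp_conv one_le_two hpm hfg
  have hibp := integral_mul_pd j (f := S l (fun y => f y * g y)) (g := S l f)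
    ((contDiff_S hl hfgl).differentiable (by simp)) (hf.differentiable_S hl)
    (by rw [hpdfg]; exact s4.integrable_mul s3) (by rw [hf.pd_S j hl]; exact s1.integrable_mul s2)
    (s1.integrable_mul s3)
  rw [hf.pd_S j hl, hpdfg] at hibp
  set A : E3 → ℝ := fun x => conv (mol l) (fun y => f y * g y) x - g x * conv (mol l) f x with hA
  set B : E3 → ℝ := fun x => conv (pd j (mol l)) (fun y => f y * g y) x -
    g x * conv (pd j (mol l)) f x with hB
  have mm := (integrable_mol hl).1
  have mA : AEStronglyMeasurable A volume := (aestronglyMeasurable_conv mm hfg.1).sub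
    (hg.memLp.1.mul (aestronglyMeasurable_conv mm hf.memLp.1))
  have mB : AEStronglyMeasurable B volume := (aestronglyMeasurable_conv hpm.1 hfg.1).sub
    (hg.memLp.1.mul (aestronglyMeasurable_conv hpm.1 hf.memLp.1))
  -- Integration by parts makes twice the integral equal to the integral of `S(fg) ∂ⱼSf - ∂ⱼS(fg)
  -- Sf`. Subtracting `g Sf` from `S(fg)` and `g ∂ⱼSf` from `∂ⱼS(fg)` changes nothing, since the two
  -- corrections cancel, and leaves commutators with `g`.
  have e : 2 * ∫ x, S l (fun y => f y * g y) x * S l (F j) x =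
      ∫ x, (A x * S l (F j) x - B x * S l f x) := by
    have i1 : Integrable (fun x => S l (fun y => f y * g y) x * S l (F j) x) :=
      s1.integrable_mul s2
    have i2 : Integrable (fun x => conv (pd j (mol l)) (fun y => f y * g y) x * S l f x) :=
      s4.integrable_mul s3
    have : 2 * ∫ x, S l (fun y => f y * g y) x * S l (F j) x =
        (∫ x, S l (fun y => f y * g y) x * S l (F j) x) -
        ∫ x, conv (pd j (mol l)) (fun y => f y * g y) x * S l f x := by linarith
    rw [this, ← integral_sub i1 i2]
    congr 1; ext x
    simp only [hA, hB, hpd]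
    simp only [S]
    ring
  -- In each of the two products one derivative of the mollifier costs `l` and one commutator gains
  -- the kernel radius `2 / l`.
  have hl2 : ENNReal.ofReal l * ENNReal.ofReal (2 / l) = 2 := by
    rw [← ENNReal.ofReal_mul hl.le, mul_div_cancel₀ _ hl.ne']
    simp
  have bA : eLpNorm A n volume ≤ 1 * (eLpNorm f s volume *
        (ENNReal.ofReal (2 / l) * ∑ j, eLpNorm (K j) q volume)) := by
    rw [← eLpNorm_one_mol hl]
    exact hg.eLpNorm_commutator_le s q n hn hq hf.memLp (memLp_mol hl)
      fun y hy => (norm_lt_of_mol_ne_zero hl hy).le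
  have bB : eLpNorm B n volume ≤ (ENNReal.ofReal l * etaConst) * (eLpNorm f s volume *
        (ENNReal.ofReal (2 / l) * ∑ j, eLpNorm (K j) q volume)) := by
    refine le_trans ?_ (mul_le_mul' (eLpNorm_pd_mol_le hl j) le_rfl)
    exact hg.eLpNorm_commutator_le s q n hn hq hf.memLp (memLp_pd_mol hl j)
      fun y hy => norm_le_of_pd_mol_ne_zero hl hy
  have bF : eLpNorm (S l (F j)) s volume ≤ ENNReal.ofReal l * etaConst * eLpNorm f s volume := by
    rw [← hpd]
    exact (eLpNorm_conv_le hs hpm.1 hf.memLp.1).trans (mul_le_mul' (eLpNorm_pd_mol_le hl j) le_rfl)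
  have bS : eLpNorm (S l f) s volume ≤ eLpNorm f s volume := eLpNorm_S_le hl hs hf.memLp.1
  calc ‖∫ x, S l (fun y => f y * g y) x * S l (F j) x‖ₑ
      ≤ ‖(2 : ℝ)‖ₑ * ‖∫ x, S l (fun y => f y * g y) x * S l (F j) x‖ₑ := by
        refine le_mul_of_one_le_left zero_le ?_
        rw [Real.enorm_of_nonneg zero_le_two]
        simp
    _ = ‖∫ x, (A x * S l (F j) x - B x * S l f x)‖ₑ := by rw [← enorm_mul, e]
    _ ≤ ∫⁻ x, ‖A x * S l (F j) x - B x * S l f x‖ₑ := enorm_integral_le_lintegral_enorm _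
    _ ≤ ∫⁻ x, (‖A x * S l (F j) x‖ₑ + ‖B x * S l f x‖ₑ) :=
        lintegral_mono fun x => by
          rw [sub_eq_add_neg, ← enorm_neg (B x * _)]
          exact enorm_add_le _ _
    _ = (∫⁻ x, ‖A x * S l (F j) x‖ₑ) + ∫⁻ x, ‖B x * S l f x‖ₑ :=
        lintegral_add_left' (mA.mul s2.1).enorm _
    _ ≤ eLpNorm A n volume * eLpNorm (S l (F j)) s volume +
        eLpNorm B n volume * eLpNorm (S l f) s volume :=
        add_le_add (lintegral_enorm_mul_le n s mA s2.1) (lintegral_enorm_mul_le n s mB s3.1)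
    _ ≤ 1 * (eLpNorm f s volume * (ENNReal.ofReal (2 / l) * ∑ j, eLpNorm (K j) q volume)) *
          (ENNReal.ofReal l * etaConst * eLpNorm f s volume) +
        (ENNReal.ofReal l * etaConst) * (eLpNorm f s volume *
          (ENNReal.ofReal (2 / l) * ∑ j, eLpNorm (K j) q volume)) * eLpNorm f s volume :=
        add_le_add (mul_le_mul' bA bF) (mul_le_mul' bB bS)
    _ = (ENNReal.ofReal l * ENNReal.ofReal (2 / l)) * (2 * etaConst) *
        (eLpNorm f s volume * eLpNorm f s volume * ∑ j, eLpNorm (K j) q volume) := by ring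
    _ = _ := by rw [hl2]; ring

lemma IsSolenoidalH1.integral_mul_S_two_two (h : IsSolenoidalH1 v G) {l : ℝ} (hl : 0 < l)
    {R : E3 → ℝ} (hR : MemLp R 2 volume) :
    ∫ x, R x * S l (G 2 2) x = -((∫ x, R x * S l (G 0 0) x) + ∫ x, R x * S l (G 1 1) x) := by
  rw [← integral_add, ← integral_neg]
  · simp only [h.S_two_two l hl]
    congr 1; ext x; ring
  · exact hR.integrable_mul (memLp_S hl one_le_two ((h.isH1 0).grad_memLp 0))
  · exact hR.integrable_mul (memLp_S hl one_le_two ((h.isH1 1).grad_memLp 1))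

lemma enorm_sum_sum_le {a : Fin 3 → Fin 3 → ℝ} {C : ℝ≥0∞} (h : ∀ i j, ‖a i j‖ₑ ≤ C) :
    ‖∑ i, ∑ j, a i j‖ₑ ≤ 9 * C := by
  refine (enorm_sum_le _ _).trans ((Finset.sum_le_sum fun i _ => (enorm_sum_le _ _).trans
    (Finset.sum_le_sum fun j _ => h i j)).trans (le_of_eq ?_))
  simp only [Finset.sum_const, Finset.card_univ, Fintype.card_fin, nsmul_eq_mul, ← mul_assoc]
  norm_num

/-- The flux is controlled by `‖∇u_h‖ ‖u‖²`. -/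
lemma IsSolenoidalH1.enorm_flux_le_grad (h : IsSolenoidalH1 v G) {s q : ℝ≥0∞}
    (hsq : s⁻¹ + s⁻¹ + q⁻¹ = 1) {l : ℝ} (hl : 0 < l) :
    ‖flux l v‖ₑ ≤ 9 * (2 + 4 * etaConst) * ((∑ i, eLpNorm (v i) s volume) ^ 2 *
      ((∑ j, eLpNorm (G 0 j) q volume) + ∑ j, eLpNorm (G 1 j) q volume)) := by
  set V := ∑ i, eLpNorm (v i) s volume with hV
  set H := (∑ j, eLpNorm (G 0 j) q volume) + ∑ j, eLpNorm (G 1 j) q volume with hH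
  have t1 : s.HolderTriple s (s⁻¹ + s⁻¹)⁻¹ := ⟨by rw [inv_inv]⟩
  have t2 : ((s⁻¹ + s⁻¹)⁻¹).HolderTriple q 1 := ⟨by rw [inv_inv, hsq, inv_one]⟩
  have t3 : s.HolderTriple q (s⁻¹ + q⁻¹)⁻¹ := ⟨by rw [inv_inv]⟩
  have t4 : ((s⁻¹ + q⁻¹)⁻¹).HolderTriple s 1 := ⟨by
    rw [inv_inv, inv_one, add_right_comm, hsq]⟩
  have t5 : q.HolderTriple (s⁻¹ + s⁻¹)⁻¹ 1 := ENNReal.HolderTriple.symm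
  have hq : 1 ≤ q := one_le_of_holderTriple_one q (s⁻¹ + s⁻¹)⁻¹
  have hm := fun i => (h.isH1 i).memLp.1
  have hgm := fun i j => ((h.isH1 i).grad_memLp j).1
  have bV : ∀ i, eLpNorm (v i) s volume ≤ V := fun i =>
    Finset.single_le_sum (f := fun i => eLpNorm (v i) s volume) (fun _ _ => zero_le)
      (Finset.mem_univ i)
  have bH' : ∀ i, (i = 0 ∨ i = 1) → ∑ j, eLpNorm (G i j) q volume ≤ H := by
    rintro i (rfl | rfl)
    exacts [le_self_add, le_add_self]
  have bH : ∀ i j, (i = 0 ∨ i = 1) → eLpNorm (G i j) q volume ≤ H := fun i j hi =>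
    (Finset.single_le_sum (f := fun j => eLpNorm (G i j) q volume) (fun _ _ => zero_le)
      (Finset.mem_univ j)).trans (bH' i hi)
  have hdir : ∀ i j k m, (k = 0 ∨ k = 1) →
      ‖∫ x, S l (fun y => v i y * v j y) x * S l (G k m) x‖ₑ ≤ V ^ 2 * H := by
    intro i j k m hk
    refine (enorm_integral_S_mul_S_le s s (s⁻¹ + s⁻¹)⁻¹ q hl (hm i) (hm j) (hgm k m)).trans ?_
    rw [sq]
    exact mul_le_mul' (mul_le_mul' (bV i) (bV j)) (bH k m hk)
  -- In these terms the derivative falls on the vertical velocity. The commutator estimate replaces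
  -- it by the gradient of the horizontal factor `vⱼ`.
  have hmix : ∀ j, (j = 0 ∨ j = 1) →
      ‖∫ x, S l (fun y => v 2 y * v j y) x * S l (G 2 j) x‖ₑ ≤ 4 * etaConst * (V ^ 2 * H) := by
    intro j hj
    refine (enorm_integral_S_mul_S_deriv_le s q (s⁻¹ + q⁻¹)⁻¹ hq (h.isH1 2) (h.isH1 j) hl j).trans ?_
    rw [sq]
    exact mul_le_mul' le_rfl (mul_le_mul' (mul_le_mul' (bV 2) (bV 2)) (bH' j hj))
  have c1 : V ^ 2 * H ≤ (2 + 4 * etaConst) * (V ^ 2 * H) :=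
    le_mul_of_one_le_left zero_le (one_le_two.trans le_self_add)
  have c2 : 2 * (V ^ 2 * H) ≤ (2 + 4 * etaConst) * (V ^ 2 * H) :=
    mul_le_mul' le_self_add le_rfl
  have c3 : 4 * etaConst * (V ^ 2 * H) ≤ (2 + 4 * etaConst) * (V ^ 2 * H) :=
    mul_le_mul' le_add_self le_rfl
  rw [h.flux_eq hl, mul_assoc]
  refine enorm_sum_sum_le fun i j => ?_
  by_cases hi : i = 0 ∨ i = 1
  · exact (hdir i j i j hi).trans c1
  obtain rfl : i = 2 := by omega
  by_cases hj : j = 0 ∨ j = 1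
  · exact (hmix j hj).trans c3
  obtain rfl : j = 2 := by omega
  rw [h.integral_mul_S_two_two hl (memLp_S hl one_le_two ((h.isH1 2).mul_memLp_two (h.isH1 2))),
    enorm_neg]
  refine le_trans ?_ c2
  rw [two_mul]
  exact (enorm_add_le _ _).trans (add_le_add (hdir 2 2 0 0 (by simp)) (hdir 2 2 1 1 (by simp)))

/-! ### Commutators and increments in `L³`. -/

lemma holderTriple_three_three : ENNReal.HolderTriple 3 3 (3 / 2) := by
  refine ⟨?_⟩
  rw [← ENNReal.toReal_eq_toReal_iff' (by simp) (by simp),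
    ENNReal.toReal_add (by simp) (by simp)]
  simp
  norm_num

lemma holderTriple_three_halves : ENNReal.HolderTriple (3 / 2) 3 1 := by
  refine ⟨?_⟩
  rw [← ENNReal.toReal_eq_toReal_iff' (by simp) (by simp), ENNReal.toReal_add (by simp) (by simp)]
  simp
  norm_num

/-- The commutator `S(f g) - S f S g` in terms of increments. -/
lemma S_mul_sub_S_mul_S {l : ℝ} (hl : 0 < l) {f g : E3 → ℝ} (hf : MemLp f 2 volume)
    (hg : MemLp g 2 volume) (x : E3) :
    S l (fun y => f y * g y) x - S l f x * S l g x =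
      (∫ y, mol l y * ((f (x - y) - f x) * (g (x - y) - g x))) -
        (S l f x - f x) * (S l g x - g x) := by
  have hfg : MemLp (fun y => f y * g y) 1 volume :=
    memLp_one_iff_integrable.2 (hf.integrable_mul hg)
  have i1 := integrable_conv_integrand ⊤ 1 (memLp_mol hl ⊤) hfg x
  have i2 := (integrable_conv_integrand 2 2 (memLp_mol hl 2) hf x).mul_const (g x)
  have i3 := (integrable_conv_integrand 2 2 (memLp_mol hl 2) hg x).mul_const (f x)
  have i4 := (integrable_mol hl).mul_const (f x * g x)
  have e : ∫ y, mol l y * ((f (x - y) - f x) * (g (x - y) - g x)) =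
      S l (fun y => f y * g y) x - S l f x * g x - S l g x * f x + f x * g x := by
    have e1 : ∀ y, mol l y * ((f (x - y) - f x) * (g (x - y) - g x)) =
        (mol l y * (f (x - y) * g (x - y)) - mol l y * f (x - y) * g x) -
        mol l y * g (x - y) * f x + mol l y * (f x * g x) := fun y => by ring
    simp only [e1]
    have i12 : Integrable (fun y => mol l y * (f (x - y) * g (x - y)) -
        mol l y * f (x - y) * g x) := i1.sub i2
    have i123 : Integrable (fun y => mol l y * (f (x - y) * g (x - y)) -
        mol l y * f (x - y) * g x - mol l y * g (x - y) * f x) := i12.sub i3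
    rw [integral_add i123 i4, integral_sub i12 i3, integral_sub i1 i2,
      integral_mul_const, integral_mul_const, integral_mul_const, integral_mol hl, one_mul]
    rfl
  rw [e]
  ring

lemma S_sub_eq_integral {l : ℝ} (hl : 0 < l) {f : E3 → ℝ} (hf : MemLp f 2 volume) (x : E3) :
    S l f x - f x = ∫ y, mol l y * (f (x - y) - f x) := by
  have i1 := integrable_conv_integrand 2 2 (memLp_mol hl 2) hf x
  simp only [mul_sub]
  rw [integral_sub i1 ((integrable_mol hl).mul_const _), integral_mul_const, integral_mol hl,
    one_mul]
  rfl

lemma aestronglyMeasurable_increment {f : E3 → ℝ} (hf : AEStronglyMeasurable f volume) :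
    AEStronglyMeasurable (fun z : E3 × E3 => f (z.1 - z.2) - f z.1) (volume.prod volume) :=
  (aestronglyMeasurable_comp_sub hf).sub hf.comp_fst

lemma aestronglyMeasurable_sub_translation {f : E3 → ℝ} (hf : AEStronglyMeasurable f volume)
    (y : E3) : AEStronglyMeasurable (fun x => f (x - y) - f x) volume :=
  (hf.comp_measurePreserving (measurePreserving_sub_right volume y)).sub hf

lemma eLpNorm_S_sub_le {l : ℝ} (hl : 0 < l) {p : ℝ≥0∞} (hp : 1 ≤ p) {f : E3 → ℝ}
    (hf : MemLp f 2 volume) {a : ℝ≥0∞}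
    (ha : ∀ y : E3, ‖y‖ ≤ 2 / l → eLpNorm (fun x => f (x - y) - f x) p volume ≤ a) :
    eLpNorm (fun x => S l f x - f x) p volume ≤ a := by
  simp only [S_sub_eq_integral hl hf]
  have := eLpNorm_integral_mul_le hp (K := mol l) (F := fun x y => f (x - y) - f x) (A := a)
    (integrable_mol hl).1 (aestronglyMeasurable_increment hf.1)
    (ae_of_all _ fun y hy => ha y (norm_lt_of_mol_ne_zero hl hy).le)
  rwa [← eLpNorm_one_eq_lintegral_enorm, eLpNorm_one_mol hl, one_mul] at this

/-- Both pieces in the identity `S_mul_sub_S_mul_S` are quadratic in increments over distances at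
most `2 / l`; each contributes `a * b`, by Hölder from `L³ × L³` to `L^{3/2}`. -/
lemma eLpNorm_S_mul_sub_le {l : ℝ} (hl : 0 < l) {f g : E3 → ℝ}
    (hf : MemLp f 2 volume) (hg : MemLp g 2 volume) {a b : ℝ≥0∞}
    (ha : ∀ y : E3, ‖y‖ ≤ 2 / l → eLpNorm (fun x => f (x - y) - f x) 3 volume ≤ a)
    (hb : ∀ y : E3, ‖y‖ ≤ 2 / l → eLpNorm (fun x => g (x - y) - g x) 3 volume ≤ b) :
    eLpNorm (fun x => S l (fun y => f y * g y) x - S l f x * S l g x) (3 / 2) volume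
      ≤ 2 * (a * b) := by
  have := holderTriple_three_three
  have h32 : (1 : ℝ≥0∞) ≤ 3 / 2 :=
    have := holderTriple_three_halves
    one_le_of_holderTriple_one (3 / 2) 3
  simp only [S_mul_sub_S_mul_S hl hf hg]
  have mS := fun {f : E3 → ℝ} (hf : MemLp f 2 volume) =>
    (aestronglyMeasurable_conv (integrable_mol hl).1 hf.1).sub hf.1
  have mF : AEStronglyMeasurable (fun z : E3 × E3 => (f (z.1 - z.2) - f z.1) *
      (g (z.1 - z.2) - g z.1)) (volume.prod volume) :=
    (aestronglyMeasurable_increment hf.1).mul (aestronglyMeasurable_increment hg.1)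
  refine (eLpNorm_sub_le ?_ ((mS hf).mul (mS hg)) h32).trans ?_
  · exact ((integrable_mol hl).1.comp_snd.mul mF).integral_prod_right'
  rw [two_mul]
  refine add_le_add ?_ ((eLpNorm_mul_le 3 3 (3 / 2) (mS hf) (mS hg)).trans
    (mul_le_mul' (eLpNorm_S_sub_le hl (by norm_num) hf ha) (eLpNorm_S_sub_le hl (by norm_num) hg hb)))
  have := eLpNorm_integral_mul_le h32 (K := mol l)
    (F := fun x y => (f (x - y) - f x) * (g (x - y) - g x)) (A := a * b)
    (integrable_mol hl).1 mF (ae_of_all _ fun y hy => ?_)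
  · rwa [← eLpNorm_one_eq_lintegral_enorm, eLpNorm_one_mol hl, one_mul] at this
  · have hy' := (norm_lt_of_mol_ne_zero hl hy).le
    exact (eLpNorm_mul_le 3 3 (3 / 2) (aestronglyMeasurable_sub_translation hf.1 y)
      (aestronglyMeasurable_sub_translation hg.1 y)).trans (mul_le_mul' (ha y hy') (hb y hy'))

/-- The derivative of the mollifier has integral zero, so `f(x - y)` may be replaced by an
increment; the `L¹` norm of the kernel costs one factor `l`. -/
lemma eLpNorm_conv_pd_mol_le {l : ℝ} (hl : 0 < l) (j : Fin 3) {p : ℝ≥0∞} (hp : 1 ≤ p) {f : E3 → ℝ}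
    (hf : MemLp f 2 volume) {a : ℝ≥0∞}
    (ha : ∀ y : E3, ‖y‖ ≤ 2 / l → eLpNorm (fun x => f (x - y) - f x) p volume ≤ a) :
    eLpNorm (conv (pd j (mol l)) f) p volume ≤ ENNReal.ofReal l * etaConst * a := by
  have hpm : Integrable (pd j (mol l)) := memLp_one_iff_integrable.1 (memLp_pd_mol hl j 1)
  have e : conv (pd j (mol l)) f = fun x => ∫ y, pd j (mol l) y * (f (x - y) - f x) := by
    ext x
    have i1 := integrable_conv_integrand 2 2 (memLp_pd_mol hl j 2) hf x
    simp only [mul_sub]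
    rw [integral_sub i1 (hpm.mul_const _), integral_mul_const, integral_pd_mol hl, zero_mul,
      sub_zero]
    rfl
  rw [e]
  refine (eLpNorm_integral_mul_le hp (K := pd j (mol l)) (F := fun x y => f (x - y) - f x) (A := a)
    hpm.1 (aestronglyMeasurable_increment hf.1)
    (ae_of_all _ fun y hy => ha y (norm_le_of_pd_mol_ne_zero hl hy))).trans ?_
  rw [← eLpNorm_one_eq_lintegral_enorm]
  exact mul_le_mul' (eLpNorm_pd_mol_le hl j) le_rfl

/-- The flux is controlled by the cube of anisotropic Hölder–`L³` seminorms. -/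
lemma IsSolenoidalH1.enorm_flux_le_increments (h : IsSolenoidalH1 v G) {e : Fin 3 → ℝ} {A : ℝ≥0∞}
    (he : ∀ i, e i ≤ 1) (he0 : ∀ i, 0 ≤ e i)
    (hsum : ∀ i j k, (i ≠ 2 ∨ j ≠ 2 ∨ k ≠ 2) → 1 ≤ e i + e j + e k)
    (hA : ∀ i (y : E3), eLpNorm (fun x => v i (x - y) - v i x) 3 volume ≤
      A * ENNReal.ofReal (‖y‖ ^ e i)) {l : ℝ} (hl : 1 ≤ l) :
    ‖flux l v‖ₑ ≤ 288 * etaConst * A ^ 3 := by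
  have hl0 : 0 < l := by linarith
  have := holderTriple_three_halves
  -- On the support of the mollifier `‖y‖ ≤ 2 / l`, and `2 ^ e i ≤ 2` because `e i ≤ 1`.
  set a : Fin 3 → ℝ≥0∞ := fun i => A * ENNReal.ofReal (2 * l ^ (-e i)) with ha
  have hinc : ∀ i (y : E3), ‖y‖ ≤ 2 / l →
      eLpNorm (fun x => v i (x - y) - v i x) 3 volume ≤ a i := by
    intro i y hy
    refine (hA i y).trans (mul_le_mul' le_rfl (ENNReal.ofReal_le_ofReal ?_))
    calc ‖y‖ ^ e i ≤ (2 / l) ^ e i := Real.rpow_le_rpow (norm_nonneg _) hy (he0 i)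
      _ = 2 ^ e i * l ^ (-e i) := by
        rw [Real.div_rpow zero_le_two hl0.le, Real.rpow_neg hl0.le]; rfl
      _ ≤ 2 * l ^ (-e i) := by
        gcongr
        calc (2 : ℝ) ^ e i ≤ 2 ^ (1 : ℝ) := Real.rpow_le_rpow_of_exponent_le one_le_two (he i)
          _ = 2 := by norm_num
  have hterm : ∀ i j k m, (i ≠ 2 ∨ j ≠ 2 ∨ k ≠ 2) →
      ‖∫ x, (S l (fun y => v i y * v j y) x - S l (v i) x * S l (v j) x) *
      S l (G k m) x‖ₑ ≤ 16 * etaConst * A ^ 3 := by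
    intro i j k m hijk
    have hpd : S l (G k m) = conv (pd m (mol l)) (v k) := by
      rw [← (h.isH1 k).pd_S m hl0, S, pd_conv m (contDiff_mol l) (hasCompactSupport_mol hl0)
        (h.isH1 k).locallyIntegrable]
    -- One derivative costs `l` and three increments gain `l ^ (-(eᵢ + eⱼ + eₖ))`. As the exponents
    -- add up to at least one and `l ≥ 1`, only the three factors two are left.
    have hp : ENNReal.ofReal (2 * l ^ (-e i)) * ENNReal.ofReal (2 * l ^ (-e j)) *
        ENNReal.ofReal (2 * l ^ (-e k)) * ENNReal.ofReal l ≤ 8 := by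
      rw [← ENNReal.ofReal_mul (by positivity), ← ENNReal.ofReal_mul (by positivity),
        ← ENNReal.ofReal_mul (by positivity)]
      refine ENNReal.ofReal_le_of_le_toReal ?_
      have : 2 * l ^ (-e i) * (2 * l ^ (-e j)) * (2 * l ^ (-e k)) * l =
          8 * l ^ (-e i + -e j + -e k + 1) := by
        rw [Real.rpow_add hl0, Real.rpow_add hl0, Real.rpow_add hl0, Real.rpow_one]
        ring
      rw [this]
      have h1 : l ^ (-e i + -e j + -e k + 1) ≤ 1 :=
        Real.rpow_le_one_of_one_le_of_nonpos hl (by linarith [hsum i j k hijk])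
      simp only [ENNReal.toReal_ofNat]
      linarith
    have s2 := memLp_S hl0 one_le_two ((h.isH1 i).mul_memLp_two (h.isH1 j))
    refine (enorm_integral_mul_le (3 / 2) 3 (s2.1.sub
      (memLp_S_mul_S hl0 (h.isH1 i).memLp (h.isH1 j).memLp).1)
      (memLp_S hl0 one_le_two ((h.isH1 k).grad_memLp m)).1).trans ?_
    have b1 := eLpNorm_S_mul_sub_le hl0 (h.isH1 i).memLp (h.isH1 j).memLp (hinc i) (hinc j)
    have b2 := eLpNorm_conv_pd_mol_le hl0 m (p := 3) (by norm_num) (h.isH1 k).memLp (hinc k)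
    rw [← hpd] at b2
    calc _ ≤ 2 * (a i * a j) * (ENNReal.ofReal l * etaConst * a k) := mul_le_mul' b1 b2
      _ = (2 * etaConst * A ^ 3) * (ENNReal.ofReal (2 * l ^ (-e i)) *
          ENNReal.ofReal (2 * l ^ (-e j)) * ENNReal.ofReal (2 * l ^ (-e k)) *
          ENNReal.ofReal l) := by simp only [ha]; ring
      _ ≤ (2 * etaConst * A ^ 3) * 8 := mul_le_mul' le_rfl hp
      _ = _ := by ring
  rw [h.flux_eq_commutator hl0, show 288 * etaConst * A ^ 3 = 9 * (32 * etaConst * A ^ 3) by ring]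
  have c1 : 16 * etaConst * A ^ 3 ≤ 32 * etaConst * A ^ 3 := by gcongr; norm_num
  refine enorm_sum_sum_le fun i j => ?_
  by_cases hij : i ≠ 2 ∨ j ≠ 2
  · exact (hterm i j i j (by tauto)).trans c1
  -- The hypothesis on the exponents excludes three vertical increments. Incompressibility turns the
  -- third into horizontal ones, at the price of two terms, hence `32` in place of `16`.
  · push Not at hij
    obtain ⟨rfl, rfl⟩ := hij
    have s2 := memLp_S hl0 one_le_two ((h.isH1 2).mul_memLp_two (h.isH1 2))
    rw [h.integral_mul_S_two_two hl0
      (R := fun x => S l (fun y => v 2 y * v 2 y) x - S l (v 2) x * S l (v 2) x)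
      (s2.sub (memLp_S_mul_S hl0 (h.isH1 2).memLp (h.isH1 2).memLp)), enorm_neg]
    refine (enorm_add_le _ _).trans ((add_le_add (hterm 2 2 0 0 (by simp))
      (hterm 2 2 1 1 (by simp))).trans (le_of_eq ?_))
    ring

/-! ### Inverse Fourier transforms of radial multipliers -/

/-- Smooth, compactly supported, even multipliers. -/
structure IsMultiplier (m : E3 → ℝ) : Prop where
  smooth : ContDiff ℝ ∞ m
  compact : HasCompactSupport m
  even : ∀ ξ, m (-ξ) = m ξ

namespace IsMultiplier

variable {m m' : E3 → ℝ}

/-- A multiplier as a complex Schwartz function. -/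
def toSchwartz (hm : IsMultiplier m) : SchwartzMap E3 ℂ :=
  HasCompactSupport.toSchwartzMap (f := fun ξ => (m ξ : ℂ))
    (hm.compact.comp_left (g := fun t : ℝ => (t : ℂ)) Complex.ofReal_zero)
    (Complex.ofRealCLM.contDiff.comp hm.smooth)

lemma coe_toSchwartz (hm : IsMultiplier m) : (hm.toSchwartz : E3 → ℂ) = fun ξ => (m ξ : ℂ) := rfl

/-- Conjugation amounts to `ξ ↦ -ξ`, under which an even real multiplier is invariant. The transform
is therefore real, and taking the real part in `invFourierReal` loses nothing. -/
lemma fourierInv_apply (hm : IsMultiplier m) (x : E3) :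
    (𝓕⁻ hm.toSchwartz) x = (invFourierReal m x : ℂ) := by
  rw [SchwartzMap.fourierInv_coe, hm.coe_toSchwartz, invFourierReal]
  symm
  rw [← Complex.conj_eq_iff_re, Real.fourierInv_eq', ← integral_conj, ← integral_neg_eq_self]
  congr 1; ext ξ
  simp only [hm.even, smul_eq_mul, map_mul, Complex.conj_ofReal, inner_neg_left, ← Complex.exp_conj,
    Complex.conj_I]
  congr 2
  push_cast
  ring

lemma fourierInv_eq (hm : IsMultiplier m) :
    𝓕⁻ (fun ξ => (m ξ : ℂ)) = fun x => (invFourierReal m x : ℂ) := by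
  ext x
  rw [← hm.fourierInv_apply, SchwartzMap.fourierInv_coe, hm.coe_toSchwartz]

lemma fourier_eq (hm : IsMultiplier m) :
    𝓕 (fun x => (invFourierReal m x : ℂ)) = fun ξ => (m ξ : ℂ) := by
  have h : (fun x => (invFourierReal m x : ℂ)) = ((𝓕⁻ hm.toSchwartz : SchwartzMap E3 ℂ) : E3 → ℂ) := by
    ext x; rw [hm.fourierInv_apply]
  rw [h, ← SchwartzMap.fourier_coe, FourierTransform.fourier_fourierInv_eq, hm.coe_toSchwartz]

lemma invFourierReal_eq (hm : IsMultiplier m) :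
    invFourierReal m = fun x => ((𝓕⁻ hm.toSchwartz : SchwartzMap E3 ℂ) x).re := by
  ext x; rw [hm.fourierInv_apply]; simp

lemma contDiff (hm : IsMultiplier m) : ContDiff ℝ ∞ (invFourierReal m) := by
  rw [hm.invFourierReal_eq]
  exact Complex.reCLM.contDiff.comp (SchwartzMap.smooth _ ⊤)

lemma memLp (hm : IsMultiplier m) (p : ℝ≥0∞) : MemLp (invFourierReal m) p volume := by
  rw [hm.invFourierReal_eq]
  exact ((𝓕⁻ hm.toSchwartz : SchwartzMap E3 ℂ).memLp p volume).re

lemma integrable (hm : IsMultiplier m) : Integrable (invFourierReal m) :=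
  memLp_one_iff_integrable.1 (hm.memLp 1)

lemma integrable_pd (hm : IsMultiplier m) (j : Fin 3) : Integrable (pd j (invFourierReal m)) := by
  have h1 := (SchwartzMap.fderivCLM ℝ E3 ℂ (𝓕⁻ hm.toSchwartz)).integrable (μ := volume)
  refine h1.norm.mono' ((continuous_pd j (hm.contDiff.of_le (by simp))).aestronglyMeasurable)
    (ae_of_all _ fun x => ?_)
  rw [SchwartzMap.fderivCLM_apply]
  have h2 : HasFDerivAt (invFourierReal m)
      (Complex.reCLM.comp (fderiv ℝ (𝓕⁻ hm.toSchwartz : SchwartzMap E3 ℂ) x)) x := by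
    rw [hm.invFourierReal_eq]
    exact Complex.reCLM.hasFDerivAt.comp x
      (((𝓕⁻ hm.toSchwartz : SchwartzMap E3 ℂ).smooth 1).differentiable one_ne_zero x).hasFDerivAt
  rw [pd, h2.fderiv]
  refine (Complex.abs_re_le_norm _).trans ?_
  refine (ContinuousLinearMap.le_opNorm _ _).trans ?_
  simp

lemma integral_eq (hm : IsMultiplier m) : ∫ x, invFourierReal m x = m 0 := by
  have h := congrFun hm.fourier_eq 0
  rw [Real.fourier_eq'] at h
  simp only [inner_zero_right, mul_zero, Complex.ofReal_zero, zero_mul, Complex.exp_zero,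
    one_smul] at h
  rw [integral_complex_ofReal] at h
  exact_mod_cast h

lemma mul (hm : IsMultiplier m) (hm' : IsMultiplier m') : IsMultiplier fun ξ => m ξ * m' ξ :=
  ⟨hm.smooth.mul hm'.smooth, hm.compact.mul_right, fun ξ => by rw [hm.even, hm'.even]⟩

lemma comp_smul (hm : IsMultiplier m) {c : ℝ} (hc : c ≠ 0) : IsMultiplier fun ξ => m (c • ξ) :=
  ⟨hm.smooth.comp (contDiff_const_smul c), hm.compact.comp_smul hc,
    fun ξ => by rw [smul_neg, hm.even]⟩

/-- The inverse Fourier transform maps products to convolutions. -/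
lemma conv_eq (hm : IsMultiplier m) (hm' : IsMultiplier m') :
    conv (invFourierReal m) (invFourierReal m') = invFourierReal fun ξ => m ξ * m' ξ := by
  set A : E3 → ℂ := fun x => (invFourierReal m x : ℂ)
  set B : E3 → ℂ := fun x => (invFourierReal m' x : ℂ)
  have hA : Integrable A := hm.integrable.ofReal
  have hB : Integrable B := hm'.integrable.ofReal
  have hAB : convolution A B (ContinuousLinearMap.mul ℂ ℂ) volume =
      fun x => (conv (invFourierReal m) (invFourierReal m') x : ℂ) := by
    ext x
    rw [convolution_def, conv, ← integral_complex_ofReal]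
    simp [A, B]
  have hF : 𝓕 (convolution A B (ContinuousLinearMap.mul ℂ ℂ) volume) =
      fun ξ => ((m ξ * m' ξ : ℝ) : ℂ) := by
    ext ξ
    rw [Real.fourier_mul_convolution_eq hA hB, hm.fourier_eq, hm'.fourier_eq]
    push_cast
    rfl
  -- Fourier inversion identifies the two sides at every point only for a continuous function; here
  -- a bounded continuous kernel is convolved with an integrable one.
  have hcont : Continuous (convolution A B (ContinuousLinearMap.mul ℂ ℂ) volume) := by
    refine BddAbove.continuous_convolution_left_of_integrable _ ?_
      (Complex.continuous_ofReal.comp hm.contDiff.continuous) hB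
    have e : ∀ x, A x = (𝓕⁻ hm.toSchwartz : SchwartzMap E3 ℂ) x := fun x =>
      (hm.fourierInv_apply x).symm
    simp only [e]
    refine ⟨‖(𝓕⁻ hm.toSchwartz).toBoundedContinuousFunction‖, ?_⟩
    rintro _ ⟨x, rfl⟩
    exact (𝓕⁻ hm.toSchwartz).toBoundedContinuousFunction.norm_coe_le_norm x
  have hint : Integrable (𝓕 (convolution A B (ContinuousLinearMap.mul ℂ ℂ) volume)) := by
    rw [hF]
    exact ((hm.mul hm').smooth.continuous.integrable_of_hasCompactSupport (hm.mul hm').compact).ofReal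
  have h := hcont.fourierInv_fourier_eq (hA.integrable_convolution _ hB) hint
  rw [hF, (hm.mul hm').fourierInv_eq, hAB] at h
  ext x
  have := congrFun h x
  exact_mod_cast this.symm

lemma sub_eq (hm : IsMultiplier m) (hm' : IsMultiplier m') :
    invFourierReal (fun ξ => m ξ - m' ξ) = fun x => invFourierReal m x - invFourierReal m' x := by
  ext x
  rw [invFourierReal, invFourierReal, invFourierReal, ← Complex.sub_re]
  congr 1
  simp only [Real.fourierInv_eq]
  have hint : ∀ {k : E3 → ℝ}, IsMultiplier k →
      Integrable (fun ξ => Real.fourierChar (inner ℝ ξ x) • (k ξ : ℂ)) := fun {k} hk => by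
    have hc : Continuous fun ξ => (k ξ : ℂ) := Complex.continuous_ofReal.comp hk.smooth.continuous
    refine (hk.toSchwartz.integrable (μ := volume)).norm.mono' ?_ (ae_of_all _ fun ξ => ?_)
    · refine Continuous.aestronglyMeasurable ?_
      exact (Real.continuous_fourierChar.comp (by fun_prop)).smul hc
    · rw [Circle.norm_smul]
      rfl
  rw [← integral_sub (hint hm) (hint hm')]
  simp [smul_sub]

end IsMultiplier

lemma invFourierReal_comp_smul (m : E3 → ℝ) {l : ℝ} (hl : 0 < l) :
    invFourierReal (fun ξ => m (l⁻¹ • ξ)) = dil l (invFourierReal m) := by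
  ext x
  rw [dil, invFourierReal, invFourierReal, ← Complex.re_ofReal_mul]
  congr 1
  simp only [Real.fourierInv_eq]
  have h := Measure.integral_comp_smul_of_nonneg (volume : Measure E3)
    (fun ξ => Real.fourierChar (inner ℝ ξ (l • x)) • (m ξ : ℂ)) l⁻¹ (hR := by positivity)
  have e : ∀ ξ : E3, inner ℝ (l⁻¹ • ξ) (l • x) = inner ℝ ξ x := fun ξ => by
    rw [real_inner_smul_left, real_inner_smul_right, ← mul_assoc, inv_mul_cancel₀ hl.ne', one_mul]
  simp only [e] at h
  rw [h]
  simp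

/-! ### Besov functions have Hölder increments in `L³` -/

namespace DyadicPartition

variable (P : DyadicPartition)

lemma phi_eq_zero {ξ : E3} (h : ‖ξ‖ < 3 / 4) : P.phi ξ = 0 := by
  by_contra h0
  linarith [(P.phi_support ξ h0).1]

/-- In this ball every shell of the inhomogeneous partition vanishes, since the dilations by `2 ^
(-j)` with `j ≥ 0` only shrink `ξ`. -/
lemma rho_eq_one {ξ : E3} (h : ‖ξ‖ < 3 / 4) : P.rho ξ = 1 := by
  have h1 := P.inhom_sum ξ
  have h2 : ∀ j : ℕ, P.phi ((2 : ℝ) ^ (-(j : ℤ)) • ξ) = 0 := fun j => by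
    refine P.phi_eq_zero (lt_of_le_of_lt ?_ h)
    rw [norm_smul, Real.norm_of_nonneg (by positivity)]
    refine mul_le_of_le_one_left (norm_nonneg _) ?_
    rw [zpow_neg, zpow_natCast]
    exact inv_le_one_of_one_le₀ (one_le_pow₀ one_le_two)
  simp only [h2] at h1
  have := h1.unique hasSum_zero
  linarith

/-- The inhomogeneous series at `ξ / 2` is the series at `ξ` without its first term. This makes the
partial sums of the decomposition telescope. -/
lemma phi_eq (ξ : E3) : P.phi ξ = P.rho ((2 : ℝ)⁻¹ • ξ) - P.rho ξ := by
  have h1 := P.inhom_sum ξ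
  have h2 := P.inhom_sum ((2 : ℝ)⁻¹ • ξ)
  rw [← hasSum_nat_add_iff' 1] at h1
  simp only [Finset.range_one, Finset.sum_singleton, Nat.cast_zero, neg_zero, zpow_zero,
    one_smul, Nat.cast_add, Nat.cast_one, smul_smul] at h1 h2
  have e : ∀ j : ℕ, (2 : ℝ) ^ (-((j : ℤ) + 1)) = (2 : ℝ) ^ (-(j : ℤ)) * 2⁻¹ := fun j => by
    rw [neg_add, zpow_add₀ two_ne_zero, zpow_neg_one]
  simp only [e] at h1
  have := h1.unique h2
  linarith

lemma isMultiplier_rho : IsMultiplier P.rho :=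
  ⟨P.rho_smooth, HasCompactSupport.of_support_subset_isCompact (isCompact_closedBall 0 (4 / 3))
    fun ξ hξ => by simpa using P.rho_support ξ hξ, fun ξ => P.rho_radial _ _ (norm_neg ξ)⟩

lemma isMultiplier_phi : IsMultiplier P.phi :=
  ⟨P.phi_smooth, HasCompactSupport.of_support_subset_isCompact (isCompact_closedBall 0 (8 / 3))
    fun ξ hξ => by simpa using (P.phi_support ξ hξ).2, fun ξ => P.phi_radial _ _ (norm_neg ξ)⟩

/-- The kernel of the low-frequency cut-off. -/
def lowKernel : E3 → ℝ := invFourierReal P.rho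

/-- The kernel of the dyadic shells. -/
def shellKernel : E3 → ℝ := invFourierReal P.phi

lemma shellKernel_eq (x : E3) : P.shellKernel x = dil 2 P.lowKernel x - P.lowKernel x := by
  have h := (P.isMultiplier_rho.comp_smul (c := (2 : ℝ)⁻¹) (by norm_num)).sub_eq P.isMultiplier_rho
  rw [invFourierReal_comp_smul _ two_pos] at h
  rw [shellKernel, show P.phi = fun ξ => P.rho ((2 : ℝ)⁻¹ • ξ) - P.rho ξ from funext P.phi_eq, h]
  rfl

/-- On the support of the dilated multiplier `‖ξ‖ ≤ 8l/3`, so `‖ξ‖ / (4l) ≤ 2/3 < 3/4` and the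
low-frequency cut-off equals one there. The reproducing formula is what lets a block absorb a
derivative. -/
lemma conv_lowKernel_eq {m : E3 → ℝ} (hm : IsMultiplier m) (hs : ∀ ξ, m ξ ≠ 0 → ‖ξ‖ ≤ 8 / 3)
    {l : ℝ} (hl : 0 < l) :
    conv (dil (4 * l) P.lowKernel) (dil l (invFourierReal m)) = dil l (invFourierReal m) := by
  rw [lowKernel, ← invFourierReal_comp_smul _ hl, ← invFourierReal_comp_smul _ (by positivity),
    (P.isMultiplier_rho.comp_smul (by positivity)).conv_eq (hm.comp_smul (by positivity))]
  congr 1; ext ξ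
  by_cases h : m (l⁻¹ • ξ) = 0
  · simp [h]
  · rw [P.rho_eq_one, one_mul]
    rw [mul_inv, mul_smul, norm_smul, Real.norm_of_nonneg (by norm_num)]
    linarith [hs _ h]

lemma integral_lowKernel : ∫ x, P.lowKernel x = 1 := by
  rw [lowKernel, P.isMultiplier_rho.integral_eq, P.rho_eq_one]
  simp

end DyadicPartition

lemma dil_dil (a b : ℝ) (K : E3 → ℝ) : dil a (dil b K) = dil (a * b) K := by
  ext x
  simp only [dil, smul_smul, mul_comm b a]
  ring

/-- Associativity in a commuted form. It is the adjoint relation `integral_conv_mul` applied to `b`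
and the function `w ↦ f (x - w)`. -/
lemma conv_conv {a b f : E3 → ℝ} (ha : Integrable a) (hb : MemLp b 2 volume)
    (hf : MemLp f 2 volume) : conv (conv a b) f = conv b (conv a f) := by
  ext x
  have hg : MemLp (fun w => f (x - w)) 2 volume :=
    ⟨aestronglyMeasurable_comp_sub_left hf.1 x, by rw [eLpNorm_comp_sub_left 2 hf.1]; exact hf.2⟩
  have h := integral_conv_mul 2 2 ha hb hg
  rw [conv, h, conv]
  congr 1; ext w
  congr 1
  rw [conv, conv, ← integral_neg_eq_self]
  simp only [neg_neg, sub_neg_eq_add, sub_add_eq_sub_sub]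

/-- Translations commute with convolution, so the increment can be placed on the kernel; Young's
inequality does the rest. -/
lemma eLpNorm_increment_conv_le {p : ℝ≥0∞} (hp : 1 ≤ p) {K g : E3 → ℝ} (hK : MemLp K 2 volume)
    (hg : MemLp g 2 volume) (y : E3) :
    eLpNorm (fun x => conv K g (x - y) - conv K g x) p volume ≤
      eLpNorm (fun x => K (x - y) - K x) 1 volume * eLpNorm g p volume := by
  have e : (fun x => conv K g (x - y) - conv K g x) = conv (fun x => K (x - y) - K x) g := by
    ext x
    have hKy : MemLp (fun z => K (z - y)) 2 volume :=
      hK.comp_measurePreserving (measurePreserving_sub_right volume y)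
    have h1 : conv K g (x - y) = ∫ z, K (z - y) * g (x - z) := by
      rw [conv, ← integral_sub_right_eq_self _ y]
      congr 1; ext z
      congr 2
      abel
    rw [h1, conv, conv, ← integral_sub (integrable_conv_integrand 2 2 hKy hg x)
      (integrable_conv_integrand 2 2 hK hg x)]
    simp only [sub_mul]
  rw [e]
  exact eLpNorm_conv_le hp (aestronglyMeasurable_sub_translation hK.1 y) hg.1

namespace DyadicPartition

variable (P : DyadicPartition)

/-- The partial sums of the Littlewood–Paley decomposition. -/
def partialSum (f : E3 → ℝ) (n : ℕ) : E3 → ℝ := conv (dil (2 ^ n) P.lowKernel) f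

lemma lpBlock_neg_one (f : E3 → ℝ) : lpBlock P (-1) f = conv P.lowKernel f := by
  ext x
  simp [lpBlock, conv, lowKernel]

lemma lpBlock_natCast (f : E3 → ℝ) (j : ℕ) :
    lpBlock P j f = conv (dil (2 ^ j) P.shellKernel) f := by
  ext x
  have h1 : ¬ ((j : ℤ) ≤ -2) := by omega
  have h2 : ¬ ((j : ℤ) = -1) := by omega
  rw [lpBlock, if_neg h1, if_neg h2, conv]
  simp only [dil, shellKernel, smul_eq_mul, mul_assoc, integral_const_mul, zpow_natCast]
  congr 1
  rw [mul_comm (3 : ℤ), zpow_mul, zpow_natCast]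
  norm_cast

lemma memLp_lowKernel (p : ℝ≥0∞) : MemLp P.lowKernel p volume := P.isMultiplier_rho.memLp p

lemma memLp_shellKernel (p : ℝ≥0∞) : MemLp P.shellKernel p volume := P.isMultiplier_phi.memLp p

/-- Each partial sum is a single convolution with a dilated low-frequency kernel. Convergence in
`L²` is then the approximate identity property, with no series to sum. -/
lemma partialSum_succ {f : E3 → ℝ} (hf : MemLp f 2 volume) (n : ℕ) (x : E3) :
    P.partialSum f (n + 1) x = P.partialSum f n x + lpBlock P n f x := by
  rw [lpBlock_natCast, partialSum, partialSum]
  have hp : (0 : ℝ) < 2 ^ n := by positivity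
  have hp' : (0 : ℝ) < 2 ^ (n + 1) := by positivity
  have e : dil (2 ^ n) P.shellKernel =
      fun x => dil (2 ^ (n + 1)) P.lowKernel x - dil (2 ^ n) P.lowKernel x := by
    ext x
    rw [pow_succ, ← dil_dil]
    simp only [dil, P.shellKernel_eq]
    ring
  rw [e, conv, conv, conv, ← integral_add]
  · congr 1; ext y; ring
  · exact integrable_conv_integrand 2 2 (memLp_dil hp (P.memLp_lowKernel 2)) hf x
  · have := integrable_conv_integrand 2 2 (memLp_dil hp (P.memLp_shellKernel 2)) hf x
    rwa [e] at this

lemma partialSum_zero (f : E3 → ℝ) : P.partialSum f 0 = lpBlock P (-1) f := by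
  rw [lpBlock_neg_one, partialSum]
  congr 1; ext x; simp [dil]

lemma partialSum_eq {f : E3 → ℝ} (hf : MemLp f 2 volume) (n : ℕ) (x : E3) :
    P.partialSum f n x = lpBlock P (-1) f x + ∑ j ∈ Finset.range n, lpBlock P j f x := by
  induction n with
  | zero => simp [partialSum_zero]
  | succ n ih => rw [P.partialSum_succ hf, ih, Finset.sum_range_succ, add_assoc]

lemma tendsto_partialSum {f : E3 → ℝ} (hf : MemLp f 2 volume) :
    Tendsto (fun n => eLpNorm (fun x => P.partialSum f n x - f x) 2 volume) atTop (𝓝 0) :=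
  (tendsto_eLpNorm_conv_dil 2 one_le_two (by simp) P.isMultiplier_rho.integrable
    (P.memLp_lowKernel 2) P.integral_lowKernel hf).comp
    (tendsto_pow_atTop_atTop_of_one_lt one_lt_two)

/-- The sum of the `L¹` norms of the derivatives of the low-frequency kernel. -/
def kernelConst : ℝ≥0∞ := ∑ j, eLpNorm (pd j P.lowKernel) 1 volume

lemma kernelConst_ne_top : P.kernelConst ≠ ⊤ :=
  ENNReal.sum_ne_top.2 fun j _ =>
    (memLp_one_iff_integrable.2 (P.isMultiplier_rho.integrable_pd j)).2.ne

lemma eLpNorm_increment_lowKernel_le {l : ℝ} (hl : 0 < l) (y : E3) :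
    eLpNorm (fun x => dil l P.lowKernel (x - y) - dil l P.lowKernel x) 1 volume ≤
      ENNReal.ofReal (‖y‖ * l) * P.kernelConst := by
  have hc : ContDiff ℝ ∞ P.lowKernel := P.isMultiplier_rho.contDiff
  refine (eLpNorm_translation_le_of_contDiff le_rfl ((contDiff_dil l hc).of_le (by simp)) y).trans
    (le_of_eq ?_)
  rw [ENNReal.ofReal_mul (norm_nonneg _), ofReal_norm, mul_assoc, kernelConst,
    Finset.mul_sum (a := ENNReal.ofReal l)]
  congr 1
  refine Finset.sum_congr rfl fun j _ => ?_
  rw [pd_dil j l (hc.differentiable (by simp))]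
  have h2 := eLpNorm_const_smul l (dil l (pd j P.lowKernel)) 1 (volume : Measure E3)
  have e : (l • dil l (pd j P.lowKernel)) = fun x => l * dil l (pd j P.lowKernel) x := rfl
  rw [e, eLpNorm_one_dil (K := pd j P.lowKernel) hl (P.isMultiplier_rho.integrable_pd j), Real.enorm_of_nonneg hl.le] at h2
  exact h2

/-- Increments of a frequency-localised convolution. -/
lemma eLpNorm_increment_block_le {m : E3 → ℝ} (hm : IsMultiplier m)
    (hs : ∀ ξ, m ξ ≠ 0 → ‖ξ‖ ≤ 8 / 3) {l : ℝ} (hl : 0 < l) {f : E3 → ℝ} (hf : MemLp f 2 volume)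
    (y : E3) :
    eLpNorm (fun x => conv (dil l (invFourierReal m)) f (x - y) -
      conv (dil l (invFourierReal m)) f x) 3 volume ≤
      (2 + 4 * P.kernelConst) * ENNReal.ofReal (min 1 (‖y‖ * l)) *
        eLpNorm (conv (dil l (invFourierReal m)) f) 3 volume := by
  have hl4 : 0 < 4 * l := by positivity
  have hmem : MemLp (conv (dil l (invFourierReal m)) f) 2 volume :=
    memLp_conv one_le_two (integrable_dil hl hm.integrable) hf
  -- Large displacements: the triangle inequality. Small ones: a Bernstein estimate, in which the
  -- block is reproduced by a kernel at frequency `4l` whose `L¹` increments are at most of order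
  -- `‖y‖ · 4l`.
  rcases le_total 1 (‖y‖ * l) with h | h
  · rw [min_eq_left h, ENNReal.ofReal_one, mul_one]
    refine (eLpNorm_sub_translation_le (by norm_num) hmem.1 y).trans ?_
    exact mul_le_mul' le_self_add le_rfl
  · rw [min_eq_right h]
    have e : conv (dil l (invFourierReal m)) f =
        conv (dil (4 * l) P.lowKernel) (conv (dil l (invFourierReal m)) f) := by
      conv_lhs => rw [← P.conv_lowKernel_eq hm hs hl, conv_comm (dil (4 * l) P.lowKernel)]
      exact conv_conv (integrable_dil hl hm.integrable)
        (memLp_dil hl4 (P.memLp_lowKernel 2)) hf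
    have h1 := eLpNorm_increment_conv_le (p := 3) (by norm_num)
      (memLp_dil hl4 (P.memLp_lowKernel 2)) hmem y
    rw [← e] at h1
    refine h1.trans (mul_le_mul' ((P.eLpNorm_increment_lowKernel_le hl4 y).trans ?_) le_rfl)
    rw [show ‖y‖ * (4 * l) = 4 * (‖y‖ * l) by ring, ENNReal.ofReal_mul (by norm_num)]
    calc _ = (4 * P.kernelConst) * ENNReal.ofReal (‖y‖ * l) := by
          simp only [ENNReal.ofReal_ofNat]; ring
      _ ≤ _ := mul_le_mul' le_add_self le_rfl

end DyadicPartition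

/-- A dyadic sum of Hölder type. -/
lemma exists_sum_min_le {s : ℝ} (hs0 : 0 < s) (hs1 : s < 1) :
    ∃ A : ℝ, 0 ≤ A ∧ ∀ (n : ℕ) (r : ℝ), 0 ≤ r →
      ∑ j ∈ Finset.range n, min 1 (r * 2 ^ j) * (2 : ℝ) ^ (-(j * s : ℝ)) ≤ A * r ^ s := by
  set q : ℝ := 2 ^ (-s) with hq
  have hq0 : 0 < q := by positivity
  have hq1 : q < 1 := Real.rpow_lt_one_of_one_lt_of_neg one_lt_two (by linarith)
  have h2s : (2 : ℝ) ^ s * q = 1 := by rw [hq, ← Real.rpow_add two_pos]; simp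
  have hpow : ∀ j : ℕ, (2 : ℝ) ^ (-(j * s : ℝ)) = q ^ j := fun j => by
    rw [hq, ← Real.rpow_natCast, ← Real.rpow_mul zero_le_two]
    congr 1; ring
  have h2q : 1 < 2 * q := by
    have : 2 * q = 2 ^ (1 - s) := by
      rw [hq, sub_eq_add_neg, Real.rpow_add two_pos, Real.rpow_one]
    rw [this]
    exact Real.one_lt_rpow one_lt_two (by linarith)
  set A0 : ℝ := 1 / (1 - q) with hA0
  set B : ℝ := 1 / (2 * q - 1) with hB
  have hA0p : 0 < A0 := by rw [hA0]; apply one_div_pos.2; linarith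
  have hBp : 0 < B := by rw [hB]; apply one_div_pos.2; linarith
  have hBeq : B * (2 * q - 1) = 1 := by rw [hB]; field_simp [show 2 * q - 1 ≠ 0 by linarith]
  have hA0eq : A0 * (1 - q) = 1 := by rw [hA0]; field_simp [show 1 - q ≠ 0 by linarith]
  -- Chosen so that `A * q = 1 + B + A0 * q`, which is what the induction needs when doubling `r`
  -- crosses one.
  set A : ℝ := 2 ^ s * (1 + B) + A0 with hA
  have h2sp : (0 : ℝ) < 2 ^ s := by positivity
  have hAp : 0 < A := by positivity
  have hAq : A * q = 1 + B + A0 * q := by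
    rw [hA]; linear_combination (1 + B) * h2s
  -- Removing the first term doubles `r` and multiplies the remaining sum by `q`; `A0` is the fixed
  -- point of `A0 = 1 + q * A0`.
  have hlarge : ∀ (n : ℕ) (r : ℝ), ∑ j ∈ Finset.range n, min 1 (r * 2 ^ j) * q ^ j ≤ A0 := by
    intro n
    induction n with
    | zero => intro r; simpa using hA0p.le
    | succ n ih =>
      intro r
      rw [Finset.sum_range_succ']
      have e : ∑ j ∈ Finset.range n, min 1 (r * 2 ^ (j + 1)) * q ^ (j + 1) =
          q * ∑ j ∈ Finset.range n, min 1 ((2 * r) * 2 ^ j) * q ^ j := by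
        rw [Finset.mul_sum]
        refine Finset.sum_congr rfl fun j _ => ?_
        rw [show r * 2 ^ (j + 1) = (2 * r) * 2 ^ j by ring]
        ring
      rw [e]
      have h1 := mul_le_mul_of_nonneg_left (ih (2 * r)) hq0.le
      have h2 : min 1 (r * 2 ^ 0) * q ^ 0 ≤ 1 := by simp
      linarith
  -- The extra `-B * r` makes the bound reproduce under the recursion: the first term adds `r`, and
  -- `B * (2 * q - 1) = 1` absorbs it. Positivity of `2 * q - 1` is where `s < 1` enters.
  have hsmall : ∀ (n : ℕ) (r : ℝ), 0 ≤ r → r ≤ 1 →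
      ∑ j ∈ Finset.range n, min 1 (r * 2 ^ j) * q ^ j ≤ A * r ^ s - B * r := by
    intro n
    induction n with
    | zero =>
      intro r hr0 hr1
      simp only [Finset.range_zero, Finset.sum_empty]
      have h1 : r ≤ r ^ s := by
        calc r = r ^ (1 : ℝ) := (Real.rpow_one r).symm
          _ ≤ r ^ s := Real.rpow_le_rpow_of_exponent_ge_of_imp hr0 hr1 hs1.le (by
              intro _ h; linarith)
      have h2 : B ≤ A := by
        have : (1 : ℝ) ≤ 2 ^ s := Real.one_le_rpow one_le_two hs0.le
        nlinarith
      nlinarith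
    | succ n ih =>
      intro r hr0 hr1
      rw [Finset.sum_range_succ']
      have e : ∑ j ∈ Finset.range n, min 1 (r * 2 ^ (j + 1)) * q ^ (j + 1) =
          q * ∑ j ∈ Finset.range n, min 1 ((2 * r) * 2 ^ j) * q ^ j := by
        rw [Finset.mul_sum]
        refine Finset.sum_congr rfl fun j _ => ?_
        rw [show r * 2 ^ (j + 1) = (2 * r) * 2 ^ j by ring]
        ring
      rw [e]
      have h2 : min 1 (r * 2 ^ 0) * q ^ 0 ≤ r := by simp
      rcases le_total (2 * r) 1 with h | h
      · have h1 := mul_le_mul_of_nonneg_left (ih (2 * r) (by linarith) h) hq0.le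
        rw [Real.mul_rpow zero_le_two hr0] at h1
        have h3 : q * (A * (2 ^ s * r ^ s) - B * (2 * r)) = A * r ^ s - B * r - r := by
          linear_combination (A * r ^ s) * h2s - r * hBeq
        linarith
      · have h1 := mul_le_mul_of_nonneg_left (hlarge n (2 * r)) hq0.le
        have h3 : q ≤ r ^ s := by
          have : (1 / 2 : ℝ) ^ s ≤ r ^ s := Real.rpow_le_rpow (by norm_num) (by linarith) hs0.le
          rwa [one_div, Real.inv_rpow zero_le_two, ← Real.rpow_neg zero_le_two] at this
        have h4 := mul_le_mul_of_nonneg_left h3 hAp.le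
        have h5 : B * r ≤ B := by nlinarith
        linarith
  refine ⟨A, hAp.le, fun n r hr => ?_⟩
  simp only [hpow]
  rcases le_total r 1 with h | h
  · linarith [hsmall n r hr h, mul_nonneg hBp.le hr]
  · refine (hlarge n r).trans ?_
    have h1 : 1 ≤ r ^ s := Real.one_le_rpow h hs0.le
    have h2 : A0 ≤ A := by rw [hA]; have := mul_pos h2sp (by linarith : 0 < 1 + B); linarith
    nlinarith

lemma eLpNorm_lpBlock_le (P : DyadicPartition) (s : ℝ) (p : ℝ≥0∞) (f : E3 → ℝ) (j : ℤ) :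
    eLpNorm (lpBlock P j f) p volume ≤
      ENNReal.ofReal (2 ^ (-(j * s : ℝ))) * besovNorm P s p f := by
  have h := le_iSup (fun j : ℤ => ENNReal.ofReal ((2 : ℝ) ^ ((j : ℝ) * s)) *
    eLpNorm (lpBlock P j f) p volume) j
  have e : ENNReal.ofReal (2 ^ (-(j * s : ℝ))) * ENNReal.ofReal ((2 : ℝ) ^ ((j : ℝ) * s)) = 1 := by
    rw [← ENNReal.ofReal_mul (by positivity), ← Real.rpow_add two_pos]
    simp
  calc eLpNorm (lpBlock P j f) p volume = ENNReal.ofReal (2 ^ (-(j * s : ℝ))) *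
        (ENNReal.ofReal ((2 : ℝ) ^ ((j : ℝ) * s)) * eLpNorm (lpBlock P j f) p volume) := by
        rw [← mul_assoc, e, one_mul]
    _ ≤ _ := mul_le_mul' le_rfl h

lemma aestronglyMeasurable_lpBlock (P : DyadicPartition) {f : E3 → ℝ} (hf : MemLp f 2 volume)
    (j : ℤ) : AEStronglyMeasurable (lpBlock P j f) volume := by
  rcases lt_or_ge j (-1) with hj | hj
  · have : lpBlock P j f = fun _ => 0 := by
      ext x; rw [lpBlock, if_pos (by omega)]
    rw [this]
    exact aestronglyMeasurable_const
  rcases hj.eq_or_lt with rfl | hj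
  · rw [P.lpBlock_neg_one]
    exact aestronglyMeasurable_conv P.isMultiplier_rho.integrable.1 hf.1
  · lift j to ℕ using by omega
    rw [P.lpBlock_natCast]
    exact aestronglyMeasurable_conv
      (integrable_dil (by positivity) P.isMultiplier_phi.integrable).1 hf.1

lemma min_one_le_rpow {r s : ℝ} (hr : 0 ≤ r) (hs0 : 0 < s) (hs1 : s < 1) : min 1 r ≤ r ^ s := by
  rcases le_total 1 r with h | h
  · rw [min_eq_left h]; exact Real.one_le_rpow h hs0.le
  · rw [min_eq_right h]
    calc r = r ^ (1 : ℝ) := (Real.rpow_one _).symm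
      _ ≤ r ^ s := Real.rpow_le_rpow_of_exponent_ge_of_imp hr h hs1.le (by
          intro _ h; linarith)

lemma eLpNorm_increment_lpBlock_neg_one_le (P : DyadicPartition) {s : ℝ} (hs0 : 0 < s)
    (hs1 : s < 1) {f : E3 → ℝ} (hf : MemLp f 2 volume) (y : E3) :
    eLpNorm (fun x => lpBlock P (-1) f (x - y) - lpBlock P (-1) f x) 3 volume ≤
      (2 + 4 * P.kernelConst) * (ENNReal.ofReal (2 ^ s * ‖y‖ ^ s) * besovNorm P s 3 f) := by
  have h := P.eLpNorm_increment_block_le P.isMultiplier_rho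
    (fun ξ hξ => (P.rho_support ξ hξ).trans (by norm_num)) one_pos hf y
  have e : conv (dil 1 (invFourierReal P.rho)) f = lpBlock P (-1) f := by
    rw [P.lpBlock_neg_one]
    congr 1; ext x; simp [dil, DyadicPartition.lowKernel]
  rw [e, mul_one] at h
  refine h.trans ?_
  rw [mul_assoc]
  refine mul_le_mul' le_rfl ?_
  calc _ ≤ ENNReal.ofReal (‖y‖ ^ s) * (ENNReal.ofReal (2 ^ s) * besovNorm P s 3 f) := by
        refine mul_le_mul' (ENNReal.ofReal_le_ofReal
          (min_one_le_rpow (norm_nonneg _) hs0 hs1)) ?_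
        simpa using eLpNorm_lpBlock_le P s 3 f (-1)
    _ = _ := by rw [ENNReal.ofReal_mul (by positivity)]; ring

lemma eLpNorm_increment_lpBlock_natCast_le (P : DyadicPartition) (s : ℝ) {f : E3 → ℝ}
    (hf : MemLp f 2 volume) (y : E3) (j : ℕ) :
    eLpNorm (fun x => lpBlock P j f (x - y) - lpBlock P j f x) 3 volume ≤
      (2 + 4 * P.kernelConst) * (ENNReal.ofReal
        (min 1 (‖y‖ * 2 ^ j) * (2 : ℝ) ^ (-(j * s : ℝ))) * besovNorm P s 3 f) := by
  have h := P.eLpNorm_increment_block_le P.isMultiplier_phi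
    (fun ξ hξ => (P.phi_support ξ hξ).2) (l := 2 ^ j) (by positivity) hf y
  have e : conv (dil (2 ^ j) (invFourierReal P.phi)) f = lpBlock P j f := by
    rw [P.lpBlock_natCast]; rfl
  rw [e] at h
  refine h.trans ?_
  rw [mul_assoc, ENNReal.ofReal_mul (by positivity), mul_assoc]
  refine mul_le_mul' le_rfl (mul_le_mul' le_rfl ?_)
  simpa using eLpNorm_lpBlock_le P s 3 f j

lemma sum_dyadic_le (κ N : ℝ≥0∞) {n : ℕ} {a : ℕ → ℝ} (ha : ∀ j, 0 ≤ a j) {A r s : ℝ} (hA0 : 0 ≤ A)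
    (hA : ∑ j ∈ Finset.range n, a j ≤ A * r ^ s) :
    κ * (ENNReal.ofReal (2 ^ s * r ^ s) * N) +
      ∑ j ∈ Finset.range n, κ * (ENNReal.ofReal (a j) * N) ≤
    κ * ENNReal.ofReal (2 ^ s + A) * N * ENNReal.ofReal (r ^ s) := by
  rw [← Finset.mul_sum, ← Finset.sum_mul, ← ENNReal.ofReal_sum_of_nonneg fun j _ => ha j]
  calc _ ≤ κ * (ENNReal.ofReal (2 ^ s * r ^ s) * N) + κ * (ENNReal.ofReal (A * r ^ s) * N) := by
        gcongr
    _ = _ := by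
        rw [ENNReal.ofReal_mul (by positivity), ENNReal.ofReal_mul hA0,
          ENNReal.ofReal_add (by positivity) hA0]
        ring

/-- Functions in `B^s_{3,∞}`, `0 < s < 1`, have Hölder increments in `L³`. -/
lemma exists_increment_le_besovNorm (P : DyadicPartition) {s : ℝ} (hs0 : 0 < s) (hs1 : s < 1) :
    ∃ C : ℝ≥0∞, C ≠ ⊤ ∧ ∀ f : E3 → ℝ, MemLp f 2 volume → ∀ y : E3,
      eLpNorm (fun x => f (x - y) - f x) 3 volume ≤
        C * besovNorm P s 3 f * ENNReal.ofReal (‖y‖ ^ s) := by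
  obtain ⟨A, hA0, hA⟩ := exists_sum_min_le hs0 hs1
  have hκt : 2 + 4 * P.kernelConst ≠ ⊤ := ENNReal.add_ne_top.2
    ⟨by simp, ENNReal.mul_ne_top (by simp) P.kernelConst_ne_top⟩
  refine ⟨(2 + 4 * P.kernelConst) * ENNReal.ofReal (2 ^ s + A),
    ENNReal.mul_ne_top hκt ENNReal.ofReal_ne_top, fun f hf y => ?_⟩
  have hmem : ∀ n, MemLp (P.partialSum f n) 2 volume := fun n =>
    memLp_conv one_le_two (integrable_dil (by positivity) P.isMultiplier_rho.integrable) hf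
  -- Only `f ∈ L²` is known, so the partial sums converge in `L²`; their `L³` increment bounds pass
  -- to the limit by Fatou.
  refine eLpNorm_translation_le_of_tendsto one_le_two (fun n => (hmem n).1) hf.1
    (P.tendsto_partialSum hf) 3 y fun n => ?_
  set F : ℤ → E3 → ℝ := fun j x => lpBlock P j f (x - y) - lpBlock P j f x with hF
  have e : (fun x => P.partialSum f n (x - y) - P.partialSum f n x) =
      F (-1) + ∑ j ∈ Finset.range n, F j := by
    ext x
    simp only [hF, P.partialSum_eq hf, Pi.add_apply, Finset.sum_apply, Finset.sum_sub_distrib]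
    ring
  have hm' : ∀ j : ℤ, AEStronglyMeasurable (F j) volume := fun j =>
    aestronglyMeasurable_sub_translation (aestronglyMeasurable_lpBlock P hf j) y
  have h3 : (1 : ℝ≥0∞) ≤ 3 := by norm_num
  rw [e]
  have h1 := (eLpNorm_add_le (hm' (-1)) (Finset.aestronglyMeasurable_sum (Finset.range n)
    fun j _ => hm' (j : ℤ)) h3).trans
      (add_le_add le_rfl (eLpNorm_sum_le (s := Finset.range n) (fun j _ => hm' (j : ℤ)) h3))
  refine h1.trans ((add_le_add (eLpNorm_increment_lpBlock_neg_one_le P hs0 hs1 hf y)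
    (Finset.sum_le_sum fun j _ => eLpNorm_increment_lpBlock_natCast_le P s hf y j)).trans ?_)
  exact sum_dyadic_le _ _ (fun j => by positivity) hA0 (hA n ‖y‖ (norm_nonneg _))

/-- Besov norms decrease with the regularity index. -/
lemma besovNorm_mono {F : Type*} [NormedAddCommGroup F] [NormedSpace ℝ F] (P : DyadicPartition)
    {s t : ℝ} (hst : s ≤ t) (p : ℝ≥0∞) (f : E3 → F) :
    besovNorm P s p f ≤ ENNReal.ofReal (2 ^ (t - s)) * besovNorm P t p f := by
  refine iSup_le fun j => ?_
  rcases lt_or_ge j (-1) with hj | hj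
  · have : lpBlock P j f = fun _ => 0 := by
      ext x; rw [lpBlock, if_pos (by omega)]
    rw [this]
    simp
  -- The constant `2 ^ (t - s)` is paid by the block `j = -1`, the only one with negative index that
  -- does not vanish.
  · refine le_trans ?_ (mul_le_mul' le_rfl (le_iSup (fun j : ℤ =>
      ENNReal.ofReal ((2 : ℝ) ^ ((j : ℝ) * t)) * eLpNorm (lpBlock P j f) p volume) j))
    rw [← mul_assoc, ← ENNReal.ofReal_mul (by positivity), ← Real.rpow_add two_pos]
    refine mul_le_mul' (ENNReal.ofReal_le_ofReal
      (Real.rpow_le_rpow_of_exponent_le one_le_two ?_)) le_rfl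
    have : (-1 : ℝ) ≤ j := by exact_mod_cast hj
    nlinarith

/-! ### Density of smooth solenoidal fields -/

lemma pd_comm (i j : Fin 3) {φ : E3 → ℝ} (hφ : ContDiff ℝ ∞ φ) :
    pd i (pd j φ) = pd j (pd i φ) := by
  ext x
  have hd : DifferentiableAt ℝ (fderiv ℝ φ) x :=
    ((hφ.fderiv_right (m := ∞) (by simp)).differentiable (by simp)) x
  have hs : IsSymmSndFDerivAt ℝ φ x :=
    (hφ.contDiffAt (x := x)).isSymmSndFDerivAt (by
      rw [minSmoothness_of_isRCLikeNormedField]; exact WithTop.coe_le_coe.2 le_top)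
  have h : ∀ k l, pd k (pd l φ) x =
      fderiv ℝ (fderiv ℝ φ) x (EuclideanSpace.single k 1) (EuclideanSpace.single l 1) := by
    intro k l
    have h1 := hd.hasFDerivAt.clm_apply (hasFDerivAt_const (EuclideanSpace.single l (1 : ℝ)) x)
    have h2 : HasFDerivAt (pd l φ) _ x := h1
    simp [pd, h2.fderiv]
  rw [h, h, hs.eq]

lemma pd_sub (j : Fin 3) {f g : E3 → ℝ} (hf : Differentiable ℝ f) (hg : Differentiable ℝ g)
    (x : E3) : pd j (fun y => f y - g y) x = pd j f x - pd j g x := by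
  simp [pd, fderiv_fun_sub (hf x) (hg x)]

lemma pd_comp_const_sub (j : Fin 3) {K : E3 → ℝ} (hK : Differentiable ℝ K) (x y : E3) :
    pd j (fun y => K (x - y)) y = - pd j K (x - y) := by
  have h1 : HasFDerivAt (fun y => x - y) (-(ContinuousLinearMap.id ℝ E3)) y := by
    simpa using (hasFDerivAt_id y).const_sub x
  have h2 := (hK (x - y)).hasFDerivAt.comp y h1
  have h3 : HasFDerivAt (fun y => K (x - y)) _ y := h2
  simp [pd, h3.fderiv]

lemma pd_neg (j : Fin 3) (f : E3 → ℝ) (x : E3) : pd j (fun y => - f y) x = - pd j f x := by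
  simp [pd, fderiv_fun_neg]

/-- Constants are excluded by the Sobolev inequality, which bounds the `L⁶` norm of a
square-integrable function by its gradient alone. -/
lemma ae_eq_zero_of_pd_eq_zero {f : E3 → ℝ} (hf : ContDiff ℝ ∞ f) (hf2 : MemLp f 2 volume)
    (h : ∀ j, pd j f =ᵐ[volume] 0) : f =ᵐ[volume] 0 := by
  obtain ⟨C, -, hC⟩ := exists_sobolev_const_smooth
  have h6 := hC f hf hf2
  have h0 : ∀ j, eLpNorm (pd j f) 2 volume = 0 := fun j => by
    rw [eLpNorm_congr_ae (h j)]; exact eLpNorm_zero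
  simp only [h0, Finset.sum_const_zero, mul_zero, nonpos_iff_eq_zero] at h6
  exact (eLpNorm_eq_zero_iff hf.continuous.aestronglyMeasurable (by norm_num)).1 h6

/-- A square-integrable function that is harmonic in the sense of distributions vanishes. -/
lemma ae_eq_zero_of_weakly_harmonic {f : E3 → ℝ} (hf : MemLp f 2 volume)
    (h : ∀ φ : E3 → ℝ, ContDiff ℝ ∞ φ → HasCompactSupport φ →
      ∑ j, ∫ x, f x * pd j (pd j φ) x = 0) : f =ᵐ[volume] 0 := by
  have hloc : LocallyIntegrable f := hf.locallyIntegrable (by norm_num)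
  have key : ∀ l : ℝ, 0 < l → S l f =ᵐ[volume] 0 := by
    intro l hl
    have hK := contDiff_mol l
    have hKc := hasCompactSupport_mol hl
    have hmem : ∀ K : E3 → ℝ, ContDiff ℝ ∞ K → HasCompactSupport K → MemLp (conv K f) 2 volume :=
      fun K hK hKc => memLp_conv one_le_two
        (hK.continuous.integrable_of_hasCompactSupport hKc) hf
    have e1 : ∀ j, pd j (S l f) = conv (pd j (mol l)) f := fun j => pd_conv j hK hKc hloc
    have e2 : ∀ j, pd j (pd j (S l f)) = conv (pd j (pd j (mol l))) f := fun j => by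
      rw [e1, pd_conv j (contDiff_pd j hK) (hasCompactSupport_pd j hKc) hloc]
    have m0 : MemLp (S l f) 2 volume := memLp_S hl one_le_two hf
    have m1 : ∀ j, MemLp (pd j (S l f)) 2 volume := fun j => by
      rw [e1]; exact hmem _ (contDiff_pd j hK) (hasCompactSupport_pd j hKc)
    have m2 : ∀ j, MemLp (pd j (pd j (S l f))) 2 volume := fun j => by
      rw [e2]
      exact hmem _ (contDiff_pd j (contDiff_pd j hK))
        (hasCompactSupport_pd j (hasCompactSupport_pd j hKc))
    have hsm : ContDiff ℝ ∞ (S l f) := contDiff_S hl hloc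
    have harm : ∀ x, ∑ j, pd j (pd j (S l f)) x = 0 := by
      intro x
      have ht := h (fun y => mol l (x - y)) (hK.comp (contDiff_const.sub contDiff_id))
        (hKc.comp_homeomorph (Homeomorph.subLeft x))
      rw [← ht]
      refine Finset.sum_congr rfl fun j _ => ?_
      rw [e2, conv_comm, conv]
      congr 1; ext y
      have : pd j (fun y => mol l (x - y)) = fun y => - pd j (mol l) (x - y) :=
        funext fun y => pd_comp_const_sub j (hK.differentiable (by simp)) x y
      rw [this, pd_neg, pd_comp_const_sub j ((contDiff_pd j hK).differentiable (by simp)), neg_neg]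
    -- The energy identity for the harmonic function `S l f`. Mollification puts all the derivatives
    -- involved in `L²`, so no boundary terms arise; summing over `j` gives `‖∇ S f‖₂ = 0`.
    have hibp : ∀ j, ∫ x, pd j (S l f) x * pd j (S l f) x =
        - ∫ x, S l f x * pd j (pd j (S l f)) x := fun j => by
      have := integral_mul_pd j (hsm.differentiable (by simp))
        ((contDiff_pd j hsm).differentiable (by simp)) ((m1 j).integrable_mul (m1 j))
        (m0.integrable_mul (m2 j)) (m0.integrable_mul (m1 j))
      rw [this, neg_neg]
    have hsum : ∑ j, ∫ x, pd j (S l f) x * pd j (S l f) x = 0 := by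
      simp only [hibp, Finset.sum_neg_distrib]
      have hi : ∀ j ∈ Finset.univ, Integrable (fun x => S l f x * pd j (pd j (S l f)) x) :=
        fun j _ => m0.integrable_mul (m2 j)
      rw [← integral_finsetSum _ hi]
      simp only [← Finset.mul_sum, harm, mul_zero, integral_zero, neg_zero]
    rw [Finset.sum_eq_zero_iff_of_nonneg fun j _ => integral_nonneg fun x => mul_self_nonneg _]
      at hsum
    refine ae_eq_zero_of_pd_eq_zero hsm m0 fun j => ?_
    have h0 := (integral_eq_zero_iff_of_nonneg (fun x => mul_self_nonneg _)
      ((m1 j).integrable_mul (m1 j))).1 (hsum j (Finset.mem_univ j))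
    filter_upwards [h0] with x hx
    simpa using hx
  have ht := tendsto_eLpNorm_S_nat one_le_two (by norm_num) hf
  have hc : ∀ n : ℕ, eLpNorm (fun x => S (n + 1) f x - f x) 2 volume = eLpNorm f 2 volume := by
    intro n
    rw [← eLpNorm_neg f]
    refine eLpNorm_congr_ae ?_
    filter_upwards [key (n + 1) (by positivity)] with x hx
    simp [hx]
  simp only [hc] at ht
  exact (eLpNorm_eq_zero_iff hf.1 (by norm_num)).1 (tendsto_nhds_unique tendsto_const_nhds ht)

lemma memLp_apply {X ι : Type*} [MeasurableSpace X] {μ : Measure X} [Fintype ι]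
    {v : X → EuclideanSpace ℝ ι} {p : ℝ≥0∞} (hv : MemLp v p μ) (i : ι) :
    MemLp (fun x => v x i) p μ :=
  (EuclideanSpace.proj (𝕜 := ℝ) i).comp_memLp' hv

lemma inner_eq_sum (x y : E3) : inner ℝ x y = ∑ i, x i * y i := by
  simp [PiLp.inner_apply, mul_comm]

lemma contDiff_toLp {n : WithTop ℕ∞} {w : Fin 3 → E3 → ℝ} (hw : ∀ i, ContDiff ℝ n (w i)) :
    ContDiff ℝ n (fun x => (WithLp.toLp 2 fun i => w i x : E3)) :=
  contDiff_euclidean.2 hw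

lemma hasCompactSupport_toLp {w : Fin 3 → E3 → ℝ} (hw : ∀ i, HasCompactSupport (w i)) :
    HasCompactSupport (fun x => (WithLp.toLp 2 fun i => w i x : E3)) := by
  have hK : IsCompact (⋃ i, tsupport (w i)) := isCompact_iUnion fun i => hw i
  refine HasCompactSupport.intro hK fun x hx => ?_
  simp only [mem_iUnion, not_exists] at hx
  exact PiLp.ext fun i => image_eq_zero_of_notMem_tsupport (f := w i) (hx i)

/-- The gradient of a scalar function as a vector field. -/
def gradField (φ : E3 → ℝ) (x : E3) : E3 := WithLp.toLp 2 fun i => pd i φ x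

/-- The solenoidal field `∂ⱼψ eᵢ - ∂ᵢψ eⱼ`. -/
def curlField (i j : Fin 3) (ψ : E3 → ℝ) (x : E3) : E3 :=
  WithLp.toLp 2 fun k => (if k = i then pd j ψ x else 0) - (if k = j then pd i ψ x else 0)

/-- Smooth compactly supported solenoidal fields. -/
structure IsSmoothSolenoidal (w : E3 → E3) : Prop where
  smooth : ContDiff ℝ ∞ w
  compact_support : HasCompactSupport w
  div_free : ∀ x, divergence w x = 0

lemma IsSmoothSolenoidal.memLp {w : E3 → E3} (hw : IsSmoothSolenoidal w) (p : ℝ≥0∞) :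
    MemLp w p volume := hw.smooth.continuous.memLp_of_hasCompactSupport hw.compact_support

lemma contDiff_apply_euclidean {n : WithTop ℕ∞} {w : E3 → E3} (hw : ContDiff ℝ n w) (i : Fin 3) :
    ContDiff ℝ n (fun x => w x i) := contDiff_euclidean.1 hw i

lemma hasCompactSupport_apply {w : E3 → E3} (hw : HasCompactSupport w) (i : Fin 3) :
    HasCompactSupport (fun x => w x i) :=
  hw.comp_left (g := fun v : E3 => v i) rfl

lemma contDiff_gradField {φ : E3 → ℝ} (hφ : ContDiff ℝ ∞ φ) : ContDiff ℝ ∞ (gradField φ) :=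
  contDiff_toLp fun i => contDiff_pd i hφ

lemma memLp_gradField {φ : E3 → ℝ} (hφ : ContDiff ℝ ∞ φ) (hφc : HasCompactSupport φ) :
    MemLp (gradField φ) 2 volume :=
  (contDiff_gradField hφ).continuous.memLp_of_hasCompactSupport
    (hasCompactSupport_toLp fun i => hasCompactSupport_pd i hφc)

lemma isSmoothSolenoidal_curlField (i j : Fin 3) {ψ : E3 → ℝ} (hψ : ContDiff ℝ ∞ ψ)
    (hψc : HasCompactSupport ψ) : IsSmoothSolenoidal (curlField i j ψ) := by
  have hs : ∀ (p : Prop) [Decidable p] (m : Fin 3),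
      ContDiff ℝ ∞ (fun x => if p then pd m ψ x else 0) := fun p _ m => by
    split_ifs
    exacts [contDiff_pd m hψ, contDiff_const]
  refine ⟨contDiff_toLp fun k => (hs _ j).sub (hs _ i), hasCompactSupport_toLp fun k => ?_,
    fun x => ?_⟩
  · have hc : ∀ (p : Prop) [Decidable p] (m : Fin 3),
        HasCompactSupport (fun x => if p then pd m ψ x else 0) := fun p _ m => by
      split_ifs
      exacts [hasCompactSupport_pd m hψc, HasCompactSupport.zero]
    exact (hc _ j).sub (hc _ i)
  · have hp : ∀ (p : Prop) [Decidable p] (m k : Fin 3),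
        pd k (fun x => if p then pd m ψ x else 0) x = if p then pd k (pd m ψ) x else 0 :=
      fun p _ m k => by
        split_ifs
        · rfl
        · simp [pd]
    have hk : ∀ k, pd k (fun y => curlField i j ψ y k) x =
        (if k = i then pd k (pd j ψ) x else 0) - if k = j then pd k (pd i ψ) x else 0 := by
      intro k
      rw [← hp, ← hp]
      exact pd_sub k ((hs _ j).differentiable (by simp)) ((hs _ i).differentiable (by simp)) x
    simp only [divergence, hk, Finset.sum_sub_distrib, Finset.sum_ite_eq', Finset.mem_univ,
      if_true, pd_comm i j hψ, sub_self]

/-- The subspace of `L²` spanned by the smooth compactly supported solenoidal fields. -/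
def smoothSolenoidal : Submodule ℝ (Lp E3 2 (volume : Measure E3)) where
  carrier := {f | ∃ w, IsSmoothSolenoidal w ∧ f =ᵐ[volume] w}
  zero_mem' := ⟨0, ⟨contDiff_const, HasCompactSupport.zero, fun x => by simp [divergence, pd]⟩,
    Lp.coeFn_zero _ _ _⟩
  add_mem' := by
    rintro f g ⟨w, hw, hfw⟩ ⟨z, hz, hgz⟩
    refine ⟨w + z, ⟨hw.smooth.add hz.smooth, hw.compact_support.add hz.compact_support,
      fun x => ?_⟩, (Lp.coeFn_add f g).trans (hfw.add hgz)⟩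
    have h := congrArg₂ (· + ·) (hw.div_free x) (hz.div_free x)
    simp only [divergence, ← Finset.sum_add_distrib, add_zero] at h
    rw [← h]
    refine Finset.sum_congr rfl fun i _ => ?_
    have h1 := ((contDiff_apply_euclidean hw.smooth i).differentiable (by simp)) x
    have h2 := ((contDiff_apply_euclidean hz.smooth i).differentiable (by simp)) x
    simp [pd, fderiv_fun_add h1 h2]
  smul_mem' := by
    rintro c f ⟨w, hw, hfw⟩
    refine ⟨c • w, ⟨hw.smooth.const_smul c, hw.compact_support.smul_left (f := fun _ => c),
      fun x => ?_⟩, (Lp.coeFn_smul c f).trans (hfw.const_smul c)⟩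
    have h := congrArg (c * ·) (hw.div_free x)
    simp only [divergence, Finset.mul_sum, mul_zero] at h
    rw [← h, divergence]
    refine Finset.sum_congr rfl fun i _ => ?_
    have h1 := ((contDiff_apply_euclidean hw.smooth i).differentiable (by simp)) x
    simp [pd, fderiv_const_mul h1]

lemma integral_inner_gradField {w : E3 → E3} (hw : IsSmoothSolenoidal w) {φ : E3 → ℝ}
    (hφ : ContDiff ℝ ∞ φ) (hφc : HasCompactSupport φ) :
    ∫ x, inner ℝ (w x) (gradField φ x) = 0 := by
  have hwi := fun i => contDiff_apply_euclidean hw.smooth i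
  have hwc := fun i => hasCompactSupport_apply hw.compact_support i
  simp only [inner_eq_sum, gradField]
  have h1 : ∀ i ∈ Finset.univ, Integrable (fun x => w x i * pd i φ x) := fun i _ =>
    ((hwi i).continuous.mul
      (contDiff_pd i hφ).continuous).integrable_of_hasCompactSupport (hwc i).mul_right
  have h2 : ∀ i ∈ Finset.univ, Integrable (fun x => pd i (fun x => w x i) x * φ x) := fun i _ =>
    ((contDiff_pd i (hwi i)).continuous.mul
      hφ.continuous).integrable_of_hasCompactSupport hφc.mul_left
  rw [integral_finsetSum _ h1]
  simp only [fun i => hasWeakDeriv_of_contDiff i (hwi i) φ hφ hφc, Finset.sum_neg_distrib]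
  rw [← integral_finsetSum _ h2]
  have : ∀ x, ∑ i, pd i (fun x => w x i) x * φ x = 0 := fun x => by
    rw [← Finset.sum_mul]
    have := hw.div_free x
    rw [divergence] at this
    rw [this, zero_mul]
  simp [this]

/-- Square-integrable solenoidal fields orthogonal to the smooth ones vanish. -/
lemma ae_eq_zero_of_orthogonal {v : E3 → E3} (hv : MemLp v 2 volume)
    (hdiv : ∀ φ : E3 → ℝ, ContDiff ℝ ∞ φ → HasCompactSupport φ →
      ∫ x, inner ℝ (v x) (gradField φ x) = 0)
    (horth : ∀ w, IsSmoothSolenoidal w → ∫ x, inner ℝ (v x) (w x) = 0) (i : Fin 3) :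
    (fun x => v x i) =ᵐ[volume] 0 := by
  have hvi : ∀ i, MemLp (fun x => v x i) 2 volume := fun i => memLp_apply hv i
  have hint : ∀ (i : Fin 3) {φ : E3 → ℝ}, ContDiff ℝ ∞ φ → HasCompactSupport φ →
      Integrable (fun x => v x i * φ x) := fun i φ hφ hφc =>
    (hvi i).integrable_mul (q := 2) (memLp_of_hasCompactSupport hφ.continuous hφc)
  refine ae_eq_zero_of_weakly_harmonic (hvi i) fun φ hφ hφc => ?_
  have hpp : ∀ a b, ContDiff ℝ ∞ (pd a (pd b φ)) := fun a b => contDiff_pd a (contDiff_pd b hφ)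
  have hppc : ∀ a b, HasCompactSupport (pd a (pd b φ)) := fun a b =>
    hasCompactSupport_pd a (hasCompactSupport_pd b hφc)
  -- Orthogonality to the curl field of `∂ⱼφ` says that the curl of `v` vanishes weakly. Summed over
  -- `j`, it turns the Laplacian of `vᵢ` into `∂ᵢ div v`, which is zero.
  have h1 : ∀ j, ∫ x, v x i * pd j (pd j φ) x = ∫ x, v x j * pd i (pd j φ) x := by
    intro j
    have h := horth _ (isSmoothSolenoidal_curlField i j (contDiff_pd j hφ)
      (hasCompactSupport_pd j hφc))
    simp only [inner_eq_sum, curlField, mul_sub, Finset.sum_sub_distrib, mul_ite, mul_zero,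
      Finset.sum_ite_eq', Finset.mem_univ, if_true] at h
    rw [integral_sub (hint i (hpp j j) (hppc j j)) (hint j (hpp i j) (hppc i j))] at h
    linarith
  have h2 := hdiv (pd i φ) (contDiff_pd i hφ) (hasCompactSupport_pd i hφc)
  simp only [inner_eq_sum, gradField] at h2
  rw [integral_finsetSum _ fun j _ => hint j (hpp j i) (hppc j i)] at h2
  simp only [h1, pd_comm i _ hφ]
  exact h2

/-- Smooth compactly supported solenoidal fields are dense among the square-integrable solenoidal
fields. -/
lemma exists_smoothSolenoidal_approx {g : E3 → E3} (hg : MemLp g 2 volume)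
    (hd : IsWeaklyDivFree g) {ε : ℝ≥0∞} (hε : 0 < ε) :
    ∃ w, IsSmoothSolenoidal w ∧ eLpNorm (fun x => w x - g x) 2 volume < ε := by
  set K := smoothSolenoidal.topologicalClosure with hK
  have : CompleteSpace K := smoothSolenoidal.isClosed_topologicalClosure.completeSpace_coe
  obtain ⟨y, hy, z, hz, hyz⟩ := Submodule.exists_add_mem_mem_orthogonal (K := K) (hg.toLp g)
  have hzW : z ∈ smoothSolenoidalᗮ := by
    rwa [hK, Submodule.orthogonal_closure] at hz
  -- Gradients are orthogonal to `K`, hence to `y`, and orthogonal to `g` by incompressibility. The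
  -- remainder `z = g - y` is therefore itself solenoidal, besides being orthogonal to the smooth
  -- solenoidal fields, and so it vanishes.
  have hgrad : ∀ φ : E3 → ℝ, ContDiff ℝ ∞ φ → HasCompactSupport φ →
      ∫ x, inner ℝ (z x) (gradField φ x) = 0 := by
    intro φ hφ hφc
    have hm := memLp_gradField hφ hφc
    have horth : hm.toLp _ ∈ Kᗮ := by
      rw [hK, Submodule.orthogonal_closure, Submodule.mem_orthogonal]
      rintro f ⟨w, hw, hfw⟩
      rw [L2.inner_def, ← integral_inner_gradField hw hφ hφc]
      refine integral_congr_ae ?_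
      filter_upwards [hfw, hm.coeFn_toLp] with x h1 h2
      rw [h1, h2]
    have h1 : inner ℝ y (hm.toLp _) = 0 := (Submodule.mem_orthogonal _ _).1 horth y hy
    have h2 : inner ℝ (hg.toLp g) (hm.toLp _) = 0 := by
      rw [L2.inner_def, ← hd φ hφ hφc]
      refine integral_congr_ae ?_
      filter_upwards [hg.coeFn_toLp, hm.coeFn_toLp] with x h1 h2
      rw [h1, h2, inner_eq_sum]
      rfl
    rw [hyz, inner_add_left, h1, zero_add, L2.inner_def] at h2
    rw [← h2]
    refine integral_congr_ae ?_
    filter_upwards [hm.coeFn_toLp] with x h2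
    rw [h2]
  have hw0 : ∀ w, IsSmoothSolenoidal w → ∫ x, inner ℝ (z x) (w x) = 0 := by
    intro w hw
    have h := (Submodule.mem_orthogonal' _ _).1 hzW ((hw.memLp 2).toLp w)
      ⟨w, hw, (hw.memLp 2).coeFn_toLp⟩
    rw [L2.inner_def] at h
    rw [← h]
    refine integral_congr_ae ?_
    filter_upwards [(hw.memLp 2).coeFn_toLp] with x h2
    rw [h2]
  have hz0 := ae_eq_zero_of_orthogonal (Lp.memLp z) hgrad hw0
  have hgy : g =ᵐ[volume] y := by
    have hall := ae_all_iff.2 hz0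
    have hadd := Lp.coeFn_add y z
    rw [← hyz] at hadd
    filter_upwards [hall, hadd, hg.coeFn_toLp] with x h1 h2 h3
    rw [← h3, h2]
    ext i
    simpa using h1 i
  have hy' : y ∈ closure (smoothSolenoidal : Set (Lp E3 2 (volume : Measure E3))) := hy
  obtain ⟨f, ⟨w, hw, hfw⟩, hlt⟩ := EMetric.mem_closure_iff.1 hy' ε hε
  refine ⟨w, hw, ?_⟩
  rw [edist_comm, Lp.edist_def] at hlt
  rwa [eLpNorm_congr_ae (g := ⇑f - ⇑y)]
  filter_upwards [hfw, hgy] with x h1 h2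
  simp [h1, h2]

/-! ### Weak differential identities in time -/

lemma contDiff_primitive {ψ : ℝ → ℝ} (hψ : ContDiff ℝ ∞ ψ) (a : ℝ) :
    ContDiff ℝ ∞ (fun t => ∫ s in a..t, ψ s) := by
  have hd : ∀ t, HasDerivAt (fun t => ∫ s in a..t, ψ s) (ψ t) t := fun t =>
    intervalIntegral.integral_hasDerivAt_right (hψ.continuous.intervalIntegrable _ _)
      (hψ.continuous.stronglyMeasurableAtFilter _ _) hψ.continuous.continuousAt
  rw [contDiff_infty_iff_deriv]
  exact ⟨fun t => (hd t).differentiableAt, by rwa [funext fun t => (hd t).deriv]⟩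

/-- A continuous function whose distributional derivative, initial value included, is integrable
is the corresponding primitive. -/
lemma eq_add_integral_of_weak_deriv {T : ℝ} (hT : 0 < T) {g h : ℝ → ℝ} {g₀ : ℝ}
    (hg : ContinuousOn g (Icc 0 T)) (hh : IntervalIntegrable h volume 0 T)
    (hw : ∀ θ : ℝ → ℝ, ContDiff ℝ ∞ θ → HasCompactSupport θ → tsupport θ ⊆ Iio T →
      ∫ t in Ioo 0 T, (deriv θ t * g t + θ t * h t) = -(θ 0 * g₀)) :
    ∀ t ∈ Icc 0 T, g t = g₀ + ∫ s in (0 : ℝ)..t, h s := by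
  set I : ℝ → ℝ := fun t => ∫ s in (0 : ℝ)..t, h s with hI
  have hIac : AbsolutelyContinuousOnInterval I 0 T :=
    hh.absolutelyContinuousOnInterval_intervalIntegral (by simp)
  have hIc : ContinuousOn I (Icc 0 T) := by
    have := hIac.continuousOn
    rwa [uIcc_of_le hT.le] at this
  have hGc : ContinuousOn (fun t => g₀ + I t) (Icc 0 T) := continuousOn_const.add hIc
  have hint : ∀ {f : ℝ → ℝ}, ContinuousOn f (Icc 0 T) → IntervalIntegrable f volume 0 T :=
    fun hf => ContinuousOn.intervalIntegrable (by rwa [uIcc_of_le hT.le])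
  have hae : ∀ᵐ t, t ∈ Ioo 0 T → g t - (g₀ + I t) = 0 := by
    refine isOpen_Ioo.ae_eq_zero_of_integral_contDiff_smul_eq_zero
      ((hg.sub hGc).mono Ioo_subset_Icc_self |>.locallyIntegrableOn measurableSet_Ioo) ?_
    intro ψ hψ hψc hψs
    -- The primitive is normalised at `T`: as `ψ` has compact support in `(0, T)`, it vanishes near
    -- `T`, which makes it admissible there, while its value at `0` picks up the initial datum.
    set Θ : ℝ → ℝ := fun t => ∫ s in T..t, ψ s with hΘ
    have hΘd : ∀ t, HasDerivAt Θ (ψ t) t := fun t =>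
      intervalIntegral.integral_hasDerivAt_right (hψ.continuous.intervalIntegrable _ _)
        (hψ.continuous.stronglyMeasurableAtFilter _ _) hψ.continuous.continuousAt
    have hΘs : ContDiff ℝ ∞ Θ := contDiff_primitive hψ T
    obtain ⟨b, hbT, hb⟩ : ∃ b < T, ∀ t, b ≤ t → ψ t = 0 := by
      rcases (tsupport ψ).eq_empty_or_nonempty with he | hne
      · exact ⟨T - 1, by linarith, fun t _ => by
          rw [tsupport_eq_empty_iff] at he; simp [he]⟩
      · obtain ⟨c, hc, hmax⟩ := IsCompact.exists_isGreatest hψc hne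
        have hcT := (hψs hc).2
        exact ⟨(c + T) / 2, by linarith, fun t ht => image_eq_zero_of_notMem_tsupport
          fun hts => by have := hmax hts; linarith⟩
    have hΘ0 : ∀ t, b ≤ t → Θ t = 0 := fun t ht =>
      intervalIntegral.integral_zero_ae (ae_of_all _ fun s hs => hb s (by
        rcases le_total T t with h | h
        · rw [uIoc_of_le h] at hs; linarith [hs.1]
        · rw [uIoc_of_ge h] at hs; linarith [hs.1]))
    -- The primitive need not vanish to the left of the support of `ψ`. The bump makes it compactly
    -- supported without changing it on `[0, T]`.
    let χ : ContDiffBump (0 : ℝ) := ⟨T + 1, T + 2, by linarith, by linarith⟩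
    have hχ1 : ∀ t ∈ Icc (-(T + 1)) (T + 1), χ t = 1 := fun t ht =>
      χ.one_of_mem_closedBall (by
        rw [Real.closedBall_eq_Icc, zero_sub, zero_add]; exact ht)
    set θ : ℝ → ℝ := fun t => χ t * Θ t with hθ
    have hθs : tsupport θ ⊆ Iio T := by
      have : tsupport θ ⊆ Iic b := closure_minimal (fun t ht => by
        by_contra hlt
        exact ht (by simp [hθ, hΘ0 t (not_le.1 hlt).le])) isClosed_Iic
      exact this.trans (Iic_subset_Iio.2 hbT)
    have h1 := hw θ (χ.contDiff.mul hΘs) χ.hasCompactSupport.mul_right hθs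
    have h2 : ∫ t in Ioo 0 T, (deriv θ t * g t + θ t * h t) =
        ∫ t in Ioo 0 T, (ψ t * g t + Θ t * h t) := by
      refine setIntegral_congr_fun measurableSet_Ioo fun t ht => ?_
      have e1 : θ =ᶠ[𝓝 t] Θ := by
        filter_upwards [isOpen_Ioo.mem_nhds ht] with s hs
        simp [hθ, hχ1 s ⟨by linarith [hs.1], by linarith [hs.2]⟩]
      simp only [e1.deriv_eq, e1.eq_of_nhds, (hΘd t).deriv]
    have h3 : θ 0 = Θ 0 := by simp [hθ, hχ1 0 ⟨by linarith, by linarith⟩]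
    rw [h2, h3, ← integral_Ioc_eq_integral_Ioo, ← intervalIntegral.integral_of_le hT.le] at h1
    have hψg : IntervalIntegrable (fun t => ψ t * g t) volume 0 T :=
      hint (hψ.continuous.continuousOn.mul hg)
    have hψI : IntervalIntegrable (fun t => ψ t * I t) volume 0 T :=
      hint (hψ.continuous.continuousOn.mul hIc)
    have hΘh : IntervalIntegrable (fun t => Θ t * h t) volume 0 T :=
      hh.continuousOn_mul hΘs.continuous.continuousOn
    rw [intervalIntegral.integral_add hψg hΘh] at h1
    have hΘac : AbsolutelyContinuousOnInterval Θ 0 T :=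
      ContDiffOn.absolutelyContinuousOnInterval (hΘs.contDiffOn.of_le (by simp))
    have h4 := hΘac.integral_mul_deriv_eq_deriv_mul hIac
    have h5 : ∫ t in (0 : ℝ)..T, Θ t * deriv I t = ∫ t in (0 : ℝ)..T, Θ t * h t := by
      refine intervalIntegral.integral_congr_ae ?_
      filter_upwards [hh.ae_hasDerivAt_integral] with t ht hts
      have := ht (uIoc_subset_uIcc hts) 0 (by simp)
      rw [show deriv I t = h t from this.deriv]
    have h6 : Θ 0 = -∫ t in (0 : ℝ)..T, ψ t := intervalIntegral.integral_symm _ _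
    simp only [(fun t => (hΘd t).deriv : ∀ t, deriv Θ t = ψ t)] at h4
    rw [h5, hΘ0 T hbT.le, show I 0 = 0 from intervalIntegral.integral_same] at h4
    have h7 : ∫ t, ψ t • (g t - (g₀ + I t)) = ∫ t in (0 : ℝ)..T, ψ t * (g t - (g₀ + I t)) := by
      rw [intervalIntegral.integral_of_le hT.le, integral_Ioc_eq_integral_Ioo]
      refine (setIntegral_eq_integral_of_forall_compl_eq_zero fun t ht => ?_).symm
      rw [image_eq_zero_of_notMem_tsupport fun hts => ht (hψs hts), zero_smul]
    have h8 : ∫ t in (0 : ℝ)..T, ψ t * (g t - (g₀ + I t)) = (∫ t in (0 : ℝ)..T, ψ t * g t) -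
        (g₀ * (∫ t in (0 : ℝ)..T, ψ t) + ∫ t in (0 : ℝ)..T, ψ t * I t) := by
      rw [← intervalIntegral.integral_const_mul, ← intervalIntegral.integral_add
        ((hψ.continuous.intervalIntegrable 0 T).const_mul g₀) hψI, ← intervalIntegral.integral_sub
        hψg (((hψ.continuous.intervalIntegrable 0 T).const_mul g₀).add hψI)]
      congr 1; ext t; ring
    rw [h7, h8]
    linear_combination h1 - h4 - g₀ * h6
  refine Measure.eqOn_Icc_of_ae_eq (μ := volume) hT.ne ?_ hg hGc
  rw [Measure.restrict_congr_set Ioo_ae_eq_Icc.symm, EventuallyEq,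
    ae_restrict_iff' measurableSet_Ioo]
  filter_upwards [hae] with t ht hts
  linarith [ht hts]

/-- The fundamental theorem of calculus on the diagonal, for a symmetric function of two variables
that is absolutely continuous in each of them. -/
lemma sub_eq_two_mul_integral_diag {T : ℝ} {b n : ℝ → ℝ → ℝ} {m : ℝ → ℝ}
    (hsymm : ∀ s t, b s t = b t s)
    (hb : ∀ t' ∈ Icc 0 T, ∀ t ∈ Icc 0 T, b t t' - b 0 t' = ∫ s in (0 : ℝ)..t, n s t')
    (hmeas : ∀ t' ∈ Icc 0 T,
      AEStronglyMeasurable (fun s => n s t') (volume.restrict (Ioo 0 T)))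
    (hm : IntegrableOn m (Ioo 0 T))
    (hbound : ∀ᵐ s ∂(volume.restrict (Ioo 0 T)), ∀ t' ∈ Icc 0 T, |n s t'| ≤ m s)
    (hcont : ∀ᵐ s ∂(volume.restrict (Ioo 0 T)), ContinuousOn (n s) (Icc 0 T))
    {t : ℝ} (ht : t ∈ Icc 0 T) :
    IntegrableOn (fun s => n s s) (Ioc 0 t) ∧ b t t - b 0 0 = 2 * ∫ s in (0 : ℝ)..t, n s s := by
  rcases ht.1.eq_or_lt with rfl | ht0
  · simp
  rw [Measure.restrict_congr_set Ioo_ae_eq_Ioc] at hmeas hbound hcont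
  rw [IntegrableOn, Measure.restrict_congr_set Ioo_ae_eq_Ioc] at hm
  have hsub : Ioc 0 t ⊆ Ioc 0 T := Ioc_subset_Ioc_right ht.2
  have hle := Measure.restrict_mono_set volume hsub
  have hnint : ∀ t' ∈ Icc 0 T, IntegrableOn (fun s => n s t') (Ioc 0 T) := fun t' ht' =>
    hm.mono' (hmeas t' ht') (by filter_upwards [hbound] with s hs using hs t' ht')
  have hnint' : ∀ t' ∈ Icc 0 T, ∀ a ∈ Icc 0 T, ∀ c ∈ Icc 0 T,
      IntervalIntegrable (fun s => n s t') volume a c := fun t' ht' a ha c hc =>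
    intervalIntegrable_iff.2 ((hnint t' ht').mono_set (by
      intro s hs
      rw [mem_uIoc] at hs
      rcases hs with h | h
      exacts [⟨ha.1.trans_lt h.1, h.2.trans hc.2⟩, ⟨hc.1.trans_lt h.1, h.2.trans ha.2⟩]))
  have hb' : ∀ t' ∈ Icc 0 T, ∀ a ∈ Icc 0 T, ∀ c ∈ Icc 0 T,
      b c t' - b a t' = ∫ s in a..c, n s t' := by
    intro t' ht' a ha c hc
    have h0 : (0 : ℝ) ∈ Icc 0 T := ⟨le_rfl, ht.1.trans ht.2⟩
    rw [← intervalIntegral.integral_interval_sub_left (hnint' t' ht' 0 h0 c hc)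
      (hnint' t' ht' 0 h0 a ha), ← hb t' ht' c hc, ← hb t' ht' a ha]
    ring
  -- evaluation at the right and left end points of the partition intervals
  set p : ℕ → ℕ → ℝ := fun N k => t * (k / (N + 1)) with hp
  set r : ℕ → ℝ → ℝ := fun N s => p N ⌈s * (N + 1) / t⌉₊ with hr
  -- The truncated subtraction is harmless: for `s` in `(0, t]` the ceiling is at least one.
  set l : ℕ → ℝ → ℝ := fun N s => p N (⌈s * (N + 1) / t⌉₊ - 1) with hl
  set F : ℕ → ℝ → ℝ := fun N s => n s (r N s) + n s (l N s) with hF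
  have hpmem : ∀ N k, k ≤ N + 1 → p N k ∈ Icc 0 t := fun N k hk => by
    have h1 : (k : ℝ) / (N + 1) ≤ 1 := div_le_one_of_le₀ (by exact_mod_cast hk) (by positivity)
    exact ⟨by positivity, by simp only [hp]; nlinarith⟩
  have hpmemT : ∀ N k, k ≤ N + 1 → p N k ∈ Icc 0 T := fun N k hk =>
    Icc_subset_Icc_right ht.2 (hpmem N k hk)
  have hceil : ∀ N k s, s ∈ Ioc (p N k) (p N (k + 1)) → ⌈s * (N + 1) / t⌉₊ = k + 1 := by
    intro N k s hs
    rw [Nat.ceil_eq_iff (by omega)]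
    have hN : (0 : ℝ) < N + 1 := by positivity
    have e1 : t * (k / (N + 1)) = k * t / (N + 1) := by ring
    have e2 : t * (((k + 1 : ℕ) : ℝ) / (N + 1)) = (k + 1 : ℕ) * t / (N + 1) := by ring
    have h1 := hs.1
    have h2 := hs.2
    simp only [hp, e1, e2] at h1 h2
    rw [div_lt_iff₀ hN] at h1
    rw [le_div_iff₀ hN] at h2
    refine ⟨?_, ?_⟩
    · rw [lt_div_iff₀ ht0]; simpa using h1
    · rw [div_le_iff₀ ht0]; exact h2
  have hple : ∀ N k, p N k ≤ p N (k + 1) := fun N k => by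
    simp only [hp]; gcongr; simp
  have hstep : ∀ N k, k < N + 1 → EqOn (fun s => n s (p N (k + 1)) + n s (p N k)) (F N)
      (Ioc (p N k) (p N (k + 1))) := fun N k _ s hs => by
    simp only [hF, hr, hl, hceil N k s hs, Nat.add_sub_cancel]
  have hFi : ∀ N k, k < N + 1 → IntervalIntegrable (F N) volume (p N k) (p N (k + 1)) :=
    fun N k hk => by
      refine ((hnint' _ (hpmemT N (k + 1) hk) _ (hpmemT N k hk.le) _ (hpmemT N (k + 1) hk)).add
        (hnint' _ (hpmemT N k hk.le) _ (hpmemT N k hk.le) _ (hpmemT N (k + 1) hk))).congr ?_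
      rw [uIoc_of_le (hple N k)]
      exact hstep N k hk
  -- With `p` and `q` consecutive nodes, symmetry gives `b(q,q) - b(p,p) = (b(q,q) - b(p,q)) +
  -- (b(q,p) - b(p,p))`, a sum of increments in the first variable only.
  have hFint : ∀ N k, k < N + 1 → ∫ s in (p N k)..(p N (k + 1)), F N s =
      b (p N (k + 1)) (p N (k + 1)) - b (p N k) (p N k) := by
    intro N k hk
    rw [intervalIntegral.integral_congr_ae (g := fun s => n s (p N (k + 1)) + n s (p N k)),
      intervalIntegral.integral_add
        (hnint' _ (hpmemT N (k + 1) hk) _ (hpmemT N k hk.le) _ (hpmemT N (k + 1) hk))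
        (hnint' _ (hpmemT N k hk.le) _ (hpmemT N k hk.le) _ (hpmemT N (k + 1) hk)),
      ← hb' _ (hpmemT N (k + 1) hk) _ (hpmemT N k hk.le) _ (hpmemT N (k + 1) hk),
      ← hb' _ (hpmemT N k hk.le) _ (hpmemT N k hk.le) _ (hpmemT N (k + 1) hk),
      hsymm (p N k) (p N (k + 1))]
    · ring
    · rw [uIoc_of_le (hple N k)]
      exact ae_of_all _ fun s hs => (hstep N k hk hs).symm
  have hp0 : ∀ N, p N 0 = 0 := fun N => by simp [hp]
  have hpN : ∀ N, p N (N + 1) = t := fun N => by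
    simp only [hp]; push_cast; rw [div_self (by positivity), mul_one]
  have hFall : ∀ N, IntervalIntegrable (F N) volume 0 t := fun N => by
    have := IntervalIntegrable.trans_iterate fun k hk => hFi N k hk
    rwa [hp0, hpN] at this
  have hFsum : ∀ N, ∫ s in (0 : ℝ)..t, F N s = b t t - b 0 0 := fun N => by
    have := intervalIntegral.sum_integral_adjacent_intervals fun k hk => hFi N k hk
    rw [hp0, hpN] at this
    rw [← this, Finset.sum_congr rfl fun k hk => hFint N k (Finset.mem_range.1 hk),
      Finset.sum_range_sub (fun k => b (p N k) (p N k)), hp0, hpN]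
  have hceil_le : ∀ (N : ℕ) (s : ℝ), s ∈ Ioc 0 t → ⌈s * (N + 1) / t⌉₊ ≤ N + 1 := fun N s hs => by
    rw [Nat.ceil_le, div_le_iff₀ ht0]
    push_cast
    nlinarith [hs.2, (by positivity : (0 : ℝ) ≤ N + 1)]
  have hrmem : ∀ N s, s ∈ Ioc 0 t → r N s ∈ Icc 0 T := fun N s hs => hpmemT N _ (hceil_le N s hs)
  have hlmem : ∀ N s, s ∈ Ioc 0 t → l N s ∈ Icc 0 T := fun N s hs =>
    hpmemT N _ ((Nat.sub_le _ _).trans (hceil_le N s hs))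
  have hlr : ∀ N s, s ∈ Ioc 0 t → |r N s - s| ≤ t * (1 / (N + 1)) ∧
      |l N s - s| ≤ t * (1 / (N + 1)) := by
    intro N s hs
    have hN : (0 : ℝ) < N + 1 := by positivity
    have hx : 0 < s * (N + 1) / t := by have := hs.1; positivity
    have h1 := Nat.le_ceil (s * (N + 1) / t)
    have h2 := Nat.ceil_lt_add_one hx.le
    have h3 : 1 ≤ ⌈s * (N + 1) / t⌉₊ := Nat.one_le_ceil_iff.2 hx
    have e : s = t * ((s * (N + 1) / t) / (N + 1)) := by field_simp
    set c := ⌈s * (N + 1) / t⌉₊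
    set x := s * (N + 1) / t
    have er : r N s - s = t * ((c - x) / (N + 1)) := by
      have : r N s = t * (c / (N + 1)) := rfl
      linear_combination this - e
    have el : l N s - s = t * ((c - 1 - x) / (N + 1)) := by
      have : l N s = t * ((c - 1 : ℕ) / (N + 1)) := rfl
      rw [Nat.cast_sub h3] at this
      push_cast at this
      linear_combination this - e
    rw [er, el, abs_mul, abs_mul, abs_div, abs_div, abs_of_pos ht0, abs_of_pos hN]
    refine ⟨?_, ?_⟩
    · gcongr; rw [abs_le]; constructor <;> linarith
    · gcongr; rw [abs_le]; constructor <;> linarith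
  have hto : Tendsto (fun N : ℕ => t * (1 / ((N : ℝ) + 1))) atTop (𝓝 0) := by
    simpa using tendsto_one_div_add_atTop_nhds_zero_nat.const_mul t
  have hmt : IntervalIntegrable (fun s => 2 * m s) volume 0 t := by
    rw [intervalIntegrable_iff_integrableOn_Ioc_of_le ht0.le]
    exact (hm.mono_measure hle).const_mul 2
  -- The first argument of `n` is kept equal to `s` and only the second sits at a node. Continuity
  -- in that second argument is thus enough.
  have hlim : ∀ᵐ s ∂(volume.restrict (Ioc 0 t)), Tendsto (fun N => F N s) atTop
      (𝓝 (2 * n s s)) := by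
    filter_upwards [ae_mono hle hcont, ae_restrict_mem measurableSet_Ioc] with s hs hst
    have hsT : s ∈ Icc 0 T := ⟨hst.1.le, hst.2.trans ht.2⟩
    have htr : ∀ q : ℕ → ℝ, (∀ N, q N ∈ Icc 0 T) → (∀ N : ℕ, |q N - s| ≤ t * (1 / ((N : ℝ) + 1))) →
        Tendsto (fun N => n s (q N)) atTop (𝓝 (n s s)) := fun q hq1 hq2 =>
      (hs s hsT).tendsto.comp (tendsto_nhdsWithin_iff.2 ⟨tendsto_iff_dist_tendsto_zero.2
        (squeeze_zero (fun _ => dist_nonneg) (fun N => by rw [Real.dist_eq]; exact hq2 N) hto),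
        Eventually.of_forall hq1⟩)
    rw [two_mul]
    exact (htr _ (fun N => hrmem N s hst) fun N => (hlr N s hst).1).add
      (htr _ (fun N => hlmem N s hst) fun N => (hlr N s hst).2)
  have hFmeas : ∀ N, AEStronglyMeasurable (F N) (volume.restrict (Ioc 0 t)) := fun N =>
    ((intervalIntegrable_iff_integrableOn_Ioc_of_le ht0.le).1 (hFall N)).1
  -- Measurability of the diagonal is not a hypothesis; it is inherited from the approximations `F
  -- N`.
  have hdiag : IntegrableOn (fun s => n s s) (Ioc 0 t) := by
    have h1 : AEStronglyMeasurable (fun s => 2 * n s s) (volume.restrict (Ioc 0 t)) :=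
      aestronglyMeasurable_of_tendsto_ae atTop hFmeas hlim
    have h2 : AEStronglyMeasurable (fun s => n s s) (volume.restrict (Ioc 0 t)) := by
      simpa using h1.const_mul (2⁻¹ : ℝ)
    refine (hm.mono_measure hle).mono' h2 ?_
    filter_upwards [ae_mono hle hbound, ae_restrict_mem measurableSet_Ioc] with s hs hst
    exact hs s ⟨hst.1.le, hst.2.trans ht.2⟩
  refine ⟨hdiag, ?_⟩
  have hconv := intervalIntegral.tendsto_integral_filter_of_dominated_convergence
    (μ := volume) (a := 0) (b := t) (F := F) (l := atTop) (f := fun s => 2 * n s s)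
    (fun s => 2 * m s)
    (Eventually.of_forall fun N => by rw [uIoc_of_le ht0.le]; exact hFmeas N)
    (Eventually.of_forall fun N => by
      rw [uIoc_of_le ht0.le, ← ae_restrict_iff' measurableSet_Ioc]
      filter_upwards [ae_mono hle hbound, ae_restrict_mem measurableSet_Ioc] with s hs hst
      refine (norm_add_le _ _).trans ?_
      rw [two_mul]
      exact add_le_add (hs _ (hrmem N s hst)) (hs _ (hlmem N s hst)))
    hmt (by rw [uIoc_of_le ht0.le, ← ae_restrict_iff' measurableSet_Ioc]; exact hlim)
  simp only [hFsum] at hconv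
  rw [← intervalIntegral.integral_const_mul]
  exact tendsto_nhds_unique tendsto_const_nhds hconv

/-! ### Elementary properties of Leray–Hopf solutions -/

section Slices

variable {X F : Type*} [MeasurableSpace X] {μ : Measure X} [NormedAddCommGroup F]

/-- The `L^q` norm of the slices of a jointly measurable function is measurable. -/
lemma aemeasurable_eLpNorm_slice {f : X → E3 → F}
    (hf : AEStronglyMeasurable (fun z : X × E3 => f z.1 z.2) (μ.prod volume)) (q : ℝ≥0∞) :
    AEMeasurable (fun t => eLpNorm (f t) q volume) μ := by
  obtain ⟨f', hf', hff'⟩ := hf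
  have hae : ∀ᵐ t ∂μ, eLpNorm (f t) q volume = eLpNorm (fun x => f' (t, x)) q volume := by
    filter_upwards [Measure.ae_ae_of_ae_prod hff'] with t ht using eLpNorm_congr_ae ht
  suffices h : Measurable (fun t => eLpNorm (fun x => f' (t, x)) q volume) from ⟨_, h, hae⟩
  have hm : Measurable (fun z => ‖f' z‖ₑ) := hf'.enorm
  rcases eq_or_ne q 0 with rfl | hq0
  · simp only [eLpNorm_exponent_zero, measurable_const]
  rcases eq_or_ne q ⊤ with rfl | hqt
  · simp only [eLpNorm_exponent_top, eLpNormEssSup]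
    -- An essential supremum is at most `c` exactly when the corresponding section of `{c < ‖f'‖}`
    -- is null, and measures of sections depend measurably on `t`.
    refine measurable_of_Iic fun c => ?_
    have hset : MeasurableSet {z : X × E3 | c < ‖f' z‖ₑ} := measurableSet_lt measurable_const hm
    have e : (fun t => essSup (fun x => ‖f' (t, x)‖ₑ) volume) ⁻¹' Iic c =
        {t | volume (Prod.mk t ⁻¹' {z : X × E3 | c < ‖f' z‖ₑ}) = 0} := by
      ext t
      have h1 : volume (Prod.mk t ⁻¹' {z : X × E3 | c < ‖f' z‖ₑ}) = 0 ↔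
          ∀ᵐ x, ‖f' (t, x)‖ₑ ≤ c := by
        rw [ae_iff]
        simp only [not_le]
        rfl
      rw [Set.mem_ofPred_eq, h1, mem_preimage, mem_Iic]
      exact ⟨fun h => (ENNReal.ae_le_essSup _).mono fun x hx => hx.trans h,
        fun h => essSup_le_of_ae_le _ h⟩
    rw [e]
    exact measurable_measure_prodMk_left hset (measurableSet_singleton 0)
  · simp only [eLpNorm_eq_lintegral_rpow_enorm_toReal hq0 hqt]
    exact (Measurable.lintegral_prod_right' (hm.pow_const _)).pow_const _

end Slices

section Coordinates

variable {X ι : Type*} [MeasurableSpace X] {μ : Measure X}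

lemma aestronglyMeasurable_coord {f : X → EuclideanSpace ℝ ι} (hf : AEStronglyMeasurable f μ)
    (i : ι) : AEStronglyMeasurable (fun x => f x i) μ :=
  (EuclideanSpace.proj (𝕜 := ℝ) i).continuous.comp_aestronglyMeasurable hf

lemma eLpNorm_coord_le [Fintype ι] (f : X → EuclideanSpace ℝ ι) (p : ℝ≥0∞) (i : ι) :
    eLpNorm (fun x => f x i) p μ ≤ eLpNorm f p μ :=
  eLpNorm_mono fun x => PiLp.norm_apply_le (f x) i

end Coordinates

lemma eLpNorm_two_sq {F : Type*} [NormedAddCommGroup F] {f : E3 → F} (hf : MemLp f 2 volume) :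
    eLpNorm f 2 volume ^ 2 = ENNReal.ofReal (∫ x, ‖f x‖ ^ 2) := by
  rw [hf.eLpNorm_eq_integral_rpow_norm (by norm_num) (by norm_num), ← ENNReal.ofReal_pow
    (by positivity)]
  congr 1
  rw [← Real.rpow_natCast, ← Real.rpow_mul (by positivity)]
  simp

lemma integrable_inner {v w : E3 → E3} (hv : MemLp v 2 volume) (hw : MemLp w 2 volume) :
    Integrable (fun x => inner ℝ (v x) (w x)) := by
  simp only [inner_eq_sum]
  exact integrable_finsetSum _ fun i _ => (memLp_apply hv i).integrable_mul (memLp_apply hw i)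

lemma integral_inner_eq_sum {v w : E3 → E3} (hv : MemLp v 2 volume) (hw : MemLp w 2 volume) :
    ∫ x, inner ℝ (v x) (w x) = ∑ i, ∫ x, v x i * w x i := by
  simp only [inner_eq_sum]
  exact integral_finsetSum _ fun i _ => (memLp_apply hv i).integrable_mul (memLp_apply hw i)

namespace IsLerayHopf

variable {T : ℝ} {u₀ : E3 → E3} {u : ℝ → E3 → E3}
  {Du : ℝ → E3 → EuclideanSpace ℝ (Fin 3 × Fin 3)}

/-- The energy inequality enters the proof through this bound. It holds at every time, not merely
almost every one, which is needed because test fields are slices at prescribed times. -/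
lemma eLpNorm_le_init (hu : IsLerayHopf T u₀ u Du) {t : ℝ} (ht : t ∈ Icc 0 T) :
    eLpNorm (u t) 2 volume ≤ eLpNorm u₀ 2 volume := by
  have h := hu.energy_inequality t ht
  have h0 : 0 ≤ ∫ s in Ioo 0 t, ∫ x, ‖Du s x‖ ^ 2 :=
    integral_nonneg fun s => integral_nonneg fun x => by positivity
  rw [← ENNReal.pow_le_pow_left_iff two_ne_zero, eLpNorm_two_sq (hu.memLp t ht),
    eLpNorm_two_sq hu.init_memLp]
  exact ENNReal.ofReal_le_ofReal (by linarith)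

lemma ae_mem_Icc : ∀ᵐ t ∂(volume.restrict (Ioo 0 T)), t ∈ Icc 0 T := by
  filter_upwards [ae_restrict_mem measurableSet_Ioo] with t ht using Ioo_subset_Icc_self ht

lemma aemeasurable_grad (hu : IsLerayHopf T u₀ u Du) :
    AEMeasurable (fun t => eLpNorm (Du t) 2 volume) (volume.restrict (Ioo 0 T)) :=
  aemeasurable_eLpNorm_slice hu.grad_class.1 2

lemma lintegral_grad_sq (hu : IsLerayHopf T u₀ u Du) :
    ∫⁻ t in Ioo 0 T, eLpNorm (Du t) 2 volume ^ 2 < ⊤ := by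
  have h := hu.grad_class.2
  rw [eLpNorm_lt_top_iff_lintegral_rpow_enorm_lt_top (by norm_num) (by norm_num)] at h
  simpa using h

lemma ae_memLp_grad (hu : IsLerayHopf T u₀ u Du) :
    ∀ᵐ t ∂(volume.restrict (Ioo 0 T)), MemLp (Du t) 2 volume := by
  have h := ae_lt_top' (hu.aemeasurable_grad.pow_const 2) hu.lintegral_grad_sq.ne
  filter_upwards [h, hu.grad_class.1.prodMk_left] with t h1 h2
  exact ⟨h2, by simpa using h1⟩

lemma ae_isSolenoidalH1 (hu : IsLerayHopf T u₀ u Du) :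
    ∀ᵐ t ∂(volume.restrict (Ioo 0 T)),
      IsSolenoidalH1 (fun i x => u t x i) (fun i j x => Du t x (i, j)) := by
  filter_upwards [hu.ae_memLp_grad, hu.weak_gradient, hu.div_free, ae_mem_Icc] with t h1 h2 h3 ht
  have hm := hu.memLp t ht
  refine ⟨fun i => ⟨memLp_apply hm i, fun j => memLp_apply h1 (i, j),
    fun j φ hφ hφc => h2 φ hφ hφc i j⟩, fun φ hφ hφc => ?_⟩
  have := h3 φ hφ hφc
  rwa [integral_finsetSum] at this
  exact fun i _ => (memLp_apply hm i).integrable_mul (q := 2)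
    (memLp_of_hasCompactSupport (contDiff_pd i hφ).continuous (hasCompactSupport_pd i hφc))

/-- Incompressibility is assumed at almost every time; weak continuity extends it to every time, so
that each slice, the initial one included, can be approximated by test fields. -/
lemma isWeaklyDivFree (hu : IsLerayHopf T u₀ u Du) (hT : 0 < T) {t : ℝ} (ht : t ∈ Icc 0 T) :
    IsWeaklyDivFree (u t) := by
  intro φ hφ hφc
  have hc := hu.weak_continuous _ (memLp_gradField hφ hφc)
  have h0 : EqOn (fun t => ∫ x, inner ℝ (u t x) (gradField φ x)) (fun _ => 0) (Icc 0 T) := by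
    refine Measure.eqOn_Icc_of_ae_eq (μ := volume) hT.ne ?_ hc continuousOn_const
    rw [Measure.restrict_congr_set Ioo_ae_eq_Icc.symm]
    filter_upwards [hu.div_free] with s hs
    have := hs φ hφ hφc
    simpa only [inner_eq_sum, gradField] using this
  have := h0 ht
  simpa only [inner_eq_sum, gradField] using this

end IsLerayHopf

/-! ### The stress tensor and the momentum equation -/

/-- The tensor `v ⊗ v - ∇v`. -/
def stress (v : E3 → E3) (D : E3 → EuclideanSpace ℝ (Fin 3 × Fin 3)) (i j : Fin 3) (x : E3) : ℝ :=
  v x i * v x j - D x (i, j)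

/-- The quadratic part lies in `L¹` and is paired in `L^∞`, the gradient is paired in `L²`. The
resulting bound is integrable in time for solutions in the energy class alone. -/
lemma enorm_integral_stress_mul_le {v : E3 → E3} {D : E3 → EuclideanSpace ℝ (Fin 3 × Fin 3)}
    (hv : MemLp v 2 volume) (hD : MemLp D 2 volume) {W : E3 → ℝ} (hW : MemLp W 2 volume)
    (hWt : MemLp W ⊤ volume) (i j : Fin 3) :
    ‖∫ x, stress v D i j x * W x‖ₑ ≤ (eLpNorm W ⊤ volume + eLpNorm W 2 volume) *
      (eLpNorm v 2 volume ^ 2 + eLpNorm D 2 volume) := by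
  have h11 : MemLp (fun x => v x i * v x j) 1 volume :=
    memLp_one_iff_integrable.2 ((memLp_apply hv i).integrable_mul (memLp_apply hv j))
  have i1 : Integrable (fun x => (v x i * v x j) * W x) := h11.integrable_mul hWt
  have i2 : Integrable (fun x => D x (i, j) * W x) := (memLp_apply hD (i, j)).integrable_mul hW
  have e : ∫ x, stress v D i j x * W x =
      (∫ x, (v x i * v x j) * W x) - ∫ x, D x (i, j) * W x := by
    rw [← integral_sub i1 i2]
    simp only [stress, sub_mul]
  rw [e]
  refine (enorm_sub_le).trans ?_
  have b1 : ‖∫ x, (v x i * v x j) * W x‖ₑ ≤ eLpNorm v 2 volume ^ 2 * eLpNorm W ⊤ volume := by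
    refine (enorm_integral_mul_le 1 ⊤ h11.1 hWt.1).trans (mul_le_mul' ?_ le_rfl)
    refine (eLpNorm_mul_le 2 2 1 (memLp_apply hv i).1 (memLp_apply hv j).1).trans ?_
    rw [pow_two]
    exact mul_le_mul' (eLpNorm_coord_le v 2 i) (eLpNorm_coord_le v 2 j)
  have b2 : ‖∫ x, D x (i, j) * W x‖ₑ ≤ eLpNorm D 2 volume * eLpNorm W 2 volume :=
    (enorm_integral_mul_le 2 2 (memLp_apply hD (i, j)).1 hW.1).trans
      (mul_le_mul' (eLpNorm_coord_le D 2 _) le_rfl)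
  refine (add_le_add b1 b2).trans ?_
  calc _ ≤ (eLpNorm W ⊤ volume + eLpNorm W 2 volume) * eLpNorm v 2 volume ^ 2 +
        (eLpNorm W ⊤ volume + eLpNorm W 2 volume) * eLpNorm D 2 volume := by
        rw [mul_comm (eLpNorm v 2 volume ^ 2), mul_comm (eLpNorm D 2 volume)]
        exact add_le_add (mul_le_mul' le_self_add le_rfl) (mul_le_mul' le_add_self le_rfl)
    _ = _ := (mul_add _ _ _).symm

/-- The pairing `∑ᵢⱼ ∫ (vᵢ vⱼ - ∂ⱼvᵢ) Wᵢⱼ`. -/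
def stressPairing (v : E3 → E3) (D : E3 → EuclideanSpace ℝ (Fin 3 × Fin 3))
    (W : Fin 3 → Fin 3 → E3 → ℝ) : ℝ :=
  ∑ i, ∑ j, ∫ x, stress v D i j x * W i j x

lemma enorm_stressPairing_le {v : E3 → E3} {D : E3 → EuclideanSpace ℝ (Fin 3 × Fin 3)}
    (hv : MemLp v 2 volume) (hD : MemLp D 2 volume) {W : Fin 3 → Fin 3 → E3 → ℝ}
    (hW : ∀ i j, MemLp (W i j) 2 volume) (hWt : ∀ i j, MemLp (W i j) ⊤ volume) :
    ‖stressPairing v D W‖ₑ ≤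
      (∑ i, ∑ j, (eLpNorm (W i j) ⊤ volume + eLpNorm (W i j) 2 volume)) *
      (eLpNorm v 2 volume ^ 2 + eLpNorm D 2 volume) := by
  simp only [stressPairing, Finset.sum_mul]
  refine (enorm_sum_le _ _).trans (Finset.sum_le_sum fun i _ => (enorm_sum_le _ _).trans
    (Finset.sum_le_sum fun j _ => enorm_integral_stress_mul_le hv hD (hW i j) (hWt i j) i j))

/-- The components of the gradient of a vector field. -/
def gradMatrix (w : E3 → E3) (i j : Fin 3) : E3 → ℝ := pd j (fun y => w y i)

namespace IsLerayHopf

variable {T : ℝ} {u₀ : E3 → E3} {u : ℝ → E3 → E3}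
  {Du : ℝ → E3 → EuclideanSpace ℝ (Fin 3 × Fin 3)}

lemma aestronglyMeasurable_stressPairing (hu : IsLerayHopf T u₀ u Du)
    {W : Fin 3 → Fin 3 → E3 → ℝ} (hW : ∀ i j, AEStronglyMeasurable (W i j) volume) :
    AEStronglyMeasurable (fun s => stressPairing (u s) (Du s) W) (volume.restrict (Ioo 0 T)) := by
  refine Finset.aestronglyMeasurable_fun_sum _ fun i _ =>
    Finset.aestronglyMeasurable_fun_sum _ fun j _ => ?_
  have h := fun i => aestronglyMeasurable_coord hu.energy_class.1 i
  have hD := aestronglyMeasurable_coord hu.grad_class.1 (i, j)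
  exact AEStronglyMeasurable.integral_prod_right'
    (f := fun z : ℝ × E3 => stress (u z.1) (Du z.1) i j z.2 * W i j z.2)
    ((((h i).mul (h j)).sub hD).mul (hW i j).comp_snd)

/-- A time-integrable majorant of the stress tensor. -/
def stressBound (u₀ : E3 → E3) (Du : ℝ → E3 → EuclideanSpace ℝ (Fin 3 × Fin 3)) (s : ℝ) : ℝ≥0∞ :=
  eLpNorm u₀ 2 volume ^ 2 + eLpNorm (Du s) 2 volume

lemma aemeasurable_stressBound (hu : IsLerayHopf T u₀ u Du) :
    AEMeasurable (stressBound u₀ Du) (volume.restrict (Ioo 0 T)) :=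
  hu.aemeasurable_grad.const_add _

lemma lintegral_grad (hu : IsLerayHopf T u₀ u Du) :
    ∫⁻ t in Ioo 0 T, eLpNorm (Du t) 2 volume < ⊤ := by
  have h : ∀ t, eLpNorm (Du t) 2 volume ≤ 1 + eLpNorm (Du t) 2 volume ^ 2 := fun t => by
    rcases le_total (eLpNorm (Du t) 2 volume) 1 with h | h
    · exact h.trans le_self_add
    · exact (le_self_pow₀ h two_ne_zero).trans le_add_self
  refine (lintegral_mono h).trans_lt ?_
  rw [lintegral_add_left measurable_const]
  exact ENNReal.add_lt_top.2 ⟨by simp, hu.lintegral_grad_sq⟩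

lemma lintegral_stressBound (hu : IsLerayHopf T u₀ u Du) :
    ∫⁻ t in Ioo 0 T, stressBound u₀ Du t ≠ ⊤ := by
  simp only [stressBound]
  rw [lintegral_add_left measurable_const]
  refine (ENNReal.add_lt_top.2 ⟨?_, hu.lintegral_grad⟩).ne
  simp only [lintegral_const, Measure.restrict_apply MeasurableSet.univ, univ_inter]
  exact ENNReal.mul_lt_top (ENNReal.pow_lt_top hu.init_memLp.2) (by simp)

/-- The exceptional set of times is fixed before `W`. The bound then holds simultaneously for the
test fields built from all slices `u(t')`, as the diagonal argument requires. -/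
lemma ae_enorm_stressPairing_le (hu : IsLerayHopf T u₀ u Du) :
    ∀ᵐ s ∂(volume.restrict (Ioo 0 T)), ∀ W : Fin 3 → Fin 3 → E3 → ℝ,
      (∀ i j, MemLp (W i j) 2 volume) → (∀ i j, MemLp (W i j) ⊤ volume) →
      ‖stressPairing (u s) (Du s) W‖ₑ ≤
        (∑ i, ∑ j, (eLpNorm (W i j) ⊤ volume + eLpNorm (W i j) 2 volume)) *
          stressBound u₀ Du s := by
  filter_upwards [hu.ae_memLp_grad, ae_mem_Icc] with s h1 hs W hW hWt
  refine (enorm_stressPairing_le (hu.memLp s hs) h1 hW hWt).trans (mul_le_mul' le_rfl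
    (add_le_add (pow_le_pow_left' (hu.eLpNorm_le_init hs) 2) le_rfl))

lemma ae_norm_stressPairing_le (hu : IsLerayHopf T u₀ u Du) {C : ℝ≥0∞} (hC : C ≠ ⊤) :
    ∀ᵐ s ∂(volume.restrict (Ioo 0 T)), ∀ W : Fin 3 → Fin 3 → E3 → ℝ,
      (∀ i j, MemLp (W i j) 2 volume) → (∀ i j, MemLp (W i j) ⊤ volume) →
      ∑ i, ∑ j, (eLpNorm (W i j) ⊤ volume + eLpNorm (W i j) 2 volume) ≤ C →
      |stressPairing (u s) (Du s) W| ≤ (C * stressBound u₀ Du s).toReal := by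
  filter_upwards [hu.ae_enorm_stressPairing_le, ae_lt_top' hu.aemeasurable_stressBound
    hu.lintegral_stressBound] with s h1 h2 W hW hWt hle
  have h3 := (h1 W hW hWt).trans (mul_le_mul' hle le_rfl)
  have h4 := ENNReal.toReal_mono (ENNReal.mul_ne_top hC h2.ne) h3
  simpa using h4

lemma integrable_const_mul_stressBound (hu : IsLerayHopf T u₀ u Du) {C : ℝ≥0∞} (hC : C ≠ ⊤) :
    IntegrableOn (fun s => (C * stressBound u₀ Du s).toReal) (Ioo 0 T) := by
  refine integrable_toReal_of_lintegral_ne_top (hu.aemeasurable_stressBound.const_mul C) ?_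
  rw [lintegral_const_mul' _ _ hC]
  exact ENNReal.mul_ne_top hC hu.lintegral_stressBound

lemma integrableOn_stressPairing (hu : IsLerayHopf T u₀ u Du) {W : Fin 3 → Fin 3 → E3 → ℝ}
    (hW : ∀ i j, MemLp (W i j) 2 volume) (hWt : ∀ i j, MemLp (W i j) ⊤ volume) :
    IntegrableOn (fun s => stressPairing (u s) (Du s) W) (Ioo 0 T) := by
  have hC : ∑ i, ∑ j, (eLpNorm (W i j) ⊤ volume + eLpNorm (W i j) 2 volume) ≠ ⊤ :=
    ENNReal.sum_ne_top.2 fun i _ => ENNReal.sum_ne_top.2 fun j _ =>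
      ENNReal.add_ne_top.2 ⟨(hWt i j).2.ne, (hW i j).2.ne⟩
  refine (hu.integrable_const_mul_stressBound hC).mono'
    (hu.aestronglyMeasurable_stressPairing fun i j => (hW i j).1) ?_
  filter_upwards [hu.ae_norm_stressPairing_le hC] with s hs using hs W hW hWt le_rfl

lemma isTestField {w : E3 → E3} (hw : IsSmoothSolenoidal w) {θ : ℝ → ℝ} (hθ : ContDiff ℝ ∞ θ)
    (hθc : HasCompactSupport θ) (hθT : tsupport θ ⊆ Iio T) :
    IsTestField T (fun t x => θ t • w x) where
  smooth := (hθ.comp contDiff_fst).smul (hw.smooth.comp contDiff_snd)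
  compact_support := by
    refine HasCompactSupport.intro (IsCompact.prod hθc hw.compact_support) fun z hz => ?_
    rw [mem_prod, not_and_or] at hz
    rcases hz with h | h
    · simp only [image_eq_zero_of_notMem_tsupport h, zero_smul]
    · simp only [image_eq_zero_of_notMem_tsupport h, smul_zero]
  support_lt := by
    have : tsupport (fun z : ℝ × E3 => θ z.1 • w z.2) ⊆ tsupport θ ×ˢ univ := by
      refine closure_minimal (fun z hz => ⟨subset_tsupport θ fun h0 => hz ?_, mem_univ _⟩)
        ((isClosed_tsupport θ).prod isClosed_univ)
      simp [h0]
    exact this.trans (prod_mono hθT subset_rfl)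
  div_free t x := by
    have h := congrArg (θ t * ·) (hw.div_free x)
    simp only [divergence, Finset.mul_sum, mul_zero] at h
    rw [← h, divergence]
    refine Finset.sum_congr rfl fun i _ => ?_
    have h1 := ((contDiff_apply_euclidean hw.smooth i).differentiable (by simp)) x
    simp [pd, fderiv_const_mul h1]

lemma integral_weakIntegrand {v : ℝ → E3 → E3} {D : ℝ → E3 → EuclideanSpace ℝ (Fin 3 × Fin 3)}
    {t : ℝ} (hv : MemLp (v t) 2 volume) (hD : MemLp (D t) 2 volume) {w : E3 → E3}
    (hw : IsSmoothSolenoidal w) {θ : ℝ → ℝ} (hθ : ContDiff ℝ ∞ θ) :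
    ∫ x, weakIntegrand v D (fun t x => θ t • w x) t x =
      deriv θ t * (∫ x, inner ℝ (v t x) (w x)) +
        θ t * stressPairing (v t) (D t) (gradMatrix w) := by
  have hws := fun i => contDiff_apply_euclidean hw.smooth i
  have hg : ∀ i j, ContDiff ℝ ∞ (gradMatrix w i j) := fun i j => contDiff_pd j (hws i)
  have hgc : ∀ i j, HasCompactSupport (gradMatrix w i j) := fun i j =>
    hasCompactSupport_pd j (hasCompactSupport_apply hw.compact_support i)
  have hint : ∀ i j, Integrable (fun x => stress (v t) (D t) i j x * gradMatrix w i j x) := by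
    intro i j
    have h11 : MemLp (fun x => v t x i * v t x j) 1 volume :=
      memLp_one_iff_integrable.2 ((memLp_apply hv i).integrable_mul (memLp_apply hv j))
    have i1 : Integrable (fun x => (v t x i * v t x j) * gradMatrix w i j x) :=
      h11.integrable_mul (q := ⊤) (memLp_of_hasCompactSupport (hg i j).continuous (hgc i j))
    have i2 : Integrable (fun x => D t x (i, j) * gradMatrix w i j x) :=
      (memLp_apply hD (i, j)).integrable_mul (q := 2)
        (memLp_of_hasCompactSupport (hg i j).continuous (hgc i j))
    simp only [stress, sub_mul]
    exact i1.sub i2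
  have e : ∀ x, weakIntegrand v D (fun t x => θ t • w x) t x =
      deriv θ t * inner ℝ (v t x) (w x) +
        θ t * ∑ i, ∑ j, stress (v t) (D t) i j x * gradMatrix w i j x := by
    intro x
    have e1 : ∀ i, deriv (fun s => (θ s • w x) i) t = deriv θ t * w x i := fun i => by
      simp only [PiLp.smul_apply, smul_eq_mul]
      exact deriv_mul_const ((hθ.differentiable (by simp)) t) _
    have e2 : ∀ i j, pd j (fun y => (θ t • w y) i) x = θ t * gradMatrix w i j x := fun i j => by
      simp [gradMatrix, pd, fderiv_const_mul (((hws i).differentiable (by simp)) x)]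
    simp only [weakIntegrand, e1, e2, inner_eq_sum, stress, Finset.mul_sum, sub_mul, mul_sub,
      Finset.sum_sub_distrib]
    rw [add_sub_assoc]
    congr 1
    · exact Finset.sum_congr rfl fun i _ => by ring
    · congr 1 <;>
        exact Finset.sum_congr rfl fun i _ => Finset.sum_congr rfl fun j _ => by ring
  simp only [e]
  rw [integral_add ((integrable_inner hv (hw.memLp 2)).const_mul _)
    ((integrable_finsetSum _ fun i _ => integrable_finsetSum _ fun j _ => hint i j).const_mul _),
    integral_const_mul, integral_const_mul, stressPairing,
    integral_finsetSum _ fun i _ => integrable_finsetSum _ fun j _ => hint i j]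
  congr 2
  exact Finset.sum_congr rfl fun i _ => integral_finsetSum _ fun j _ => hint i j

lemma memLp_gradMatrix {w : E3 → E3} (hw : IsSmoothSolenoidal w) (p : ℝ≥0∞) (i j : Fin 3) :
    MemLp (gradMatrix w i j) p volume :=
  memLp_of_hasCompactSupport (contDiff_pd j (contDiff_apply_euclidean hw.smooth i)).continuous
    (hasCompactSupport_pd j (hasCompactSupport_apply hw.compact_support i))

lemma intervalIntegrable_of_Ioo {f : ℝ → ℝ} (hT : 0 ≤ T) (hf : IntegrableOn f (Ioo 0 T)) :
    IntervalIntegrable f volume 0 T := by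
  rw [intervalIntegrable_iff_integrableOn_Ioc_of_le hT, IntegrableOn,
    ← Measure.restrict_congr_set Ioo_ae_eq_Ioc]
  exact hf

/-- The momentum equation, integrated in time, for a fixed smooth solenoidal field. -/
lemma integral_inner_eq (hu : IsLerayHopf T u₀ u Du) (hT : 0 < T) {w : E3 → E3}
    (hw : IsSmoothSolenoidal w) {t : ℝ} (ht : t ∈ Icc 0 T) :
    ∫ x, inner ℝ (u t x) (w x) = (∫ x, inner ℝ (u₀ x) (w x)) +
      ∫ s in (0 : ℝ)..t, stressPairing (u s) (Du s) (gradMatrix w) := by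
  refine eq_add_integral_of_weak_deriv hT (hu.weak_continuous w (hw.memLp 2))
    (intervalIntegrable_of_Ioo hT.le (hu.integrableOn_stressPairing
      (fun i j => memLp_gradMatrix hw 2 i j) fun i j => memLp_gradMatrix hw ⊤ i j))
    (fun θ hθ hθc hθT => ?_) t ht
  have h := hu.momentum _ (isTestField hw hθ hθc hθT)
  simp only [inner_smul_right, integral_const_mul] at h
  rw [← h]
  refine integral_congr_ae ?_
  filter_upwards [hu.ae_memLp_grad, ae_mem_Icc] with s h1 hs
  rw [integral_weakIntegrand (hu.memLp s hs) h1 hw hθ]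

end IsLerayHopf

/-! ### The mollified energy balance -/

/-- Componentwise mollification. -/
def mollify (l : ℝ) (v : E3 → E3) (x : E3) : E3 := WithLp.toLp 2 fun i => S l (fun y => v y i) x

/-- The gradient of a twice mollified field. -/
def mollifiedGrad (l : ℝ) (v : E3 → E3) (i j : Fin 3) : E3 → ℝ :=
  pd j (S l (S l fun y => v y i))

lemma memLp_toLp {w : Fin 3 → E3 → ℝ} {p : ℝ≥0∞} (hw : ∀ i, MemLp (w i) p volume) :
    MemLp (fun x => (WithLp.toLp 2 fun i => w i x : E3)) p volume := by
  have e : (fun x => (WithLp.toLp 2 fun i => w i x : E3)) =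
      ∑ i, fun x => w i x • EuclideanSpace.single i (1 : ℝ) := by
    ext x k
    simp [Finset.sum_apply, Pi.single_apply]
  rw [e]
  refine memLp_finsetSum' _ fun i _ => ?_
  exact (hw i).continuousLinearMap_comp
    (ContinuousLinearMap.toSpanSingleton ℝ (EuclideanSpace.single i (1 : ℝ)))

lemma memLp_mollify {l : ℝ} (hl : 0 < l) {v : E3 → E3} (hv : MemLp v 2 volume) :
    MemLp (mollify l v) 2 volume :=
  memLp_toLp fun i => memLp_S hl one_le_two (memLp_apply hv i)

lemma isSmoothSolenoidal_mollify {l : ℝ} (hl : 0 < l) {w : E3 → E3} (hw : IsSmoothSolenoidal w) :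
    IsSmoothSolenoidal (mollify l w) := by
  have hs := fun i => contDiff_apply_euclidean hw.smooth i
  have hc := fun i => hasCompactSupport_apply hw.compact_support i
  have hloc : ∀ i, LocallyIntegrable (fun x => w x i) := fun i =>
    (hs i).continuous.locallyIntegrable
  refine ⟨contDiff_toLp fun i => contDiff_S hl (hloc i), hasCompactSupport_toLp fun i => ?_,
    fun x => ?_⟩
  · rw [S, conv_eq_convolution]
    exact (hasCompactSupport_mol hl).convolution _ (hc i)
  · have e : ∀ i, pd i (fun y => mollify l w y i) x = S l (pd i fun y => w y i) x := fun i => by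
      rw [← pd_S hl (hloc i) (hasWeakDeriv_of_contDiff i (hs i))]
      rfl
    have hint : ∀ i, Integrable (fun y => mol l y * pd i (fun y => w y i) (x - y)) := fun i =>
      integrable_conv_integrand 2 2 (memLp_mol hl 2) (memLp_of_hasCompactSupport
        (contDiff_pd i (hs i)).continuous (hasCompactSupport_pd i (hc i))) x
    simp only [divergence, e, S, conv]
    rw [← integral_finsetSum _ fun i _ => hint i]
    simp only [← Finset.mul_sum]
    have h0 : ∀ y, ∑ i, pd i (fun y => w y i) (x - y) = 0 := fun y => hw.div_free (x - y)
    simp [h0]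

lemma integral_inner_mollify {l : ℝ} (hl : 0 < l) {v w : E3 → E3} (hv : MemLp v 2 volume)
    (hw : MemLp w 2 volume) :
    ∫ x, inner ℝ (mollify l v x) (w x) = ∫ x, inner ℝ (v x) (mollify l w x) := by
  rw [integral_inner_eq_sum (memLp_mollify hl hv) hw,
    integral_inner_eq_sum hv (memLp_mollify hl hw)]
  exact Finset.sum_congr rfl fun i _ => integral_S_mul hl 2 2 (memLp_apply hv i) (memLp_apply hw i)

lemma mollifiedGrad_eq {l : ℝ} (hl : 0 < l) {v : E3 → E3} (hv : MemLp v 2 volume) (i j : Fin 3) :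
    mollifiedGrad l v i j = conv (pd j (mol l)) (S l fun y => v y i) :=
  pd_conv j (contDiff_mol l) (hasCompactSupport_mol hl)
    ((memLp_S hl one_le_two (memLp_apply hv i)).locallyIntegrable (by norm_num))

lemma integrable_pd_mol {l : ℝ} (hl : 0 < l) (j : Fin 3) : Integrable (pd j (mol l)) :=
  memLp_one_iff_integrable.1 (memLp_pd_mol hl j 1)

lemma memLp_mollifiedGrad {l : ℝ} (hl : 0 < l) {v : E3 → E3} (hv : MemLp v 2 volume)
    (i j : Fin 3) : MemLp (mollifiedGrad l v i j) 2 volume := by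
  rw [mollifiedGrad_eq hl hv]
  exact memLp_conv one_le_two (integrable_pd_mol hl j)
    (memLp_S hl one_le_two (memLp_apply hv i))

lemma eLpNorm_S_coord_le {l : ℝ} (hl : 0 < l) {v : E3 → E3} (hv : MemLp v 2 volume) (i : Fin 3) :
    eLpNorm (S l fun y => v y i) 2 volume ≤ eLpNorm v 2 volume :=
  (eLpNorm_S_le hl one_le_two (memLp_apply hv i).1).trans (eLpNorm_coord_le v 2 i)

lemma eLpNorm_top_mollifiedGrad_le {l : ℝ} (hl : 0 < l) {v : E3 → E3} (hv : MemLp v 2 volume)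
    (i j : Fin 3) :
    eLpNorm (mollifiedGrad l v i j) ⊤ volume ≤
      eLpNorm (pd j (mol l)) 2 volume * eLpNorm v 2 volume := by
  rw [mollifiedGrad_eq hl hv, eLpNorm_exponent_top]
  refine essSup_le_of_ae_le _ (ae_of_all _ fun x => ?_)
  exact (enorm_conv_le 2 2 (memLp_pd_mol hl j 2).1
    (memLp_S hl one_le_two (memLp_apply hv i)).1 x).trans
      (mul_le_mul' le_rfl (eLpNorm_S_coord_le hl hv i))

lemma memLp_top_mollifiedGrad {l : ℝ} (hl : 0 < l) {v : E3 → E3} (hv : MemLp v 2 volume)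
    (i j : Fin 3) : MemLp (mollifiedGrad l v i j) ⊤ volume :=
  ⟨(memLp_mollifiedGrad hl hv i j).1, (eLpNorm_top_mollifiedGrad_le hl hv i j).trans_lt
    (ENNReal.mul_lt_top (memLp_pd_mol hl j 2).2 hv.2)⟩

/-- The operator norm constant of `v ↦ mollifiedGrad l v`. -/
def molConst (l : ℝ) : ℝ≥0∞ :=
  ∑ _i : Fin 3, ∑ j, (eLpNorm (pd j (mol l)) 2 volume + eLpNorm (pd j (mol l)) 1 volume)

lemma molConst_ne_top {l : ℝ} (hl : 0 < l) : molConst l ≠ ⊤ :=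
  ENNReal.sum_ne_top.2 fun _ _ => ENNReal.sum_ne_top.2 fun j _ =>
    ENNReal.add_ne_top.2 ⟨(memLp_pd_mol hl j 2).2.ne, (memLp_pd_mol hl j 1).2.ne⟩

lemma sum_eLpNorm_mollifiedGrad_le {l : ℝ} (hl : 0 < l) {v : E3 → E3} (hv : MemLp v 2 volume) :
    ∑ i, ∑ j, (eLpNorm (mollifiedGrad l v i j) ⊤ volume +
      eLpNorm (mollifiedGrad l v i j) 2 volume) ≤ molConst l * eLpNorm v 2 volume := by
  simp only [molConst, Finset.sum_mul, add_mul]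
  refine Finset.sum_le_sum fun i _ => Finset.sum_le_sum fun j _ =>
    add_le_add (eLpNorm_top_mollifiedGrad_le hl hv i j) ?_
  rw [mollifiedGrad_eq hl hv]
  exact (eLpNorm_conv_le one_le_two (memLp_pd_mol hl j 1).1
    (memLp_S hl one_le_two (memLp_apply hv i)).1).trans
      (mul_le_mul' le_rfl (eLpNorm_S_coord_le hl hv i))

/-- The mollified divergence of a tensor, the adjoint of `v ↦ mollifiedGrad l v`. -/
def mollifiedDiv (l : ℝ) (A : Fin 3 → Fin 3 → E3 → ℝ) (x : E3) : E3 :=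
  WithLp.toLp 2 fun i => ∑ j, S l (conv (fun y => pd j (mol l) (-y)) (A i j)) x

lemma memLp_conv_pd_mol_neg {l : ℝ} (hl : 0 < l) {f : E3 → ℝ} (hf : MemLp f 2 volume)
    (j : Fin 3) : MemLp (conv (fun y => pd j (mol l) (-y)) f) 2 volume :=
  memLp_conv one_le_two (integrable_pd_mol hl j).comp_neg hf

lemma memLp_mollifiedDiv {l : ℝ} (hl : 0 < l) {A : Fin 3 → Fin 3 → E3 → ℝ}
    (hA : ∀ i j, MemLp (A i j) 2 volume) : MemLp (mollifiedDiv l A) 2 volume :=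
  memLp_toLp fun i => memLp_finsetSum _ fun j _ =>
    memLp_S hl one_le_two (memLp_conv_pd_mol_neg hl (hA i j) j)

/-- Moving both mollifications and the derivative onto the stress exhibits the pairing as an `L²`
inner product with `z`. It is therefore continuous in `z`, and continuous in `t'` when `z` is the
weakly continuous slice `u(t')`. -/
lemma stressPairing_mollifiedGrad {l : ℝ} (hl : 0 < l) {v : E3 → E3}
    {D : E3 → EuclideanSpace ℝ (Fin 3 × Fin 3)} (hA : ∀ i j, MemLp (stress v D i j) 2 volume)
    {z : E3 → E3} (hz : MemLp z 2 volume) :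
    stressPairing v D (mollifiedGrad l z) =
      ∫ x, inner ℝ (z x) (mollifiedDiv l (stress v D) x) := by
  rw [integral_inner_eq_sum hz (memLp_mollifiedDiv hl hA), stressPairing]
  refine Finset.sum_congr rfl fun i _ => ?_
  have hzi := memLp_apply hz i
  have hc := fun j => memLp_conv_pd_mol_neg hl (hA i j) j
  have hint : ∀ j ∈ Finset.univ, Integrable (fun x => z x i *
      S l (conv (fun y => pd j (mol l) (-y)) (stress v D i j)) x) := fun j _ =>
    hzi.integrable_mul (memLp_S hl one_le_two (hc j))
  simp only [mollifiedDiv, Finset.mul_sum]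
  rw [integral_finsetSum _ hint]
  refine Finset.sum_congr rfl fun j _ => ?_
  rw [← integral_S_mul hl 2 2 hzi (hc j), ← integral_conv_mul 2 2 (integrable_pd_mol hl j)
    (memLp_S hl one_le_two hzi) (hA i j), ← mollifiedGrad_eq hl hz]
  simp only [mul_comm]

lemma tendsto_integral_inner {f v : E3 → E3} {w : ℕ → E3 → E3} (hf : MemLp f 2 volume)
    (hw : ∀ n, MemLp (w n) 2 volume) (hv : MemLp v 2 volume)
    (h : Tendsto (fun n => eLpNorm (fun x => w n x - v x) 2 volume) atTop (𝓝 0)) :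
    Tendsto (fun n => ∫ x, inner ℝ (f x) (w n x)) atTop (𝓝 (∫ x, inner ℝ (f x) (v x))) := by
  simp only [fun n => integral_inner_eq_sum hf (hw n), integral_inner_eq_sum hf hv]
  refine tendsto_finsetSum _ fun i _ => ?_
  refine tendsto_integral_mul 2 2 one_le_two (Eventually.of_forall fun n => memLp_apply hf i)
    (Eventually.of_forall fun n => memLp_apply (hw n) i) (memLp_apply hf i) (memLp_apply hv i)
    (by simp) ?_
  exact tendsto_of_tendsto_of_tendsto_of_le_of_le tendsto_const_nhds h (fun _ => zero_le)
    fun n => eLpNorm_coord_le (fun x => w n x - v x) 2 i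

/-- The resolved dissipation. -/
def dissipation (l : ℝ) (D : E3 → EuclideanSpace ℝ (Fin 3 × Fin 3)) : ℝ :=
  ∑ i, ∑ j, ∫ x, S l (fun y => D y (i, j)) x * S l (fun y => D y (i, j)) x

/-- The reason for mollifying twice: `S l` is self-adjoint, so one mollification moves to the stress
and one stays on the gradient. -/
lemma IsSolenoidalH1.stressPairing_self {v : E3 → E3}
    {D : E3 → EuclideanSpace ℝ (Fin 3 × Fin 3)}
    (h : IsSolenoidalH1 (fun i x => v x i) (fun i j x => D x (i, j))) {l : ℝ} (hl : 0 < l) :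
    stressPairing v D (mollifiedGrad l v) = flux l (fun i x => v x i) - dissipation l D := by
  rw [h.flux_eq hl, dissipation, stressPairing, ← Finset.sum_sub_distrib]
  refine Finset.sum_congr rfl fun i _ => ?_
  rw [← Finset.sum_sub_distrib]
  refine Finset.sum_congr rfl fun j _ => ?_
  have hi := h.isH1 i
  have hm := hi.mul_memLp_two (h.isH1 j)
  have hG := hi.grad_memLp j
  have hSG := memLp_S hl one_le_two hG
  have e : mollifiedGrad l v i j = S l (S l fun y => D y (i, j)) := by
    rw [mollifiedGrad, pd_S hl ((memLp_S hl one_le_two hi.memLp).locallyIntegrable (by norm_num))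
      (hasWeakDeriv_of_contDiff j (hi.contDiff_S hl)), hi.pd_S j hl]
  have hSSG := memLp_S hl one_le_two hSG
  have i1 : Integrable (fun x => (v x i * v x j) * S l (S l fun y => D y (i, j)) x) :=
    hm.integrable_mul hSSG
  have i2 : Integrable (fun x => D x (i, j) * S l (S l fun y => D y (i, j)) x) :=
    hG.integrable_mul hSSG
  rw [e, integral_S_mul hl 2 2 hm hSG, integral_S_mul hl 2 2 hG hSG, ← integral_sub i1 i2]
  simp only [stress, sub_mul]

/-- The resolved kinetic energy (times two). -/
def resolvedProduct (l : ℝ) (v w : E3 → E3) : ℝ :=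
  ∑ i, ∫ x, S l (fun y => v y i) x * S l (fun y => w y i) x

lemma integral_inner_mollify_mollify {l : ℝ} (hl : 0 < l) {v w : E3 → E3}
    (hv : MemLp v 2 volume) (hw : MemLp w 2 volume) :
    ∫ x, inner ℝ (v x) (mollify l (mollify l w) x) = resolvedProduct l v w := by
  rw [← integral_inner_mollify hl hv (memLp_mollify hl hw),
    integral_inner_eq_sum (memLp_mollify hl hv) (memLp_mollify hl hw)]
  rfl

namespace IsLerayHopf

variable {T : ℝ} {u₀ : E3 → E3} {u : ℝ → E3 → E3}
  {Du : ℝ → E3 → EuclideanSpace ℝ (Fin 3 × Fin 3)}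

lemma ae_memLp_stress (hu : IsLerayHopf T u₀ u Du) : ∀ᵐ s ∂(volume.restrict (Ioo 0 T)),
    ∀ i j, MemLp (stress (u s) (Du s) i j) 2 volume := by
  filter_upwards [hu.ae_isSolenoidalH1] with s hs i j
  exact ((hs.isH1 i).mul_memLp_two (hs.isH1 j)).sub ((hs.isH1 i).grad_memLp j)

/-- The momentum equation tested with a twice mollified solenoidal field. -/
lemma integral_inner_mollify_eq (hu : IsLerayHopf T u₀ u Du) (hT : 0 < T) {l : ℝ} (hl : 0 < l)
    {v : E3 → E3} (hv : MemLp v 2 volume) (hdiv : IsWeaklyDivFree v) {t : ℝ} (ht : t ∈ Icc 0 T) :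
    ∫ x, inner ℝ (u t x) (mollify l (mollify l v) x) =
      (∫ x, inner ℝ (u₀ x) (mollify l (mollify l v) x)) +
        ∫ s in (0 : ℝ)..t, stressPairing (u s) (Du s) (mollifiedGrad l v) := by
  -- The field `v` is solenoidal but need not be smooth or compactly supported. The `w n` give
  -- admissible test fields after mollification, and both sides of the identity are continuous in
  -- `v` for the `L²` norm.
  choose w hw hwv using fun n : ℕ => exists_smoothSolenoidal_approx hv hdiv
    (ε := ((n : ℝ≥0∞) + 1)⁻¹) (ENNReal.inv_pos.2 (by finiteness))
  have hw2 : ∀ n, MemLp (w n) 2 volume := fun n => (hw n).memLp 2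
  have hlim : Tendsto (fun n => eLpNorm (fun x => w n x - v x) 2 volume) atTop (𝓝 0) := by
    refine tendsto_of_tendsto_of_tendsto_of_le_of_le tendsto_const_nhds ?_ (fun _ => zero_le)
      fun n => (hwv n).le
    have := (ENNReal.tendsto_inv_nat_nhds_zero).comp (tendsto_add_atTop_nat 1)
    simpa [Function.comp_def] using this
  have hb : ∀ n, eLpNorm (w n) 2 volume ≤ eLpNorm v 2 volume + 1 := fun n => by
    have e : w n = (fun x => w n x - v x) + v := by ext x; simp
    calc eLpNorm (w n) 2 volume ≤ eLpNorm (fun x => w n x - v x) 2 volume + eLpNorm v 2 volume := by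
          conv_lhs => rw [e]
          exact eLpNorm_add_le ((hw2 n).1.sub hv.1) hv.1 one_le_two
      _ ≤ eLpNorm v 2 volume + 1 := by
          rw [add_comm]
          refine add_le_add le_rfl ((hwv n).le.trans ?_)
          exact ENNReal.inv_le_one.2 le_add_self
  have h2 : ∀ {f : E3 → E3}, MemLp f 2 volume → Tendsto
      (fun n => ∫ x, inner ℝ (f x) (mollify l (mollify l (w n)) x)) atTop
      (𝓝 (∫ x, inner ℝ (f x) (mollify l (mollify l v) x))) := by
    intro f hf
    have hf1 := memLp_mollify hl hf
    have e : ∀ {z : E3 → E3}, MemLp z 2 volume →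
        ∫ x, inner ℝ (f x) (mollify l (mollify l z) x) =
          ∫ x, inner ℝ (mollify l (mollify l f) x) (z x) := fun hz => by
      rw [integral_inner_mollify hl hf1 hz, integral_inner_mollify hl hf (memLp_mollify hl hz)]
    simp only [fun n => e (hw2 n), e hv]
    exact tendsto_integral_inner (memLp_mollify hl hf1) hw2 hv hlim
  -- For a.e. fixed time the pairing converges by the adjoint formula; the uniform norm bound `hb`
  -- supplies the majorant in time.
  have h3 : Tendsto (fun n => ∫ s in (0 : ℝ)..t,
      stressPairing (u s) (Du s) (mollifiedGrad l (w n))) atTop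
      (𝓝 (∫ s in (0 : ℝ)..t, stressPairing (u s) (Du s) (mollifiedGrad l v))) := by
    have hC : molConst l * (eLpNorm v 2 volume + 1) ≠ ⊤ :=
      ENNReal.mul_ne_top (molConst_ne_top hl) (ENNReal.add_ne_top.2 ⟨hv.2.ne, ENNReal.one_ne_top⟩)
    have hsub : Ioc 0 t ≤ᵐ[volume] Ioo 0 T :=
      (Ioc_subset_Ioc_right ht.2).eventuallyLE.trans Ioo_ae_eq_Ioc.symm.le
    have hle := Measure.restrict_mono_ae hsub
    simp only [intervalIntegral.integral_of_le ht.1]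
    refine tendsto_integral_of_dominated_convergence _ (fun n =>
      (hu.aestronglyMeasurable_stressPairing
        fun i j => (memLp_mollifiedGrad hl (hw2 n) i j).1).mono_measure hle)
      (Integrable.mono_measure (hu.integrable_const_mul_stressBound hC) hle) (fun n => ?_) ?_
    · filter_upwards [ae_mono hle (hu.ae_norm_stressPairing_le hC)] with s hs
      exact hs _ (memLp_mollifiedGrad hl (hw2 n)) (memLp_top_mollifiedGrad hl (hw2 n))
        ((sum_eLpNorm_mollifiedGrad_le hl (hw2 n)).trans (mul_le_mul' le_rfl (hb n)))
    · filter_upwards [ae_mono hle hu.ae_memLp_stress] with s hs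
      have e : ∀ z : E3 → E3, MemLp z 2 volume → stressPairing (u s) (Du s) (mollifiedGrad l z) =
          ∫ x, inner ℝ (mollifiedDiv l (stress (u s) (Du s)) x) (z x) := fun z hz => by
        rw [stressPairing_mollifiedGrad hl hs hz]
        exact integral_congr_ae (ae_of_all _ fun x => real_inner_comm _ _)
      simp only [fun n => e _ (hw2 n), e _ hv]
      exact tendsto_integral_inner (memLp_mollifiedDiv hl hs) hw2 hv hlim
  refine tendsto_nhds_unique (h2 (hu.memLp t ht)) ?_
  have heq : ∀ n, ∫ x, inner ℝ (u t x) (mollify l (mollify l (w n)) x) =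
      (∫ x, inner ℝ (u₀ x) (mollify l (mollify l (w n)) x)) +
        ∫ s in (0 : ℝ)..t, stressPairing (u s) (Du s) (mollifiedGrad l (w n)) := fun n =>
    hu.integral_inner_eq hT (isSmoothSolenoidal_mollify hl (isSmoothSolenoidal_mollify hl (hw n))) ht
  simp only [heq]
  exact (h2 hu.init_memLp).add h3

/-- The energy balance of the mollified solution. -/
lemma resolved_energy_balance (hu : IsLerayHopf T u₀ u Du) (hT : 0 < T) {l : ℝ} (hl : 0 < l)
    {t : ℝ} (ht : t ∈ Icc 0 T) :
    IntegrableOn (fun s => flux l (fun i x => u s x i) - dissipation l (Du s)) (Ioc 0 t) ∧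
    resolvedProduct l (u t) (u t) - resolvedProduct l (u 0) (u 0) =
      2 * ∫ s in (0 : ℝ)..t, (flux l (fun i x => u s x i) - dissipation l (Du s)) := by
  have h0 : (0 : ℝ) ∈ Icc 0 T := ⟨le_rfl, hT.le⟩
  have hC : molConst l * eLpNorm u₀ 2 volume ≠ ⊤ :=
    ENNReal.mul_ne_top (molConst_ne_top hl) hu.init_memLp.2.ne
  -- For fixed `t'`, the identity in the first time variable is the momentum equation tested with
  -- the twice mollified slice at `t'`. The symmetry is that of the resolved inner product.
  have hmain := sub_eq_two_mul_integral_diag (T := T)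
    (b := fun s t => resolvedProduct l (u s) (u t))
    (n := fun s t => stressPairing (u s) (Du s) (mollifiedGrad l (u t)))
    (m := fun s => (molConst l * eLpNorm u₀ 2 volume * IsLerayHopf.stressBound u₀ Du s).toReal)
    (fun s t => by simp only [resolvedProduct, mul_comm])
    (fun t' ht' t ht => by
      have hm := hu.memLp t' ht'
      have h1 := hu.integral_inner_mollify_eq hT hl hm (hu.isWeaklyDivFree hT ht') ht
      have h2 : ∫ x, inner ℝ (u₀ x) (mollify l (mollify l (u t')) x) =
          ∫ x, inner ℝ (u 0 x) (mollify l (mollify l (u t')) x) := by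
        refine integral_congr_ae ?_
        filter_upwards [hu.initial_value] with x hx
        rw [hx]
      rw [h2, integral_inner_mollify_mollify hl (hu.memLp t ht) hm,
        integral_inner_mollify_mollify hl (hu.memLp 0 h0) hm] at h1
      linarith)
    (fun t' ht' => hu.aestronglyMeasurable_stressPairing fun i j =>
      (memLp_mollifiedGrad hl (hu.memLp t' ht') i j).1)
    (hu.integrable_const_mul_stressBound hC)
    (by
      filter_upwards [hu.ae_norm_stressPairing_le hC] with s hs t' ht'
      have hm := hu.memLp t' ht'
      exact hs _ (memLp_mollifiedGrad hl hm) (memLp_top_mollifiedGrad hl hm)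
        ((sum_eLpNorm_mollifiedGrad_le hl hm).trans
          (mul_le_mul' le_rfl (hu.eLpNorm_le_init ht'))))
    (by
      filter_upwards [hu.ae_memLp_stress] with s hs
      exact (hu.weak_continuous _ (memLp_mollifiedDiv hl hs)).congr fun t' ht' =>
        stressPairing_mollifiedGrad hl hs (hu.memLp t' ht'))
    ht
  have hsub : Ioc 0 t ≤ᵐ[volume] Ioo 0 T :=
    (Ioc_subset_Ioc_right ht.2).eventuallyLE.trans Ioo_ae_eq_Ioc.symm.le
  have hae : ∀ᵐ s ∂(volume.restrict (Ioc 0 t)),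
      stressPairing (u s) (Du s) (mollifiedGrad l (u s)) =
        flux l (fun i x => u s x i) - dissipation l (Du s) := by
    filter_upwards [ae_mono (Measure.restrict_mono_ae hsub) hu.ae_isSolenoidalH1] with s hs
    exact hs.stressPairing_self hl
  refine ⟨(integrable_congr hae).1 hmain.1, ?_⟩
  rw [hmain.2, intervalIntegral.integral_of_le ht.1, intervalIntegral.integral_of_le ht.1,
    integral_congr_ae hae]

end IsLerayHopf

/-! ### Passage to the limit in the energy balance -/

lemma tendsto_integral_S_mul_S {f : E3 → ℝ} (hf : MemLp f 2 volume) :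
    Tendsto (fun n : ℕ => ∫ x, S (n + 1) f x * S (n + 1) f x) atTop (𝓝 (∫ x, f x * f x)) := by
  have h : ∀ n : ℕ, MemLp (S (n + 1) f) 2 volume := fun n => memLp_S (by positivity) one_le_two hf
  exact tendsto_integral_mul 2 2 one_le_two (Eventually.of_forall h) (Eventually.of_forall h) hf hf
    (tendsto_eLpNorm_S_nat one_le_two (by norm_num) hf)
    (tendsto_eLpNorm_S_nat one_le_two (by norm_num) hf)

lemma integral_norm_sq_eq_sum {ι : Type*} [Fintype ι] {D : E3 → EuclideanSpace ℝ ι}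
    (hD : MemLp D 2 volume) : ∫ x, ‖D x‖ ^ 2 = ∑ k, ∫ x, D x k * D x k := by
  have h : ∀ k ∈ Finset.univ, Integrable (fun x => D x k * D x k) := fun k _ =>
    (memLp_apply hD k).integrable_mul (memLp_apply hD k)
  rw [← integral_finsetSum _ h]
  simp only [EuclideanSpace.norm_sq_eq, Real.norm_eq_abs, sq_abs]
  simp only [pow_two]

lemma tendsto_resolvedProduct {v : E3 → E3} (hv : MemLp v 2 volume) :
    Tendsto (fun n : ℕ => resolvedProduct (n + 1) v v) atTop (𝓝 (∫ x, ‖v x‖ ^ 2)) := by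
  rw [integral_norm_sq_eq_sum hv]
  exact tendsto_finsetSum _ fun i _ => tendsto_integral_S_mul_S (memLp_apply hv i)

lemma tendsto_dissipation {D : E3 → EuclideanSpace ℝ (Fin 3 × Fin 3)} (hD : MemLp D 2 volume) :
    Tendsto (fun n : ℕ => dissipation (n + 1) D) atTop (𝓝 (∫ x, ‖D x‖ ^ 2)) := by
  rw [integral_norm_sq_eq_sum hD, Fintype.sum_prod_type]
  exact tendsto_finsetSum _ fun i _ => tendsto_finsetSum _ fun j _ =>
    tendsto_integral_S_mul_S (memLp_apply hD (i, j))

lemma enorm_dissipation_le {D : E3 → EuclideanSpace ℝ (Fin 3 × Fin 3)} (hD : MemLp D 2 volume)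
    {l : ℝ} (hl : 0 < l) : ‖dissipation l D‖ₑ ≤ 9 * eLpNorm D 2 volume ^ 2 := by
  refine enorm_sum_sum_le fun i j => ?_
  have hm := memLp_apply hD (i, j)
  have hS := memLp_S hl one_le_two hm
  have hle : eLpNorm (S l fun y => D y (i, j)) 2 volume ≤ eLpNorm D 2 volume :=
    (eLpNorm_S_le hl one_le_two hm.1).trans (eLpNorm_coord_le D 2 _)
  rw [pow_two]
  exact (enorm_integral_mul_le 2 2 hS.1 hS.1).trans (mul_le_mul' hle hle)

/-- Dominated convergence in the resolved balance. The flux vanishes in the limit at almost every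
time for any Leray–Hopf solution; the majorant `g` only permits the limit to be taken under the time
integral. -/
lemma IsLerayHopf.energy_equality_of_flux_bound {T : ℝ} {u₀ : E3 → E3} {u : ℝ → E3 → E3}
    {Du : ℝ → E3 → EuclideanSpace ℝ (Fin 3 × Fin 3)} (hu : IsLerayHopf T u₀ u Du) (hT : 0 < T)
    {g : ℝ → ℝ≥0∞} (hg : AEMeasurable g (volume.restrict (Ioo 0 T)))
    (hgint : ∫⁻ s in Ioo 0 T, g s < ⊤)
    (hflux : ∀ᵐ s ∂(volume.restrict (Ioo 0 T)), ∀ l : ℝ, 1 ≤ l →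
      ‖flux l (fun i x => u s x i)‖ₑ ≤ g s) {t : ℝ} (ht : t ∈ Icc 0 T) :
    1 / 2 * (∫ x, ‖u t x‖ ^ 2) + ∫ s in Ioo 0 t, ∫ x, ‖Du s x‖ ^ 2
        = 1 / 2 * ∫ x, ‖u₀ x‖ ^ 2 := by
  have hpos : ∀ n : ℕ, (0 : ℝ) < n + 1 := fun n => by positivity
  have hsub : Ioc 0 t ≤ᵐ[volume] Ioo 0 T :=
    (Ioc_subset_Ioc_right ht.2).eventuallyLE.trans Ioo_ae_eq_Ioc.symm.le
  have hle := Measure.restrict_mono_ae hsub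
  set B : ℝ → ℝ≥0∞ := fun s => g s + 9 * eLpNorm (Du s) 2 volume ^ 2 with hB
  have hBm : AEMeasurable B (volume.restrict (Ioo 0 T)) :=
    hg.add ((hu.aemeasurable_grad.pow_const 2).const_mul 9)
  have hBi : ∫⁻ s in Ioo 0 T, B s ≠ ⊤ := by
    rw [hB, lintegral_add_left' hg, lintegral_const_mul' _ _ (by norm_num)]
    exact (ENNReal.add_lt_top.2 ⟨hgint, ENNReal.mul_lt_top (by norm_num) hu.lintegral_grad_sq⟩).ne
  have hlim : Tendsto (fun n : ℕ => ∫ s in (0 : ℝ)..t,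
      (flux (n + 1) (fun i x => u s x i) - dissipation (n + 1) (Du s))) atTop
      (𝓝 (∫ s in (0 : ℝ)..t, -∫ x, ‖Du s x‖ ^ 2)) := by
    simp only [intervalIntegral.integral_of_le ht.1]
    refine tendsto_integral_of_dominated_convergence (fun s => (B s).toReal)
      (fun n => (hu.resolved_energy_balance hT (hpos n) ht).1.1)
      (Integrable.mono_measure (integrable_toReal_of_lintegral_ne_top hBm hBi) hle)
      (fun n => ?_) ?_
    · filter_upwards [ae_mono hle hflux, ae_mono hle hu.ae_memLp_grad,
        ae_mono hle (ae_lt_top' hBm hBi)] with s h1 h2 h3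
      have h4 : ‖flux (n + 1) (fun i x => u s x i) - dissipation (n + 1) (Du s)‖ₑ ≤ B s :=
        enorm_sub_le.trans (add_le_add (h1 _ (by simp)) (enorm_dissipation_le h2 (hpos n)))
      simpa using ENNReal.toReal_mono h3.ne h4
    · filter_upwards [ae_mono hle hu.ae_isSolenoidalH1, ae_mono hle hu.ae_memLp_grad] with s h1 h2
      have h3 : Tendsto (fun n : ℕ => flux ((n : ℝ) + 1) (fun i x => u s x i)) atTop (𝓝 0) :=
        h1.tendsto_flux.comp (tendsto_atTop_add_const_right _ _ tendsto_natCast_atTop_atTop)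
      simpa using h3.sub (tendsto_dissipation h2)
  have h0 : (0 : ℝ) ∈ Icc 0 T := ⟨le_rfl, hT.le⟩
  have hid := tendsto_nhds_unique
    ((tendsto_resolvedProduct (hu.memLp t ht)).sub (tendsto_resolvedProduct (hu.memLp 0 h0)))
    ((hlim.const_mul 2).congr fun n => (hu.resolved_energy_balance hT (hpos n) ht).2.symm)
  have hinit : ∫ x, ‖u 0 x‖ ^ 2 = ∫ x, ‖u₀ x‖ ^ 2 := by
    refine integral_congr_ae ?_
    filter_upwards [hu.initial_value] with x hx
    rw [hx]
  rw [intervalIntegral.integral_neg, intervalIntegral.integral_of_le ht.1,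
    integral_Ioc_eq_integral_Ioo, hinit] at hid
  linarith

/-! ### Hölder's inequality in time -/

section TimeHolder

variable {X : Type*} [MeasurableSpace X] {μ : Measure X}

lemma eLpNorm_rpow_lt_top {f : X → ℝ≥0∞} {p : ℝ≥0∞} (hp : p ≠ 0) (hf : eLpNorm f p μ < ⊤) {κ : ℝ}
    (hκ : 0 < κ) : eLpNorm (fun x => f x ^ κ) (p / ENNReal.ofReal κ) μ < ⊤ := by
  have hκ' : ENNReal.ofReal κ ≠ 0 := by simpa using hκ
  rcases eq_or_ne p ⊤ with rfl | hpt
  · rw [ENNReal.top_div_of_ne_top ENNReal.ofReal_ne_top, eLpNorm_exponent_top]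
    rw [eLpNorm_exponent_top] at hf
    refine (essSup_le_of_ae_le (eLpNormEssSup f μ ^ κ) ?_).trans_lt
      (ENNReal.rpow_lt_top_of_nonneg hκ.le hf.ne)
    filter_upwards [ae_le_eLpNormEssSup (f := f) (μ := μ)] with x hx
    exact ENNReal.rpow_le_rpow hx hκ.le
  · have hq0 : p / ENNReal.ofReal κ ≠ 0 := (ENNReal.div_pos hp ENNReal.ofReal_ne_top).ne'
    have hqt : p / ENNReal.ofReal κ ≠ ⊤ := ENNReal.div_ne_top hpt hκ'
    rw [eLpNorm_lt_top_iff_lintegral_rpow_enorm_lt_top hq0 hqt]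
    rw [eLpNorm_lt_top_iff_lintegral_rpow_enorm_lt_top hp hpt] at hf
    have e : κ * (p / ENNReal.ofReal κ).toReal = p.toReal := by
      rw [ENNReal.toReal_div, ENNReal.toReal_ofReal hκ.le]
      field_simp
    simpa only [enorm_eq_self, ← ENNReal.rpow_mul, e] using hf

lemma lintegral_mul_lt_top {f g : X → ℝ≥0∞} {p q : ℝ≥0∞} (hpq : p⁻¹ + q⁻¹ = 1)
    (hf : AEMeasurable f μ) (hg : AEMeasurable g μ) (hfp : eLpNorm f p μ < ⊤)
    (hgq : eLpNorm g q μ < ⊤) : ∫⁻ x, f x * g x ∂μ < ⊤ := by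
  have key : ∀ {f g : X → ℝ≥0∞}, eLpNorm f ⊤ μ < ⊤ → eLpNorm g 1 μ < ⊤ →
      ∫⁻ x, f x * g x ∂μ < ⊤ := by
    intro f g hf hg
    rw [eLpNorm_exponent_top] at hf
    rw [eLpNorm_one_eq_lintegral_enorm] at hg
    simp only [enorm_eq_self] at hg
    calc ∫⁻ x, f x * g x ∂μ ≤ ∫⁻ x, eLpNormEssSup f μ * g x ∂μ := by
          refine lintegral_mono_ae ?_
          filter_upwards [ae_le_eLpNormEssSup (f := f) (μ := μ)] with x hx
          exact mul_le_mul' hx le_rfl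
      _ = eLpNormEssSup f μ * ∫⁻ x, g x ∂μ := lintegral_const_mul' _ _ hf.ne
      _ < ⊤ := ENNReal.mul_lt_top hf hg
  rcases eq_or_ne p ⊤ with rfl | hpt
  · have : q = 1 := by simpa using hpq
    exact key hfp (this ▸ hgq)
  rcases eq_or_ne q ⊤ with rfl | hqt
  · have : p = 1 := by simpa using hpq
    simp only [mul_comm (f _)]
    exact key hgq (this ▸ hfp)
  have hp0 : p ≠ 0 := by rintro rfl; simp at hpq
  have hq0 : q ≠ 0 := by rintro rfl; simp at hpq
  have hc : p.toReal.HolderConjugate q.toReal := by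
    rw [Real.holderConjugate_iff]
    have h := congrArg ENNReal.toReal hpq
    rw [ENNReal.toReal_add (by simpa) (by simpa), ENNReal.toReal_inv, ENNReal.toReal_inv,
      ENNReal.toReal_one] at h
    have h1 := ENNReal.toReal_pos hp0 hpt
    have h2 := inv_pos.2 (ENNReal.toReal_pos hq0 hqt)
    exact ⟨(inv_lt_one₀ h1).1 (by linarith), h⟩
  refine (ENNReal.lintegral_mul_le_Lp_mul_Lq μ hc hf hg).trans_lt ?_
  rw [eLpNorm_lt_top_iff_lintegral_rpow_enorm_lt_top hp0 hpt] at hfp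
  rw [eLpNorm_lt_top_iff_lintegral_rpow_enorm_lt_top hq0 hqt] at hgq
  simp only [enorm_eq_self] at hfp hgq
  exact ENNReal.mul_lt_top (ENNReal.rpow_lt_top_of_nonneg (by positivity) hfp.ne)
    (ENNReal.rpow_lt_top_of_nonneg (by positivity) hgq.ne)

lemma eLpNorm_two_lt_top_of_sq {f : X → ℝ≥0∞} (hf : ∫⁻ x, f x ^ 2 ∂μ < ⊤) : eLpNorm f 2 μ < ⊤ := by
  rw [eLpNorm_lt_top_iff_lintegral_rpow_enorm_lt_top (by norm_num) (by norm_num)]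
  simpa using hf

/-- Hölder with exponents `p`, `q`, `2`: the squares of `f` and `g` lie in the conjugate spaces of
exponents `p/2` and `q/2`, so `f g` is in `L²`. Infinite exponents are covered. -/
lemma lintegral_mul_mul_lt_top {f g h : X → ℝ≥0∞} {p q : ℝ≥0∞} (hpq : 1 / p + 1 / q = 1 / 2)
    (hf : AEMeasurable f μ) (hg : AEMeasurable g μ) (hh : AEMeasurable h μ)
    (hfp : eLpNorm f p μ < ⊤) (hgq : eLpNorm g q μ < ⊤) (hh2 : ∫⁻ x, h x ^ 2 ∂μ < ⊤) :
    ∫⁻ x, f x * g x * h x ∂μ < ⊤ := by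
  simp only [one_div] at hpq
  have htop : (2 : ℝ≥0∞)⁻¹ ≠ ⊤ := ENNReal.inv_ne_top.2 two_ne_zero
  have hp0 : p ≠ 0 := by rintro rfl; simp [htop.symm] at hpq
  have hq0 : q ≠ 0 := by rintro rfl; simp [htop.symm] at hpq
  refine lintegral_mul_lt_top (p := 2) (q := 2) ENNReal.inv_two_add_inv_two (hf.mul hg) hh
    (eLpNorm_two_lt_top_of_sq ?_) (eLpNorm_two_lt_top_of_sq hh2)
  have h1 := eLpNorm_rpow_lt_top hp0 hfp two_pos
  have h2 := eLpNorm_rpow_lt_top hq0 hgq two_pos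
  simp only [ENNReal.rpow_two, ENNReal.ofReal_ofNat] at h1 h2
  simp only [mul_pow]
  refine lintegral_mul_lt_top ?_ (hf.pow_const 2) (hg.pow_const 2) h1 h2
  rw [ENNReal.inv_div (by simp) (by simp), ENNReal.inv_div (by simp) (by simp),
    div_eq_mul_inv, div_eq_mul_inv, ← mul_add, hpq, ENNReal.mul_inv_cancel (by simp) (by simp)]

/-- The power `h ^ κ` lies in the space of exponent `2/κ`, which is conjugate to `p` by the
hypothesis on `p⁻¹`. -/
lemma lintegral_mul_rpow_lt_top {f h : X → ℝ≥0∞} {p : ℝ≥0∞} {κ : ℝ} (hκ : 0 < κ) (hκ2 : κ ≤ 2)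
    (hp : p⁻¹ = ENNReal.ofReal (1 - κ / 2)) (hf : AEMeasurable f μ) (hh : AEMeasurable h μ)
    (hfp : eLpNorm f p μ < ⊤) (hh2 : ∫⁻ x, h x ^ 2 ∂μ < ⊤) :
    ∫⁻ x, f x * h x ^ κ ∂μ < ⊤ := by
  refine lintegral_mul_lt_top ?_ hf (hh.pow_const κ) hfp
    (eLpNorm_rpow_lt_top two_ne_zero (eLpNorm_two_lt_top_of_sq hh2) hκ)
  rw [ENNReal.inv_div (by simp) (by simp), hp, show (2 : ℝ≥0∞) = ENNReal.ofReal 2 by simp,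
    ← ENNReal.ofReal_div_of_pos two_pos, ← ENNReal.ofReal_add (by linarith) (by linarith)]
  simp

end TimeHolder

/-! ### Time-integrable bounds of the energy flux -/

lemma eLpNorm_horizontal_le (u : ℝ → E3 → E3) (s : ℝ) (p : ℝ≥0∞) :
    eLpNorm (fun x => u s x 0) p volume ≤ eLpNorm (horizontal u s) p volume ∧
    eLpNorm (fun x => u s x 1) p volume ≤ eLpNorm (horizontal u s) p volume :=
  ⟨eLpNorm_coord_le (horizontal u s) p 0, eLpNorm_coord_le (horizontal u s) p 1⟩

lemma eLpNorm_horizontalGrad_le (Du : ℝ → E3 → EuclideanSpace ℝ (Fin 3 × Fin 3)) (s : ℝ)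
    (p : ℝ≥0∞) :
    (∑ j, eLpNorm (fun x => Du s x (0, j)) p volume) + ∑ j, eLpNorm (fun x => Du s x (1, j)) p volume
      ≤ 6 * eLpNorm (horizontalGrad Du s) p volume := by
  have h : ∀ (i : Fin 2) (j : Fin 3), eLpNorm (fun x => Du s x (i.castSucc, j)) p volume ≤
      eLpNorm (horizontalGrad Du s) p volume := fun i j =>
    eLpNorm_coord_le (horizontalGrad Du s) p (i, j)
  calc _ ≤ (∑ _j : Fin 3, eLpNorm (horizontalGrad Du s) p volume) +
        ∑ _j : Fin 3, eLpNorm (horizontalGrad Du s) p volume :=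
        add_le_add (Finset.sum_le_sum fun j _ => h 0 j) (Finset.sum_le_sum fun j _ => h 1 j)
    _ = _ := by simp; ring

lemma sum_eLpNorm_grad_le (D : E3 → EuclideanSpace ℝ (Fin 3 × Fin 3)) (p : ℝ≥0∞) :
    ∑ i, ∑ j, eLpNorm (fun x => D x (i, j)) p volume ≤ 9 * eLpNorm D p volume := by
  calc _ ≤ ∑ _i : Fin 3, ∑ _j : Fin 3, eLpNorm D p volume :=
        Finset.sum_le_sum fun i _ => Finset.sum_le_sum fun j _ => eLpNorm_coord_le D p (i, j)
    _ = _ := by simp; ring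

/-- Interpolated Sobolev bound of the components of an `H¹` field. -/
lemma exists_sobolev_interpolation : ∃ C : ℝ≥0∞, C ≠ ⊤ ∧ ∀ (v : E3 → E3)
    (D : E3 → EuclideanSpace ℝ (Fin 3 × Fin 3)),
    IsSolenoidalH1 (fun i x => v x i) (fun i j x => D x (i, j)) → ∀ s : ℝ, 2 ≤ s → s ≤ 6 →
    ∀ i, eLpNorm (fun x => v x i) (ENNReal.ofReal s) volume ≤
      eLpNorm v 2 volume ^ (1 - 3 * (1 / 2 - 1 / s)) *
        (C * eLpNorm D 2 volume) ^ (3 * (1 / 2 - 1 / s)) := by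
  obtain ⟨C, hC, hS⟩ := exists_sobolev_const_H1
  refine ⟨C * 3, ENNReal.mul_ne_top hC (by norm_num), fun v D h s hs2 hs6 i => ?_⟩
  have h1 : 1 / s ≤ 1 / 2 := one_div_le_one_div_of_le two_pos hs2
  have h2 : 1 / 6 ≤ 1 / s := one_div_le_one_div_of_le (by linarith) hs6
  refine (eLpNorm_le_interpolation (h.isH1 i).memLp.1 hs2 hs6).trans (mul_le_mul'
    (ENNReal.rpow_le_rpow (eLpNorm_coord_le v 2 i) (by linarith))
    (ENNReal.rpow_le_rpow ((hS _ _ (h.isH1 i)).trans ?_) (by linarith)))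
  rw [mul_assoc]
  refine mul_le_mul' le_rfl ?_
  calc _ ≤ ∑ _j : Fin 3, eLpNorm D 2 volume :=
        Finset.sum_le_sum fun j _ => eLpNorm_coord_le D 2 (i, j)
    _ = _ := by simp

/-! ### Coordinates and time measurability of Besov norms. -/

section Besov

/-- The kernel of the `j`-th dyadic block, before dilation. -/
lemma memLp_lpBlock_kernel (P : DyadicPartition) (j : ℤ) :
    MemLp (fun y => invFourierReal P.phi ((2 : ℝ) ^ j • y)) 2 volume :=
  memLp_comp_smul (by positivity) (P.memLp_shellKernel 2)

lemma integrable_smul_comp_sub {ι : Type*} [Fintype ι] {K : E3 → ℝ} {f : E3 → EuclideanSpace ℝ ι}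
    (hK : MemLp K 2 volume) (hf : MemLp f 2 volume) (x : E3) :
    Integrable (fun y => K y • f (x - y)) := by
  have h : MemLp (fun y => f (x - y)) 2 volume :=
    hf.comp_measurePreserving (Measure.measurePreserving_sub_left volume x)
  exact memLp_one_iff_integrable.1 (h.smul hK)

/-- A continuous projection commutes with a Bochner integral of an integrable function; square
integrability of `f` and of the kernel provides the integrability at every point. -/
lemma lpBlock_coord (P : DyadicPartition) (j : ℤ) {ι : Type*} [Fintype ι]
    {f : E3 → EuclideanSpace ℝ ι} (hf : MemLp f 2 volume) (i : ι) :
    lpBlock P j (fun x => f x i) = fun x => lpBlock P j f x i := by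
  have h : ∀ {K : E3 → ℝ}, MemLp K 2 volume → ∀ x,
      ∫ y, K y • f (x - y) i = (∫ y, K y • f (x - y)) i := fun hK x => by
    have := (EuclideanSpace.proj (𝕜 := ℝ) i).integral_comp_comm (integrable_smul_comp_sub hK hf x)
    simpa using this
  ext x
  unfold lpBlock
  split_ifs
  · rfl
  · exact h (P.memLp_lowKernel 2) x
  · rw [h (memLp_lpBlock_kernel P j) x]
    rfl

lemma besovNorm_coord_le (P : DyadicPartition) (s : ℝ) (p : ℝ≥0∞) {ι : Type*} [Fintype ι]
    {f : E3 → EuclideanSpace ℝ ι} (hf : MemLp f 2 volume) (i : ι) :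
    besovNorm P s p (fun x => f x i) ≤ besovNorm P s p f := by
  refine iSup_mono fun j => mul_le_mul' le_rfl ?_
  rw [lpBlock_coord P j hf]
  exact eLpNorm_coord_le _ p i

variable {F : Type*} [NormedAddCommGroup F] [NormedSpace ℝ F]

lemma lpBlock_congr_ae (P : DyadicPartition) (j : ℤ) {f g : E3 → F} (h : f =ᵐ[volume] g) :
    lpBlock P j f = lpBlock P j g := by
  have hK : ∀ (K : E3 → ℝ) (x : E3), ∫ y, K y • f (x - y) = ∫ y, K y • g (x - y) := by
    intro K x
    refine integral_congr_ae ?_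
    filter_upwards [(Measure.measurePreserving_sub_left volume x).quasiMeasurePreserving.ae h]
      with y hy
    rw [hy]
  ext x
  simp only [lpBlock, hK]

lemma stronglyMeasurable_lpBlock (P : DyadicPartition) (j : ℤ) {f : ℝ × E3 → F}
    (hf : StronglyMeasurable f) :
    StronglyMeasurable (fun z : ℝ × E3 => lpBlock P j (fun x => f (z.1, x)) z.2) := by
  have h : ∀ {K : E3 → ℝ}, Continuous K →
      StronglyMeasurable (fun z : ℝ × E3 => ∫ y, K y • f (z.1, z.2 - y)) := fun hK =>
    StronglyMeasurable.integral_prod_right (f := fun (z : ℝ × E3) y => _ • f (z.1, z.2 - y))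
      ((hK.comp continuous_snd).stronglyMeasurable.smul
        (hf.comp_measurable (by fun_prop)))
  unfold lpBlock
  split_ifs
  · exact stronglyMeasurable_const
  · exact h P.isMultiplier_rho.contDiff.continuous
  · exact (h (P.isMultiplier_phi.contDiff.continuous.comp (continuous_const_smul _))).const_smul _

/-- The norm is a countable supremum, and the blocks do not change when `f t` is modified on a null
set, so a jointly measurable representative may be used. -/
lemma aemeasurable_besovNorm {μ : Measure ℝ} [SFinite μ] (P : DyadicPartition) (s : ℝ) (p : ℝ≥0∞)
    {f : ℝ → E3 → F} (hf : AEStronglyMeasurable (fun z : ℝ × E3 => f z.1 z.2) (μ.prod volume)) :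
    AEMeasurable (fun t => besovNorm P s p (f t)) μ := by
  refine AEMeasurable.iSup fun j => AEMeasurable.const_mul ?_ _
  obtain ⟨f', hf', hff'⟩ := hf
  refine (aemeasurable_eLpNorm_slice (f := fun t => lpBlock P j fun x => f' (t, x))
    (stronglyMeasurable_lpBlock P j hf').aestronglyMeasurable p).congr ?_
  filter_upwards [Measure.ae_ae_of_ae_prod hff'] with t ht
  rw [lpBlock_congr_ae P j ht]

end Besov

/-- The energy flux has a time-integrable majorant, uniformly in the mollification scale. -/
def HasFluxBound (T : ℝ) (u : ℝ → E3 → E3) : Prop :=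
  ∃ g : ℝ → ℝ≥0∞, AEMeasurable g (volume.restrict (Ioo 0 T)) ∧ ∫⁻ s in Ioo 0 T, g s < ⊤ ∧
    ∀ᵐ s ∂(volume.restrict (Ioo 0 T)), ∀ l : ℝ, 1 ≤ l → ‖flux l (fun i x => u s x i)‖ₑ ≤ g s

lemma add_pow_three_le (a b : ℝ≥0∞) : (a + b) ^ 3 ≤ 8 * (a ^ 3 + b ^ 3) := by
  have key : ∀ {a b : ℝ≥0∞}, a ≤ b → (a + b) ^ 3 ≤ 8 * (a ^ 3 + b ^ 3) := fun {a b} h => by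
    calc (a + b) ^ 3 ≤ (b + b) ^ 3 := pow_le_pow_left' (add_le_add h le_rfl) 3
      _ = 8 * b ^ 3 := by ring
      _ ≤ _ := mul_le_mul' le_rfl le_add_self
  rcases le_total a b with h | h
  · exact key h
  · rw [add_comm a, add_comm (a ^ 3)]
    exact key h

/-! ### Time-integrable flux majorants under each of the four conditions. -/

namespace IsLerayHopf

variable {T : ℝ} {u₀ : E3 → E3} {u : ℝ → E3 → E3}
  {Du : ℝ → E3 → EuclideanSpace ℝ (Fin 3 × Fin 3)}

lemma hasFluxBound_of_mixed (hu : IsLerayHopf T u₀ u Du) {p₁ q₁ p₂ q₂ : ℝ≥0∞}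
    (hp : 1 / p₁ + 1 / p₂ = 1 / 2) (hq : 1 / q₁ + 1 / q₂ = 1 / 2)
    (h1 : MemLpLq p₁ q₁ T (horizontal u)) (h4 : MemLpLq 4 4 T (horizontal u))
    (h2 : MemLpLq p₂ q₂ T (vertical u)) : HasFluxBound T u := by
  have hN := hu.aemeasurable_grad
  have m1 := aemeasurable_eLpNorm_slice h1.1 q₁
  have m4 := aemeasurable_eLpNorm_slice h4.1 4
  have m2 := aemeasurable_eLpNorm_slice h2.1 q₂
  have := holderTriple_four_four_two
  have : q₁.HolderTriple q₂ 2 := ⟨by simpa using hq⟩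
  refine ⟨fun s => 432 * (eLpNorm (horizontal u s) 4 volume * eLpNorm (horizontal u s) 4 volume *
      eLpNorm (Du s) 2 volume) + 216 * (eLpNorm (horizontal u s) q₁ volume *
      eLpNorm (vertical u s) q₂ volume * eLpNorm (Du s) 2 volume),
    (((m4.mul m4).mul hN).const_mul _).add (((m1.mul m2).mul hN).const_mul _), ?_, ?_⟩
  · have m444 : AEMeasurable (fun s => 432 * (eLpNorm (horizontal u s) 4 volume *
        eLpNorm (horizontal u s) 4 volume * eLpNorm (Du s) 2 volume))
        (volume.restrict (Ioo 0 T)) := ((m4.mul m4).mul hN).const_mul _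
    rw [lintegral_add_left' m444,
      lintegral_const_mul' _ _ (by norm_num), lintegral_const_mul' _ _ (by norm_num)]
    refine ENNReal.add_lt_top.2 ⟨ENNReal.mul_lt_top (by norm_num) ?_,
      ENNReal.mul_lt_top (by norm_num) ?_⟩
    · refine lintegral_mul_mul_lt_top (p := 4) (q := 4) ?_ m4 m4 hN h4.2 h4.2 hu.lintegral_grad_sq
      simpa using ENNReal.HolderTriple.inv_add_inv_eq_inv 4 4 2
    · exact lintegral_mul_mul_lt_top hp m1 m2 hN h1.2 h2.2 hu.lintegral_grad_sq
  · filter_upwards [hu.ae_isSolenoidalH1] with s hs l hl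
    -- The pair `(4, 4)` serves the products of two horizontal components, the pair `(q₁, q₂)` those
    -- containing the vertical one.
    refine (hs.enorm_flux_le 4 4 q₁ q₂ (by linarith)).trans ?_
    have a4 := eLpNorm_horizontal_le u s 4
    have a1 := eLpNorm_horizontal_le u s q₁
    calc _ ≤ 12 * (((eLpNorm (horizontal u s) 4 volume + eLpNorm (horizontal u s) 4 volume) *
            (eLpNorm (horizontal u s) 4 volume + eLpNorm (horizontal u s) 4 volume) +
          (eLpNorm (horizontal u s) q₁ volume + eLpNorm (horizontal u s) q₁ volume) *
            eLpNorm (vertical u s) q₂ volume) * (9 * eLpNorm (Du s) 2 volume)) := by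
          refine mul_le_mul' le_rfl (mul_le_mul' (add_le_add (mul_le_mul' ?_ ?_)
            (mul_le_mul' ?_ le_rfl)) (sum_eLpNorm_grad_le (Du s) 2))
          exacts [add_le_add a4.1 a4.2, add_le_add a4.1 a4.2, add_le_add a1.1 a1.2]
      _ = _ := by ring

/-- A bound of the flux by `‖H(s)‖ ‖∇u(s)‖^κ`, with `H` in the conjugate space. -/
lemma hasFluxBound_of_le (hu : IsLerayHopf T u₀ u Du) {h : ℝ → ℝ≥0∞} {p K : ℝ≥0∞} {κ : ℝ}
    (hK : K ≠ ⊤) (hκ : 0 < κ) (hκ2 : κ ≤ 2) (hp : p⁻¹ = ENNReal.ofReal (1 - κ / 2))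
    (hh : AEMeasurable h (volume.restrict (Ioo 0 T)))
    (hhp : eLpNorm h p (volume.restrict (Ioo 0 T)) < ⊤)
    (hle : ∀ᵐ s ∂(volume.restrict (Ioo 0 T)), ∀ l : ℝ, 1 ≤ l →
      ‖flux l (fun i x => u s x i)‖ₑ ≤ K * (h s * eLpNorm (Du s) 2 volume ^ κ)) :
    HasFluxBound T u := by
  refine ⟨_, (hh.mul (hu.aemeasurable_grad.pow_const κ)).const_mul K, ?_, hle⟩
  rw [lintegral_const_mul' _ _ hK]
  exact ENNReal.mul_lt_top hK.lt_top (lintegral_mul_rpow_lt_top hκ hκ2 hp hh hu.aemeasurable_grad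
    hhp hu.lintegral_grad_sq)

lemma hasFluxBound_of_velocity (hu : IsLerayHopf T u₀ u Du) {p q : ℝ≥0∞}
    (hpq : 2 / p + 3 / q = 1) (hq3 : 3 ≤ q) (hqt : q < ⊤)
    (h : MemLpLq p q T (horizontal u)) : HasFluxBound T u := by
  obtain ⟨C, hC, hS⟩ := exists_sobolev_interpolation
  set r := q.toReal with hr
  have hqr : q = ENNReal.ofReal r := (ENNReal.ofReal_toReal hqt.ne).symm
  have hr3 : 3 ≤ r := by simpa using ENNReal.toReal_mono hqt.ne hq3
  have hr0 : 0 < r := by linarith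
  have hrinv : 1 / r ≤ 1 / 3 := one_div_le_one_div_of_le (by norm_num) hr3
  have hrpos : 0 < 1 / r := by positivity
  have hqinv : q⁻¹ = ENNReal.ofReal (1 / r) := by
    rw [hqr, one_div, ENNReal.ofReal_inv_of_pos hr0]
  have hp0 : p ≠ 0 := fun h0 => by
    rw [h0, ENNReal.div_zero two_ne_zero, top_add] at hpq
    exact ENNReal.top_ne_one hpq
  have hpinv : p⁻¹ = ENNReal.ofReal (1 - (1 + 3 / r) / 2) := by
    rw [← ENNReal.ofReal_toReal (ENNReal.inv_ne_top.2 hp0)]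
    congr 1
    have h1 := congrArg ENNReal.toReal hpq
    rw [div_eq_mul_inv, div_eq_mul_inv, ENNReal.toReal_add, ENNReal.toReal_mul,
      ENNReal.toReal_mul, hqinv, ENNReal.toReal_ofReal hrpos.le] at h1
    · simp only [ENNReal.toReal_ofNat, ENNReal.toReal_one] at h1
      have : 3 / r = 3 * (1 / r) := by ring
      linarith
    · exact ENNReal.mul_ne_top (by simp) (ENNReal.inv_ne_top.2 hp0)
    · rw [hqinv]; exact ENNReal.mul_ne_top (by simp) ENNReal.ofReal_ne_top
  -- The Hölder partner of `q` for a product in `L²`. The range `3 ≤ q < ∞` corresponds to `2 < s ≤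
  -- 6`, the range of the Sobolev interpolation.
  set s : ℝ := (1 / 2 - 1 / r)⁻¹ with hs
  have hsi : 1 / s = 1 / 2 - 1 / r := by rw [hs, one_div, inv_inv]
  have hs0 : 0 < s := inv_pos.2 (by linarith)
  have hs2 : 2 ≤ s := by
    rw [hs, le_inv_comm₀ two_pos (by linarith)]; linarith
  have hs6 : s ≤ 6 := by
    rw [hs, inv_le_comm₀ (by linarith) (by norm_num)]; linarith
  have hθ : 3 * (1 / 2 - 1 / s) = 3 / r := by rw [hsi]; ring
  have hθ1 : 3 / r ≤ 1 := by rw [div_le_one hr0]; exact hr3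
  have hsum : q⁻¹ + (ENNReal.ofReal s)⁻¹ = 2⁻¹ := by
    rw [hqinv, ← ENNReal.ofReal_inv_of_pos hs0, ← one_div s, hsi,
      ← ENNReal.ofReal_add hrpos.le (by linarith), show (2 : ℝ≥0∞) = ENNReal.ofReal 2 by simp,
      ← ENNReal.ofReal_inv_of_pos two_pos]
    congr 1; ring
  have : q.HolderTriple (ENNReal.ofReal s) 2 := ⟨hsum⟩
  set E := eLpNorm u₀ 2 volume ^ (1 - 3 / r) * C ^ (3 / r) with hE
  have hEt : E ≠ ⊤ := ENNReal.mul_ne_top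
    (ENNReal.rpow_ne_top_of_nonneg (by linarith) hu.init_memLp.2.ne)
    (ENNReal.rpow_ne_top_of_nonneg (by positivity) hC)
  -- The power of `‖∇u‖₂` is one from the gradient in the flux and `3 / r` from interpolating the
  -- other velocity factor.
  refine hu.hasFluxBound_of_le (K := 648 * E) (κ := 1 + 3 / r)
    (ENNReal.mul_ne_top (by norm_num) hEt) (by positivity) (by linarith) hpinv
    (aemeasurable_eLpNorm_slice h.1 q) h.2 ?_
  filter_upwards [hu.ae_isSolenoidalH1, ae_mem_Icc] with t ht htT l hl
  set N := eLpNorm (Du t) 2 volume with hN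
  set H := eLpNorm (horizontal u t) q volume with hH
  have a1 := eLpNorm_horizontal_le u t q
  have hv : ∀ i, eLpNorm (fun x => u t x i) (ENNReal.ofReal s) volume ≤ E * N ^ (3 / r) := by
    intro i
    refine (hS _ _ ht s hs2 hs6 i).trans ?_
    rw [hθ, ENNReal.mul_rpow_of_nonneg _ _ (by positivity), ← mul_assoc]
    exact mul_le_mul' (mul_le_mul' (ENNReal.rpow_le_rpow (hu.eLpNorm_le_init htT)
      (by linarith)) le_rfl) le_rfl
  refine (ht.enorm_flux_le q (ENNReal.ofReal s) q (ENNReal.ofReal s) (by linarith)).trans ?_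
  calc _ ≤ 12 * (((H + H) * (E * N ^ (3 / r) + E * N ^ (3 / r)) + (H + H) * (E * N ^ (3 / r))) *
        (9 * N)) := by
        refine mul_le_mul' le_rfl (mul_le_mul' (add_le_add (mul_le_mul' (add_le_add a1.1 a1.2)
          (add_le_add (hv 0) (hv 1))) (mul_le_mul' (add_le_add a1.1 a1.2) (hv 2)))
          (sum_eLpNorm_grad_le (Du t) 2))
    _ = 648 * E * (H * (N ^ (1 : ℝ) * N ^ (3 / r))) := by rw [ENNReal.rpow_one]; ring
    _ = _ := by rw [ENNReal.rpow_add_of_nonneg _ _ zero_le_one (by positivity)]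

lemma hasFluxBound_of_gradient (hu : IsLerayHopf T u₀ u Du) {p q : ℝ≥0∞}
    (hpq : 2 / p + 3 / q = 2) (hq3 : 3 / 2 ≤ q) (hqt : q < ⊤)
    (h : MemLpLq p q T (horizontalGrad Du)) : HasFluxBound T u := by
  obtain ⟨C, hC, hS⟩ := exists_sobolev_interpolation
  set r := q.toReal with hr
  have hqr : q = ENNReal.ofReal r := (ENNReal.ofReal_toReal hqt.ne).symm
  have hr3 : 3 / 2 ≤ r := by simpa using ENNReal.toReal_mono hqt.ne hq3
  have hr0 : 0 < r := by linarith
  have hrinv : 1 / r ≤ 2 / 3 := by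
    have := one_div_le_one_div_of_le (by norm_num) hr3
    norm_num at this ⊢
    exact this
  have hrpos : 0 < 1 / r := by positivity
  have h3r : 3 / r = 3 * (1 / r) := by ring
  have hqinv : q⁻¹ = ENNReal.ofReal (1 / r) := by
    rw [hqr, one_div, ENNReal.ofReal_inv_of_pos hr0]
  have hp0 : p ≠ 0 := fun h0 => by
    rw [h0, ENNReal.div_zero two_ne_zero, top_add] at hpq
    exact ENNReal.top_ne_ofNat hpq
  have hpinv : p⁻¹ = ENNReal.ofReal (1 - (3 / r) / 2) := by
    rw [← ENNReal.ofReal_toReal (ENNReal.inv_ne_top.2 hp0)]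
    congr 1
    have h1 := congrArg ENNReal.toReal hpq
    rw [div_eq_mul_inv, div_eq_mul_inv, ENNReal.toReal_add, ENNReal.toReal_mul,
      ENNReal.toReal_mul, hqinv, ENNReal.toReal_ofReal hrpos.le] at h1
    · simp only [ENNReal.toReal_ofNat] at h1
      linarith
    · exact ENNReal.mul_ne_top (by simp) (ENNReal.inv_ne_top.2 hp0)
    · rw [hqinv]; exact ENNReal.mul_ne_top (by simp) ENNReal.ofReal_ne_top
  -- Two velocity factors and one gradient must satisfy `2/s + 1/q = 1`. The condition `q ≥ 3/2`
  -- says that `s ≤ 6`; interpolating both velocities produces the power `3 / r` of `‖∇u‖₂`.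
  set s : ℝ := (1 / 2 - 1 / r / 2)⁻¹ with hs
  have hsi : 1 / s = 1 / 2 - 1 / r / 2 := by rw [hs, one_div, inv_inv]
  have hs0 : 0 < s := inv_pos.2 (by linarith)
  have hs2 : 2 ≤ s := by
    rw [hs, le_inv_comm₀ two_pos (by linarith)]; linarith
  have hs6 : s ≤ 6 := by
    rw [hs, inv_le_comm₀ (by linarith) (by norm_num)]; linarith
  have hθ : 3 * (1 / 2 - 1 / s) = 3 / r / 2 := by rw [hsi]; ring
  have hθ1 : 3 / r ≤ 2 := by linarith
  have hsum : (ENNReal.ofReal s)⁻¹ + (ENNReal.ofReal s)⁻¹ + q⁻¹ = 1 := by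
    rw [hqinv, ← ENNReal.ofReal_inv_of_pos hs0, ← one_div s, hsi,
      ← ENNReal.ofReal_add (by linarith) (by linarith), ← ENNReal.ofReal_add (by linarith) hrpos.le,
      ← ENNReal.ofReal_one]
    congr 1; ring
  set E := eLpNorm u₀ 2 volume ^ (1 - 3 / r / 2) * C ^ (3 / r / 2) with hE
  have hEt : E ≠ ⊤ := ENNReal.mul_ne_top
    (ENNReal.rpow_ne_top_of_nonneg (by linarith) hu.init_memLp.2.ne)
    (ENNReal.rpow_ne_top_of_nonneg (by positivity) hC)
  refine hu.hasFluxBound_of_le (K := 9 * (2 + 4 * etaConst) * (54 * E ^ 2)) (κ := 3 / r)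
    (ENNReal.mul_ne_top (ENNReal.mul_ne_top (by norm_num) (ENNReal.add_ne_top.2 ⟨by norm_num,
      ENNReal.mul_ne_top (by norm_num) etaConst_ne_top⟩)) (ENNReal.mul_ne_top (by norm_num)
      (ENNReal.pow_ne_top hEt))) (by positivity) hθ1 hpinv
    (aemeasurable_eLpNorm_slice h.1 q) h.2 ?_
  filter_upwards [hu.ae_isSolenoidalH1, ae_mem_Icc] with t ht htT l hl
  set N := eLpNorm (Du t) 2 volume with hN
  set H := eLpNorm (horizontalGrad Du t) q volume with hH
  have hv : ∀ i, eLpNorm (fun x => u t x i) (ENNReal.ofReal s) volume ≤ E * N ^ (3 / r / 2) := by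
    intro i
    refine (hS _ _ ht s hs2 hs6 i).trans ?_
    rw [hθ, ENNReal.mul_rpow_of_nonneg _ _ (by positivity), ← mul_assoc]
    exact mul_le_mul' (mul_le_mul' (ENNReal.rpow_le_rpow (hu.eLpNorm_le_init htT)
      (by linarith)) le_rfl) le_rfl
  have hN2 : (N ^ (3 / r / 2)) ^ 2 = N ^ (3 / r) := by
    rw [← ENNReal.rpow_two, ← ENNReal.rpow_mul]
    congr 1; ring
  refine (ht.enorm_flux_le_grad hsum (by linarith)).trans ?_
  calc _ ≤ 9 * (2 + 4 * etaConst) * ((∑ _i : Fin 3, E * N ^ (3 / r / 2)) ^ 2 * (6 * H)) :=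
        mul_le_mul' le_rfl (mul_le_mul' (pow_le_pow_left' (Finset.sum_le_sum fun i _ => hv i) 2)
          (eLpNorm_horizontalGrad_le Du t q))
    _ = 9 * (2 + 4 * etaConst) * (54 * E ^ 2 * (H * (N ^ (3 / r / 2)) ^ 2)) := by
        simp only [Finset.sum_const, Finset.card_univ, Fintype.card_fin, nsmul_eq_mul]
        push_cast
        ring
    _ = _ := by rw [hN2]; ring

lemma hasFluxBound_of_besov (hu : IsLerayHopf T u₀ u Du) (P : DyadicPartition) {α β : ℝ}
    (hα : 1 / 3 ≤ α) (hα2 : α ≤ 1 / 2) (hβ : (1 - α) / 2 ≤ β)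
    (hh : MemLpBesov P 3 α 3 T (horizontal u)) (hv : MemLpBesov P 3 β 3 T (vertical u)) :
    HasFluxBound T u := by
  -- The vertical regularity is lowered to the smallest admissible index, which lies strictly
  -- between zero and one, as the increment estimate demands; `β` itself may be large.
  set γ := (1 - α) / 2 with hγ
  obtain ⟨C₁, hC₁, h₁⟩ := exists_increment_le_besovNorm P (s := α) (by linarith) (by linarith)
  obtain ⟨C₂, hC₂, h₂⟩ := exists_increment_le_besovNorm P (s := γ) (by linarith) (by linarith)
  set C₃ := C₂ * ENNReal.ofReal (2 ^ (β - γ)) with hC₃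
  have hC₃t : C₃ ≠ ⊤ := ENNReal.mul_ne_top hC₂ ENNReal.ofReal_ne_top
  have mh := aemeasurable_besovNorm P α 3 hh.1
  have mv := aemeasurable_besovNorm P β 3 hv.1
  have hcube : ∀ {f : ℝ → ℝ≥0∞}, eLpNorm f 3 (volume.restrict (Ioo 0 T)) < ⊤ →
      ∫⁻ s in Ioo 0 T, f s ^ 3 < ⊤ := fun hf => by
    rw [eLpNorm_lt_top_iff_lintegral_rpow_enorm_lt_top (by norm_num) (by norm_num)] at hf
    have e : ∀ x : ℝ≥0∞, x ^ (3 : ℝ) = x ^ 3 := fun x => by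
      rw [← ENNReal.rpow_natCast]; norm_num
    simpa [e] using hf
  have hconst : 288 * etaConst * 8 ≠ ⊤ :=
    ENNReal.mul_ne_top (ENNReal.mul_ne_top (by norm_num) etaConst_ne_top) (by norm_num)
  refine ⟨fun s => 288 * etaConst * 8 * (C₁ ^ 3 * besovNorm P α 3 (horizontal u s) ^ 3 +
    C₃ ^ 3 * besovNorm P β 3 (vertical u s) ^ 3),
    (((mh.pow_const 3).const_mul _).add ((mv.pow_const 3).const_mul _)).const_mul _, ?_, ?_⟩
  · rw [lintegral_const_mul' _ _ hconst, lintegral_add_left' ((mh.pow_const 3).const_mul _),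
      lintegral_const_mul' _ _ (ENNReal.pow_ne_top hC₁),
      lintegral_const_mul' _ _ (ENNReal.pow_ne_top hC₃t)]
    exact ENNReal.mul_lt_top hconst.lt_top (ENNReal.add_lt_top.2
      ⟨ENNReal.mul_lt_top (ENNReal.pow_ne_top hC₁).lt_top (hcube hh.2),
        ENNReal.mul_lt_top (ENNReal.pow_ne_top hC₃t).lt_top (hcube hv.2)⟩)
  · filter_upwards [hu.ae_isSolenoidalH1, ae_mem_Icc] with t ht htT l hl
    set A := C₁ * besovNorm P α 3 (horizontal u t) + C₃ * besovNorm P β 3 (vertical u t) with hA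
    have hmem : ∀ i, MemLp (fun x => u t x i) 2 volume := fun i => (ht.isH1 i).memLp
    have hhm : MemLp (horizontal u t) 2 volume := by
      refine MemLp.of_eval_piLp fun i => hmem i.castSucc
    have hinc : ∀ (i : Fin 2) (y : E3),
        eLpNorm (fun x => u t (x - y) i.castSucc - u t x i.castSucc) 3 volume ≤
          A * ENNReal.ofReal (‖y‖ ^ α) := fun i y => by
      refine (h₁ _ (hmem i.castSucc) y).trans (mul_le_mul' (le_trans ?_ le_self_add) le_rfl)
      exact mul_le_mul' le_rfl (besovNorm_coord_le P α 3 hhm i)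
    have hinc2 : ∀ y : E3, eLpNorm (fun x => u t (x - y) 2 - u t x 2) 3 volume ≤
        A * ENNReal.ofReal (‖y‖ ^ γ) := fun y => by
      refine (h₂ _ (hmem 2) y).trans (mul_le_mul' (le_trans ?_ le_add_self) le_rfl)
      rw [hC₃, mul_assoc]
      exact mul_le_mul' le_rfl (besovNorm_mono P hβ 3 _)
    -- The exponents balance because `α + 2γ = 1`, while `2α + γ = (1 + 3α)/2` and `3α` are at least
    -- one by `α ≥ 1/3`.
    have hflux := ht.enorm_flux_le_increments (e := ![α, α, γ]) (A := A)
      (by intro i; fin_cases i <;> simp <;> linarith)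
      (by intro i; fin_cases i <;> simp <;> linarith)
      (by
        intro i j k h
        fin_cases i <;> fin_cases j <;> fin_cases k <;> simp at h ⊢ <;> linarith)
      (by
        intro i y
        fin_cases i
        exacts [hinc 0 y, hinc 1 y, hinc2 y]) hl
    refine hflux.trans ?_
    calc 288 * etaConst * A ^ 3 ≤ 288 * etaConst * (8 * _) :=
          mul_le_mul' le_rfl (add_pow_three_le _ _)
      _ = _ := by ring

end IsLerayHopf

end AnisoNS

end

theorem theorem1p4 (T : ℝ) (hT : 0 < T)
    (u₀ : AnisoNS.E3 → AnisoNS.E3) (u : ℝ → AnisoNS.E3 → AnisoNS.E3)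
    (Du : ℝ → AnisoNS.E3 → EuclideanSpace ℝ (Fin 3 × Fin 3))
    (hu : AnisoNS.IsLerayHopf T u₀ u Du)
    (hcond :
      (∃ p₁ q₁ p₂ q₂ : ℝ≥0∞,
        1 / p₁ + 1 / p₂ = 1 / 2 ∧ 1 / q₁ + 1 / q₂ = 1 / 2 ∧
        AnisoNS.MemLpLq p₁ q₁ T (AnisoNS.horizontal u) ∧
        AnisoNS.MemLpLq 4 4 T (AnisoNS.horizontal u) ∧
        AnisoNS.MemLpLq p₂ q₂ T (AnisoNS.vertical u)) ∨
      (∃ p q : ℝ≥0∞,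
        2 / p + 3 / q = 1 ∧ 3 ≤ q ∧ q < ⊤ ∧
        AnisoNS.MemLpLq p q T (AnisoNS.horizontal u)) ∨
      (∃ p q : ℝ≥0∞,
        2 / p + 3 / q = 2 ∧ 3 / 2 ≤ q ∧ q < ⊤ ∧
        AnisoNS.MemLpLq p q T (AnisoNS.horizontalGrad Du)) ∨
      (∃ (P : AnisoNS.DyadicPartition) (α β : ℝ),
        1 / 3 ≤ α ∧ α ≤ 1 / 2 ∧ (1 - α) / 2 ≤ β ∧
        AnisoNS.MemLpBesov P 3 α 3 T (AnisoNS.horizontal u) ∧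
        AnisoNS.MemLpBesov P 3 β 3 T (AnisoNS.vertical u))) :
    ∀ t ∈ Icc 0 T,
      1 / 2 * (∫ x, ‖u t x‖ ^ 2) + ∫ s in Ioo 0 t, ∫ x, ‖Du s x‖ ^ 2
        = 1 / 2 * ∫ x, ‖u₀ x‖ ^ 2 := by
  have hbound : AnisoNS.HasFluxBound T u := by
    rcases hcond with ⟨p₁, q₁, p₂, q₂, hp, hq, h1, h4, h2⟩ | ⟨p, q, hpq, hq, hqt, h⟩ |
      ⟨p, q, hpq, hq, hqt, h⟩ | ⟨P, α, β, hα, hα2, hβ, hh, hv⟩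
    · exact hu.hasFluxBound_of_mixed hp hq h1 h4 h2
    · exact hu.hasFluxBound_of_velocity hpq hq hqt h
    · exact hu.hasFluxBound_of_gradient hpq hq hqt h
    · exact hu.hasFluxBound_of_besov P hα hα2 hβ hh hv
  obtain ⟨g, hg, hgint, hflux⟩ := hbound
  exact fun t ht => hu.energy_equality_of_flux_bound hT hg hgint hflux ht
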